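/- Let $\omega_n=n+2$ and let $$e_n(x)=\frac{\sqrt{\omega_n\Gamma(1+n)\Gamma(4+n)}}{2\sqrt2\,\Gamma(\frac52+n)}\,P_n^{(3/2,3/2)}(\cos x),\qquad n\ge 0,$$ where $P_n^{(3/2,3/2)}$ are the Jacobi polynomials; these are the orthonormal eigenfunctions in $L^2((0,\pi);\sin^4x\,dx)$ of the linearized spherically symmetric Yang--Mills operator $-\sin^{-4}x\,\partial_x(\sin^4x\,\partial_x\cdot)+4$ with eigenvalues $\omega_n^2$. Put $$\overline C_{ijm}=\int_0^\pi e_ie_je_m\sin^4x\,dx,\qquad C_{ijkm}=\int_0^\pi e_ie_je_ke_m\sin^6x\,dx .$$ For $s\in\mathbb N$ let $l^2_s$ be the Hilbert space of real sequences $u=(u^j)_{j\ge0}$ with norm $|u|_s^2=\sum_j (1+j)^{2s}|u^j|^2<\infty$. Let $\Phi^t(\xi)=(\xi^n\cos(\omega_nt))_n$, $(f^{(3)}(u))^m=-\sum_{i,j,k}C_{ijkm}u^iu^ju^k$, $\langle f^{(3)}\rangle(\xi)=\frac1{2\pi}\int_0^{2\pi}\Phi^t[f^{(3)}(\Phi^t(\xi))]\,dt$,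 and $$(F_0(\xi))^m=\frac94\sum_{d}\ \sum_{\kappa,\nu\ge0}\overline C_{\kappa\nu m}\sum_{\substack{i,j\ge 0\\ d\ne\pm\omega_\nu}}\frac{\overline C_{ij\nu}}{\omega_\nu^2-d^2}\,\xi^i\xi^j\xi^\kappa\,\#\{(\sigma,\tau)\in\{\pm1\}^2:\ d+\sigma\omega_\kappa+\tau\omega_m=0\},$$ where $d$ takes the two values $d=\omega_i-\omega_j$ and $d=\omega_i+\omega_j$. Define $(M_-(\xi))^m=-\omega_m^2\xi^m+(\langle f^{(3)}\rangle(\xi))^m+(F_0(\xi))^m$. Let $\gamma\in\{0,1,2,3,4,5\}$, let $s\ge3$ be an integer, and put $$q_\gamma=\frac94\sum_{\nu=0}^{2\gamma}(\overline C_{\gamma\gamma\nu})^2\Big(\frac2{\omega_\nu^2}+\frac1{\omega_\nu^2-(2\omega_\gamma)^2}\Big),\qquad K_\gamma=\pm2\omega_\gamma\sqrt{\frac{2}{8q_\gamma-3C_{\gamma\gamma\gamma\gamma}}},\qquad \xi=(K_\gamma\mathbf 1(m=\gamma))_{m\ge0}.$$ For a constant $c$ and $m\ge0$ let $$u_{\gamma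 m}=\Big(\frac{\omega_m}{K_\gamma}\Big)^2+\frac34C_{\gamma\gamma mm}-\frac92\sum_{\nu=0}^{m+\gamma}\frac{(\overline C_{\gamma\nu m})^2}{\omega_\nu^2-(\omega_m+\omega_\gamma)^2}-c\sum_{\nu=0}^{2\gamma}\frac{\overline C_{m\nu m}\overline C_{\gamma\gamma\nu}}{\omega_\nu^2}-\frac92\sum_{\substack{\nu=0\\ \nu\ne\pm(m-\gamma)-2}}^{m+\gamma}\frac{(\overline C_{m\gamma\nu})^2}{\omega_\nu^2-(\omega_m-\omega_\gamma)^2},$$ for $0\le m\le2\gamma$ let $$v_{\gamma m}=\frac38C_{\gamma,2\gamma-m,\gamma,m}-\frac94\sum_{\nu=0}^{2\gamma}\frac{\overline C_{2\gamma-m,\nu,m}\overline C_{\gamma\gamma\nu}}{\omega_\nu^2-(2\omega_\gamma)^2}-\frac92\sum_{\substack{\nu=0\\ \nu\ne\pm(m-\gamma)-2}}^{m+\gamma}\frac{\overline C_{\gamma\nu m}\overline C_{2\gamma-m,\gamma,\nu}}{\omega_\nu^2-(\omega_{2\gamma-m}-\omega_\gamma)^2},$$ and for $0\le n<\gamma$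 let $D_{\gamma n}=u_{\gamma n}u_{\gamma,2\gamma-n}-v_{\gamma n}v_{\gamma,2\gamma-n}$. Then: 1. $8q_\gamma>3C_{\gamma\gamma\gamma\gamma}$, so that $K_\gamma$ is a well-defined non-zero real number. 2. $M_-$ maps $l^2_{s+3}$ into $l^2_{s+1}$, $M_-(\xi)=0$, $M_-$ is Fréchet differentiable at $\xi$, and $\ker dM_-(\xi)=\{0\}$. Moreover, with $c=\frac92$, $(dM_-(\xi)[h])^m=-K_\gamma^2\big(u_{\gamma m}h^m+\mathbf 1(m\le2\gamma)\,v_{\gamma m}h^{2\gamma-m}\big)$ for all $h\in l^2_{s+3}$ and $m\ge0$. 3. Equivalently to $\ker dM_-(\xi)=\{0\}$, with $c=\frac92$: $u_{\gamma\gamma}+v_{\gamma\gamma}\ne0$; $u_{\gamma m}\ne0$ for all $m\ge2\gamma+1$; and $D_{\gamma n}\ne0$ for all $0\le n<\gamma$. 4. The three conditions in 3 also hold with $c=\frac94$. -/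

import Mathlib

noncomputable section

namespace YM

/-- The frequencies `ω_n = n + 2` of the linearized Yang-Mills operator
`L u = - sin⁻⁴ x ∂ₓ (sin⁴ x ∂ₓ u) + 4 u` on `(0, π)`, as integers. -/
def freq (n : ℕ) : ℤ := n + 2

/-- The Jacobi polynomial `P_n^{(α, β)}` (for `α, β > -1/2`, so that no Gamma value below is at a pole). -/
def jacobiP (α β : ℝ) (n : ℕ) (x : ℝ) : ℝ :=
  Real.Gamma (α + n + 1) / ((n.factorial : ℝ) * Real.Gamma (α + β + n + 1)) *
    ∑ k ∈ Finset.range (n + 1),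
      (n.choose k : ℝ) * (Real.Gamma (α + β + n + k + 1) / Real.Gamma (α + k + 1)) *
        ((x - 1) / 2) ^ k

/-- The normalization constant of the `n`-th eigenfunction. -/
def normConst (n : ℕ) : ℝ :=
  Real.sqrt ((freq n : ℝ) * Real.Gamma (1 + n) * Real.Gamma (4 + n)) /
    (2 * Real.sqrt 2 * Real.Gamma (5 / 2 + n))

/-- The eigenfunctions, orthonormal in `L² ((0, π); sin⁴ x dx)`. -/
def eigenfun (n : ℕ) (x : ℝ) : ℝ :=
  normConst n * jacobiP (3 / 2) (3 / 2) n (Real.cos x)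

/-- The Fourier coefficients of the quadratic nonlinearity. -/
def cbar (i j m : ℕ) : ℝ :=
  ∫ x in (0 : ℝ)..Real.pi,
    eigenfun i x * eigenfun j x * eigenfun m x * Real.sin x ^ 4

/-- The Fourier coefficients of the cubic nonlinearity. -/
def ccub (i j k m : ℕ) : ℝ :=
  ∫ x in (0 : ℝ)..Real.pi,
    eigenfun i x * eigenfun j x * eigenfun k x * eigenfun m x * Real.sin x ^ 6

/-- The underlying vector space of the weighted sequence space `l²_s`: all real sequences `u`
with `∑_j ((j + 1)^s u_j)² < ∞`. -/
def weightedSubmodule (s : ℕ) : Submodule ℝ (ℕ → ℝ) where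
  carrier := {u | Memℓp (fun j : ℕ => ((j : ℝ) + 1) ^ s * u j) 2}
  add_mem' := by
    intro u v hu hv
    have h := Memℓp.add hu hv
    have e : (fun j : ℕ => ((j : ℝ) + 1) ^ s * (u + v) j) =
        (fun j : ℕ => ((j : ℝ) + 1) ^ s * u j) + (fun j : ℕ => ((j : ℝ) + 1) ^ s * v j) := by
      funext j
      simp [mul_add]
    simpa only [Set.mem_ofPred_eq, e] using h
  zero_mem' := by
    have e : (fun j : ℕ => ((j : ℝ) + 1) ^ s * (0 : ℕ → ℝ) j) = 0 := by
      funext j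
      simp
    simp only [Set.mem_ofPred_eq, e]
    exact zero_memℓp
  smul_mem' := by
    intro c u hu
    have h := Memℓp.const_smul hu c
    have e : (fun j : ℕ => ((j : ℝ) + 1) ^ s * (c • u) j) =
        c • (fun j : ℕ => ((j : ℝ) + 1) ^ s * u j) := by
      funext j
      simp only [Pi.smul_apply, smul_eq_mul]
      ring
    simpa only [Set.mem_ofPred_eq, e] using h

/-- The weighted sequence space `l²_s`. It is a type of its own, so that it carries the
topology of its norm and not the product topology. -/
def WeightedSeq (s : ℕ) : Type := weightedSubmodule s

instance (s : ℕ) : AddCommGroup (WeightedSeq s) :=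
  inferInstanceAs (AddCommGroup (weightedSubmodule s))

instance (s : ℕ) : Module ℝ (WeightedSeq s) :=
  inferInstanceAs (Module ℝ (weightedSubmodule s))

instance (s : ℕ) : CoeFun (WeightedSeq s) (fun _ => ℕ → ℝ) := ⟨fun u => u.1⟩

/-- The linear map `u ↦ ((j + 1)^s u_j)_j` into `ℓ²`, from which `l²_s` gets its norm. -/
def toEll2 (s : ℕ) : WeightedSeq s →ₗ[ℝ] lp (fun _ : ℕ => ℝ) 2 where
  toFun u := ⟨fun j : ℕ => ((j : ℝ) + 1) ^ s * u j, u.2⟩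
  map_add' := by
    intro u v
    ext j
    exact mul_add _ _ _
  map_smul' := by
    intro c u
    ext j
    exact mul_left_comm _ _ _

theorem toEll2_injective (s : ℕ) : Function.Injective (toEll2 s) := by
  intro u v h
  apply Subtype.ext
  funext j
  have hj : ((j : ℝ) + 1) ^ s * u j = ((j : ℝ) + 1) ^ s * v j :=
    congrFun (congrArg (fun w : lp (fun _ : ℕ => ℝ) 2 => (w : ℕ → ℝ)) h) j
  exact mul_left_cancel₀ (by positivity) hj

instance (s : ℕ) : NormedAddCommGroup (WeightedSeq s) :=
  NormedAddCommGroup.induced _ _ (toEll2 s) (toEll2_injective s)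

instance (s : ℕ) : NormedSpace ℝ (WeightedSeq s) :=
  NormedSpace.induced ℝ _ _ (toEll2 s)

/-- The 1-mode `K e_γ`, i.e. the sequence with entry `K` at `γ` and `0` elsewhere. -/
def mode (s γ : ℕ) (K : ℝ) : WeightedSeq s :=
  ⟨fun m => if m = γ then K else 0, by
    change Memℓp (fun j : ℕ => ((j : ℝ) + 1) ^ s * (if j = γ then K else 0)) 2
    apply memℓp_gen
    refine summable_of_ne_finset_zero (s := {γ}) ?_
    intro j hj
    have hj' : j ≠ γ := by simpa using hj
    simp [hj']⟩

/-- The linear flow, the solution of `u_n'' + ω_n² u_n = 0`, `u(0) = ξ`, `u'(0) = 0`. -/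
def flow (t : ℝ) (ξ : ℕ → ℝ) (n : ℕ) : ℝ := ξ n * Real.cos ((freq n : ℝ) * t)

/-- The cubic part of the nonlinearity in Fourier space. -/
def f3 (u : ℕ → ℝ) (m : ℕ) : ℝ :=
  -∑' p : ℕ × ℕ × ℕ, ccub p.1 p.2.1 p.2.2 m * u p.1 * u p.2.1 * u p.2.2

/-- The average of the cubic nonlinearity along the linear flow. -/
def avgF3 (ξ : ℕ → ℝ) (m : ℕ) : ℝ :=
  1 / (2 * Real.pi) * ∫ t in (0 : ℝ)..(2 * Real.pi), flow t (f3 (flow t ξ)) m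

/-- The number of choices of the two signs for which `a ± b ± c = 0`. -/
def signCount (a b c : ℤ) : ℝ :=
  (if a + b + c = 0 then 1 else 0) + (if a + b - c = 0 then 1 else 0) +
    (if a - b + c = 0 then 1 else 0) + (if a - b - c = 0 then 1 else 0)

/-- One summand `C̄_{κνm} C̄_{ijν} / (ω_ν² - d²) ξ_i ξ_j ξ_κ ∑_± 1(d ± ω_κ ± ω_m = 0)`, set to
zero if `d = ± ω_ν`; here `d` is going to be `ω_i - ω_j` or `ω_i + ω_j`. -/
def backreactionTerm (ξ : ℕ → ℝ) (m κ ν i j : ℕ) (d : ℤ) : ℝ :=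
  if d ≠ freq ν ∧ d ≠ -freq ν then
    cbar κ ν m * (cbar i j ν / ((freq ν : ℝ) ^ 2 - (d : ℝ) ^ 2)) *
      (ξ i * ξ j * ξ κ) * signCount d (freq κ) (freq m)
  else 0

/-- The contribution `𝔉₀` of the quadratic nonlinearity to the resonant operator. -/
def backreaction (ξ : ℕ → ℝ) (m : ℕ) : ℝ :=
  9 / 4 * ∑' p : ℕ × ℕ × ℕ × ℕ, backreactionTerm ξ m p.1 p.2.1 p.2.2.1 p.2.2.2
      (freq p.2.2.1 - freq p.2.2.2) +
  9 / 4 * ∑' p : ℕ × ℕ × ℕ × ℕ, backreactionTerm ξ m p.1 p.2.1 p.2.2.1 p.2.2.2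
      (freq p.2.2.1 + freq p.2.2.2)

/-- The modified resonant operator `M₋ ξ = - A ξ + ⟨f⁽³⁾⟩(ξ) + 𝔉₀(ξ)`. -/
def Mminus (ξ : ℕ → ℝ) (m : ℕ) : ℝ :=
  -((freq m : ℝ) ^ 2 * ξ m) + avgF3 ξ m + backreaction ξ m

/-- The constant `𝔮_γ`. -/
def q (γ : ℕ) : ℝ :=
  9 / 4 * ∑ ν ∈ Finset.range (2 * γ + 1), cbar γ γ ν ^ 2 *
    (2 / (freq ν : ℝ) ^ 2 + 1 / ((freq ν : ℝ) ^ 2 - (2 * (freq γ : ℝ)) ^ 2))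

/-- The positive choice of the amplitude `𝔎_γ`. -/
def amplitude (γ : ℕ) : ℝ :=
  2 * (freq γ : ℝ) * Real.sqrt (2 / (8 * q γ - 3 * ccub γ γ γ γ))

/-- The indices `0 ≤ ν ≤ m + γ` with `ν ≠ ±(m - γ) - 2`. -/
def nonresonantRange (γ m : ℕ) : Finset ℕ :=
  (Finset.range (m + γ + 1)).filter fun ν =>
    (ν : ℤ) ≠ ((m : ℤ) - γ) - 2 ∧ (ν : ℤ) ≠ -((m : ℤ) - γ) - 2

/-- The diagonal coefficient `𝔲_{γm}`, with the factor `c` in front of its second sum. -/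
def coeffU (c : ℝ) (γ m : ℕ) : ℝ :=
  ((freq m : ℝ) / amplitude γ) ^ 2 + 3 / 4 * ccub γ γ m m
    - 9 / 2 * ∑ ν ∈ Finset.range (m + γ + 1),
        cbar γ ν m ^ 2 / ((freq ν : ℝ) ^ 2 - ((freq m : ℝ) + freq γ) ^ 2)
    - c * ∑ ν ∈ Finset.range (2 * γ + 1), cbar m ν m * cbar γ γ ν / (freq ν : ℝ) ^ 2
    - 9 / 2 * ∑ ν ∈ nonresonantRange γ m,
        cbar m γ ν ^ 2 / ((freq ν : ℝ) ^ 2 - ((freq m : ℝ) - freq γ) ^ 2)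

/-- The off-diagonal coefficient `𝔳_{γm}`, used for `m ≤ 2 γ` only. -/
def coeffV (γ m : ℕ) : ℝ :=
  3 / 8 * ccub γ (2 * γ - m) γ m
    - 9 / 4 * ∑ ν ∈ Finset.range (2 * γ + 1),
        cbar (2 * γ - m) ν m * cbar γ γ ν / ((freq ν : ℝ) ^ 2 - (2 * (freq γ : ℝ)) ^ 2)
    - 9 / 2 * ∑ ν ∈ nonresonantRange γ m,
        cbar γ ν m * cbar (2 * γ - m) γ ν /
          ((freq ν : ℝ) ^ 2 - ((freq (2 * γ - m) : ℝ) - freq γ) ^ 2)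

/-- The determinant `𝔇_{γn}`, for `n < γ`. -/
def coeffD (c : ℝ) (γ n : ℕ) : ℝ :=
  coeffU c γ n * coeffU c γ (2 * γ - n) - coeffV γ n * coeffV γ (2 * γ - n)

/-- The non-degeneracy inequalities. -/
def NondegeneracyInequalities (c : ℝ) (γ : ℕ) : Prop :=
  coeffU c γ γ + coeffV γ γ ≠ 0 ∧
  (∀ m : ℕ, 2 * γ + 1 ≤ m → coeffU c γ m ≠ 0) ∧
  (∀ n : ℕ, n < γ → coeffD c γ n ≠ 0)

end YM

end

noncomputable section

namespace YM

open Polynomial Finset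

/-! Up to normalization the eigenfunctions are Gegenbauer polynomials, that is, derivatives of
Chebyshev polynomials `U`, so every coefficient can be computed exactly. Indexed by frequencies `a =
ω_i`, `b = ω_j`, `c = ω_m`, the integral of three of them is π/8 times the squared area of the
triangle with sides `a`, `b`, `c` (`triple_eq`): both sides satisfy the same recurrence. For the
quartic coefficients two factors always have index γ, and sin⁶ times the other two is a short cosine
sum, so an integer formula in the Fourier coefficients of one square suffices (`ccub_eq`). The
square roots in the normalization and in the amplitude occur only in combinations that become
rational, and `q`, `u`, `D` and `u + v` turn into powers of 8/π times computable rational numbers.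

For γ ≤ 5 the non-degeneracy conditions are then finitely many rational checks, except `u_{γm} ≠ 0`
for all m > 2γ. There Heron's formula cancels the resonant denominators, the remaining pole
telescopes, and `u`, times a positive factor, is a polynomial in m; in t = m - 2γ - 1 it has no
negative coefficients (`zQ_mul_uQ_eq`, `uQ_pos`).

The nonlinearity is a trilinear series. Growth bounds and the triangle selection rule give
`TriBound`, whence boundedness `l²_{t+2} → l²_t` through weighted ℓ¹ and weighted maximum norms. The
operator is thus a bounded linear map plus the diagonal of a continuous trilinear map, and its
derivative is the sum over the three slots. At a one-mode sequence the resonance conditions leave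
only the couplings m ↔ m and m ↔ 2γ - m; the other resonances, ω_m = ω_n + 2ω_γ and its mirror
image, are killed by vanishing coefficients. So the derivative splits into blocks of size one and
two, and the non-degeneracy conditions say that each block is invertible
(`eq_zero_of_nondegenerate`). The γ-component of the equation itself fixes the amplitude
(`first_sum_eq`). -/

/-! ### Gegenbauer polynomials as trigonometric sums -/

/-- The Gegenbauer polynomial `C_{a-2}^{(2)}`, as half the derivative of the Chebyshev polynomial
`U_{a-1}`; it is indexed by the frequency `a`. -/
def gpoly (a : ℕ) : ℝ[X] := C (1 / 2) * derivative (Chebyshev.U ℝ ((a : ℤ) - 1))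

/-- The Gegenbauer polynomial of frequency `a` in the variable `cos x`. -/
def gfun (a : ℕ) (x : ℝ) : ℝ := (gpoly a).eval (Real.cos x)

theorem gfun_eq (a : ℕ) (x : ℝ) :
    gfun a x = 1 / 2 * (derivative (Chebyshev.U ℝ ((a : ℤ) - 1))).eval (Real.cos x) := by
  simp [gfun, gpoly]

/-- Obtained by differentiating `U_{a-1}(cos y) sin y = sin (a y)`. The recurrence, the
orthogonality, the quartic integrals and the uniform bounds all come from this formula. -/
theorem two_mul_sin_cube_mul_gfun (a : ℕ) (x : ℝ) :
    2 * Real.sin x ^ 3 * gfun a x =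
      Real.sin (a * x) * Real.cos x - a * Real.cos (a * x) * Real.sin x := by
  have hU : ∀ y, (Chebyshev.U ℝ ((a : ℤ) - 1)).eval (Real.cos y) * Real.sin y
      = Real.sin (a * y) := by
    intro y
    have := Chebyshev.U_real_cos y ((a : ℤ) - 1)
    rw [this]; congr 1; push_cast; ring
  have h1 : HasDerivAt
      (fun y => (Chebyshev.U ℝ ((a : ℤ) - 1)).eval (Real.cos y) * Real.sin y)
      ((derivative (Chebyshev.U ℝ ((a : ℤ) - 1))).eval (Real.cos x) * (-Real.sin x) * Real.sin x
        + (Chebyshev.U ℝ ((a : ℤ) - 1)).eval (Real.cos x) * Real.cos x) x :=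
    ((Polynomial.hasDerivAt _ _).comp x (Real.hasDerivAt_cos x)).mul (Real.hasDerivAt_sin x)
  have h2 : HasDerivAt (fun y => Real.sin (a * y)) (Real.cos (a * x) * (a * 1)) x :=
    (Real.hasDerivAt_sin _).comp x ((hasDerivAt_id x).const_mul (a : ℝ))
  have h3 := h1.unique (by simpa only [hU] using h2)
  rw [gfun_eq]
  have h4 := hU x
  linear_combination (-Real.sin x) * h3 + Real.cos x * h4

theorem gfun_zero (x : ℝ) : gfun 0 x = 0 := by
  simp [gfun_eq, Chebyshev.U_neg_one]

theorem gfun_one (x : ℝ) : gfun 1 x = 0 := by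
  simp [gfun_eq]

theorem gfun_two (x : ℝ) : gfun 2 x = 1 := by
  norm_num [gfun_eq, derivative_mul]

/-- The derivative of `2 T_{a+1} = U_{a+1} - U_{a-1}`, with `T_{a+1}' = (a+1) U_a`. -/
theorem gpoly_add_two (a : ℕ) :
    gpoly (a + 2) = gpoly a + C ((a : ℝ) + 1) * Chebyshev.U ℝ a := by
  have h := congrArg derivative (Chebyshev.two_mul_T_eq_U_sub_U ℝ ((a : ℤ) - 1))
  have e1 : (a : ℤ) - 1 + 2 = a + 1 := by ring
  rw [e1, derivative_sub, derivative_mul, Chebyshev.T_derivative_eq_U] at h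
  simp only [gpoly]
  have e2 : (((a + 2 : ℕ) : ℤ) - 1) = (a : ℤ) + 1 := by push_cast; ring
  rw [e2, ← sub_eq_iff_eq_add', ← mul_sub, ← h]
  have e3 : (a : ℤ) + 1 - 1 = a := by ring
  have e4 : C (1 / 2 : ℝ) * 2 = 1 := by
    rw [show (2 : ℝ[X]) = C 2 from rfl, ← C_mul]; norm_num
  rw [e3]
  simp only [derivative_ofNat, zero_mul, zero_add]
  rw [← mul_assoc, e4, one_mul]
  simp

theorem U_cos_eq_sum (a : ℕ) (x : ℝ) :
    (Chebyshev.U ℝ (a : ℤ)).eval (Real.cos x) =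
      ∑ l ∈ range (a + 1), Real.cos (((a : ℝ) - 2 * l) * x) := by
  induction a using Nat.strong_induction_on with
  | _ a ih =>
    match a with
    | 0 => simp
    | 1 => simp [Finset.sum_range_succ]; norm_num; ring
    | b + 2 =>
      have h := ih b (by omega)
      have hU := Chebyshev.U_eq_two_mul_T_add_U ℝ (b : ℤ)
      have hT := Chebyshev.T_real_cos x ((b : ℤ) + 2)
      push_cast at hT
      push_cast
      rw [hU, eval_add, h, eval_mul, hT, Finset.sum_range_succ _ (b + 2), Finset.sum_range_succ' _ (b + 1)]
      simp only [Nat.cast_add, Nat.cast_one, Nat.cast_zero, Nat.cast_ofNat]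
      have e : ∀ l : ℕ, ((b : ℝ) + 2 - 2 * (l + 1)) * x = ((b : ℝ) - 2 * l) * x := by
        intro l; ring
      simp only [e]
      have e2 : ((b : ℝ) + 2 - 2 * ((b : ℝ) + 2)) * x = - (((b : ℝ) + 2) * x) := by ring
      rw [e2, Real.cos_neg]
      simp
      ring

/-- The Fourier expansion of the Gegenbauer polynomials. -/
theorem gfun_eq_sum (a : ℕ) (x : ℝ) :
    gfun (a + 2) x =
      ∑ l ∈ range (a + 1), ((l : ℝ) + 1) * (a + 1 - l) * Real.cos (((a : ℝ) - 2 * l) * x) := by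
  induction a using Nat.strong_induction_on with
  | _ a ih =>
    match a with
    | 0 => simp [gfun_two]
    | 1 =>
      have := congrArg (eval (Real.cos x)) (gpoly_add_two 1)
      have h1 := gfun_one x
      simp only [gfun] at h1 ⊢
      rw [show 1 + 2 = 1 + 2 from rfl, this, eval_add, h1]
      simp [Finset.sum_range_succ]; norm_num; ring
    | b + 2 =>
      have h := ih b (by omega)
      have h2 := congrArg (eval (Real.cos x)) (gpoly_add_two (b + 2))
      have h3 := U_cos_eq_sum (b + 2) x
      simp only [gfun] at h ⊢
      rw [h2, eval_add, eval_mul, h3, h, eval_C, Finset.mul_sum]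
      rw [Finset.sum_range_succ _ (b + 2), Finset.sum_range_succ' _ (b + 1),
        Finset.sum_range_succ _ (b + 2), Finset.sum_range_succ' _ (b + 1)]
      rw [← add_assoc, ← add_assoc, ← Finset.sum_add_distrib]
      congr 1
      · congr 1
        · apply Finset.sum_congr rfl
          intro l _
          push_cast
          rw [show ((b : ℝ) + 2 - 2 * ((l : ℝ) + 1)) * x = ((b : ℝ) - 2 * l) * x by ring]
          ring
        · push_cast; ring
      · push_cast; ring

theorem abs_gfun_le (a : ℕ) (x : ℝ) : |gfun a x| ≤ (a : ℝ) ^ 3 := by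
  match a with
  | 0 => simp [gfun_zero]
  | 1 => simp [gfun_one]
  | b + 2 =>
    rw [gfun_eq_sum]
    refine (Finset.abs_sum_le_sum_abs _ _).trans ?_
    have : ∀ l ∈ range (b + 1), |((l : ℝ) + 1) * (b + 1 - l) * Real.cos (((b : ℝ) - 2 * l) * x)|
        ≤ ((b : ℝ) + 2) ^ 2 := by
      intro l hl
      have hl' : (l : ℝ) ≤ b := by
        have := Finset.mem_range.1 hl; exact_mod_cast (by omega : l ≤ b)
      have hl0 : (0 : ℝ) ≤ l := Nat.cast_nonneg l
      rw [abs_mul, abs_of_nonneg (by apply mul_nonneg <;> linarith)]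
      have hc := Real.abs_cos_le_one (((b : ℝ) - 2 * l) * x)
      have h1 : ((l : ℝ) + 1) * (b + 1 - l) ≤ ((b : ℝ) + 2) * (b + 2) := by
        apply mul_le_mul <;> linarith
      calc _ ≤ ((l : ℝ) + 1) * (b + 1 - l) * 1 := by
            apply mul_le_mul_of_nonneg_left hc
            apply mul_nonneg <;> linarith
        _ ≤ _ := by nlinarith
    refine (Finset.sum_le_sum this).trans ?_
    simp only [Finset.sum_const, Finset.card_range, nsmul_eq_mul]
    push_cast
    nlinarith [sq_nonneg ((b : ℝ) + 2)]

theorem continuous_gfun (a : ℕ) : Continuous (gfun a) :=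
  (gpoly a).continuous.comp Real.continuous_cos

/-- The three-term recurrence, multiplied by `2 sin³ x`. -/
theorem gfun_recurrence (a : ℕ) (x : ℝ) :
    Real.sin x ^ 3 * (a * gfun (a + 2) x + (a + 2) * gfun a x) =
      Real.sin x ^ 3 * (2 * (a + 1) * Real.cos x * gfun (a + 1) x) := by
  have h0 := two_mul_sin_cube_mul_gfun a x
  have h1 := two_mul_sin_cube_mul_gfun (a + 1) x
  have h2 := two_mul_sin_cube_mul_gfun (a + 2) x
  push_cast at h1 h2
  set y := ((a : ℝ) + 1) * x with hy
  have e0 : (a : ℝ) * x = y - x := by rw [hy]; ring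
  have e2 : ((a : ℝ) + 2) * x = y + x := by rw [hy]; ring
  rw [e0, Real.sin_sub, Real.cos_sub] at h0
  rw [e2, Real.sin_add, Real.cos_add] at h2
  have hs := Real.sin_sq_add_cos_sq x
  linear_combination (a / 2 : ℝ) * h2 + ((a + 2) / 2 : ℝ) * h0 - (a + 1 : ℝ) * Real.cos x * h1

/-- Only three cosines, of frequency at least `a`, appear; orthogonality to polynomials in `cos x`
of degree below `a` follows at once. -/
theorem eight_mul_sin_pow_four_mul_gfun (a : ℕ) (x : ℝ) :
    8 * Real.sin x ^ 4 * gfun (a + 2) x =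
      (a + 3) * Real.cos (a * x) - 2 * (a + 2) * Real.cos ((a + 2) * x)
        + (a + 1) * Real.cos ((a + 4) * x) := by
  have h := two_mul_sin_cube_mul_gfun (a + 2) x
  push_cast at h
  set y := ((a : ℝ) + 2) * x with hy
  have e0 : (a : ℝ) * x = y - 2 * x := by rw [hy]; ring
  have e2 : ((a : ℝ) + 4) * x = y + 2 * x := by rw [hy]; ring
  rw [e0, e2, Real.cos_sub, Real.cos_add, Real.sin_two_mul, Real.cos_two_mul]
  have hs := Real.sin_sq_add_cos_sq x
  linear_combination 4 * Real.sin x * h + (- 4 * ((a : ℝ) + 2) * Real.cos y) * hs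

/-! ### Cosine integrals and orthogonality -/

theorem integral_cos_int_mul (k : ℤ) :
    ∫ x in (0 : ℝ)..Real.pi, Real.cos (k * x) = if k = 0 then Real.pi else 0 := by
  split_ifs with h
  · simp [h]
  · have hk : (k : ℝ) ≠ 0 := by exact_mod_cast h
    rw [intervalIntegral.integral_comp_mul_left (fun x => Real.cos x) hk]
    simp [Real.sin_int_mul_pi]

theorem integral_cos_mul_cos_mul_cos (p q k : ℤ) :
    ∫ x in (0 : ℝ)..Real.pi, Real.cos (p * x) * Real.cos (q * x) * Real.cos (k * x) =
      Real.pi / 4 * signCount p q k := by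
  have h : ∀ x : ℝ, Real.cos (p * x) * Real.cos (q * x) * Real.cos (k * x) =
      1 / 4 * (Real.cos ((p + q + k : ℤ) * x) + Real.cos ((p + q - k : ℤ) * x)
        + Real.cos ((p - q + k : ℤ) * x) + Real.cos ((p - q - k : ℤ) * x)) := by
    intro x
    push_cast
    simp only [add_mul, sub_mul, Real.cos_add, Real.cos_sub, Real.sin_add, Real.sin_sub]
    ring
  simp only [h]
  have hi : ∀ n : ℤ, IntervalIntegrable (fun x : ℝ => Real.cos (n * x)) MeasureTheory.volume
      0 Real.pi := fun n => Continuous.intervalIntegrable (by fun_prop) _ _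
  rw [intervalIntegral.integral_const_mul,
    intervalIntegral.integral_add (((hi _).add (hi _)).add (hi _)) (hi _),
    intervalIntegral.integral_add ((hi _).add (hi _)) (hi _),
    intervalIntegral.integral_add (hi _) (hi _)]
  simp only [integral_cos_int_mul, signCount]
  split_ifs <;> ring

theorem integral_cos_pow_mul_cos (j k : ℕ) (h : j < k) :
    ∫ x in (0 : ℝ)..Real.pi, Real.cos x ^ j * Real.cos (k * x) = 0 := by
  induction j generalizing k with
  | zero =>
    have hk : k ≠ 0 := by omega
    simp [hk]
  | succ j ih =>
    obtain ⟨k, rfl⟩ : ∃ k', k = k' + 1 := ⟨k - 1, by omega⟩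
    have e : ∀ x : ℝ, Real.cos x ^ (j + 1) * Real.cos ((k + 1 : ℕ) * x) =
        1 / 2 * (Real.cos x ^ j * Real.cos ((k + 2 : ℕ) * x)
          + Real.cos x ^ j * Real.cos (k * x)) := by
      intro x
      have e1 : ((k + 2 : ℕ) : ℝ) * x = ((k + 1 : ℕ) : ℝ) * x + x := by push_cast; ring
      have e2 : (k : ℝ) * x = ((k + 1 : ℕ) : ℝ) * x - x := by push_cast; ring
      rw [e1, e2, Real.cos_add, Real.cos_sub]
      ring
    simp only [e]
    rw [intervalIntegral.integral_const_mul, intervalIntegral.integral_add, ih _ (by omega),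
      ih _ (by omega)]
    · simp
    · exact Continuous.intervalIntegrable (by fun_prop) _ _
    · exact Continuous.intervalIntegrable (by fun_prop) _ _

theorem integral_eval_cos_mul_cos (p : ℝ[X]) (k : ℕ) (h : p.natDegree < k) :
    ∫ x in (0 : ℝ)..Real.pi, p.eval (Real.cos x) * Real.cos (k * x) = 0 := by
  simp only [eval_eq_sum_range, Finset.sum_mul]
  rw [intervalIntegral.integral_finsetSum]
  · apply Finset.sum_eq_zero
    intro j hj
    simp only [mul_assoc]
    rw [intervalIntegral.integral_const_mul, integral_cos_pow_mul_cos, mul_zero]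
    have := Finset.mem_range.1 hj
    omega
  · intro i _
    exact Continuous.intervalIntegrable (by fun_prop) _ _

theorem integral_eval_cos_mul_gfun (p : ℝ[X]) (n : ℕ) (h : p.natDegree < n) :
    ∫ x in (0 : ℝ)..Real.pi, p.eval (Real.cos x) * (gfun (n + 2) x * Real.sin x ^ 4) = 0 := by
  have e : ∀ x : ℝ, p.eval (Real.cos x) * (gfun (n + 2) x * Real.sin x ^ 4) =
      (n + 3) / 8 * (p.eval (Real.cos x) * Real.cos (n * x))
      - (n + 2) / 4 * (p.eval (Real.cos x) * Real.cos ((n + 2 : ℕ) * x))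
      + (n + 1) / 8 * (p.eval (Real.cos x) * Real.cos ((n + 4 : ℕ) * x)) := by
    intro x
    have := eight_mul_sin_pow_four_mul_gfun n x
    push_cast
    linear_combination (p.eval (Real.cos x) / 8) * this
  have hc : Continuous fun x => p.eval (Real.cos x) := p.continuous.comp Real.continuous_cos
  simp only [e]
  rw [intervalIntegral.integral_add, intervalIntegral.integral_sub,
    intervalIntegral.integral_const_mul, intervalIntegral.integral_const_mul,
    intervalIntegral.integral_const_mul, integral_eval_cos_mul_cos _ _ h,
    integral_eval_cos_mul_cos _ _ (by omega), integral_eval_cos_mul_cos _ _ (by omega)]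
  · simp
  all_goals exact Continuous.intervalIntegrable (by fun_prop) _ _

theorem natDegree_gpoly_le (n : ℕ) : (gpoly (n + 2)).natDegree ≤ n := by
  unfold gpoly
  refine (natDegree_C_mul_le _ _).trans ((natDegree_derivative_le _).trans ?_)
  have : ((n + 2 : ℕ) : ℤ) - 1 = ((n + 1 : ℕ) : ℤ) := by push_cast; ring
  rw [this, Chebyshev.natDegree_U_natCast]
  simp

/-! ### Cubic coefficients and Heron's formula -/

/-- The squared area of the triangle with sides `a`, `b`, `c` if there is such a triangle and its
perimeter is even, and zero otherwise. -/
def heron (a b c : ℕ) : ℕ :=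
  if (a + b + c) % 2 = 0 then
    (a + b + c) / 2 * ((a + b + c) / 2 - a) * ((a + b + c) / 2 - b) * ((a + b + c) / 2 - c)
  else 0

theorem heron_eq {a b c p : ℕ} (h : a + b + c = 2 * p) :
    heron a b c = p * (p - a) * (p - b) * (p - c) := by
  have h1 : (a + b + c) % 2 = 0 := by omega
  have h2 : (a + b + c) / 2 = p := by omega
  simp [heron, h1, h2]

theorem heron_of_odd {a b c p : ℕ} (h : a + b + c = 2 * p + 1) : heron a b c = 0 := by
  have h1 : ¬ (a + b + c) % 2 = 0 := by omega
  simp [heron, h1]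

/-- Truncated subtraction makes one of the factors zero when the triangle inequality is not strict.
-/
theorem heron_of_not_triangle {a b c : ℕ} (h : b + c ≤ a ∨ a + c ≤ b ∨ a + b ≤ c) :
    heron a b c = 0 := by
  unfold heron
  split_ifs with h1
  · rcases h with h | h | h
    · have : (a + b + c) / 2 - a = 0 := by omega
      simp [this]
    · have : (a + b + c) / 2 - b = 0 := by omega
      simp [this]
    · have : (a + b + c) / 2 - c = 0 := by omega
      simp [this]
  · rfl

theorem heron_recurrence (a b c : ℕ) :
    (a + 1) * (b * heron (a + 1) (b + 2) c + (b + 2) * heron (a + 1) b c) =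
      (b + 1) * (a * heron (a + 2) (b + 1) c + (a + 2) * heron a (b + 1) c) := by
  by_cases hp : (a + b + c) % 2 = 0
  · obtain ⟨p, hp⟩ : ∃ p, a + b + c = 2 * p := ⟨(a + b + c) / 2, by omega⟩
    rw [heron_of_odd (p := p + 1) (by omega), heron_of_odd (p := p) (by omega),
      heron_of_odd (p := p + 1) (by omega), heron_of_odd (p := p) (by omega)]
    simp
  by_cases h : a + b + 1 < c ∨ b + c < a ∨ a + c < b
  · rw [heron_of_not_triangle (by omega), heron_of_not_triangle (by omega),
      heron_of_not_triangle (by omega), heron_of_not_triangle (by omega)]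
    simp
  -- Tangent-length coordinates turn all the truncated differences into honest natural numbers.
  obtain ⟨x, y, z, rfl, rfl, rfl⟩ : ∃ x y z, a = x + y ∧ b = x + z ∧ c = y + z + 1 :=
    ⟨(a + b + 1 - c) / 2, (a + c - b) / 2, (b + c - a) / 2, by omega, by omega, by omega⟩
  rw [heron_eq (p := x + y + z + 2) (by omega), heron_eq (p := x + y + z + 1) (by omega),
    heron_eq (p := x + y + z + 2) (by omega), heron_eq (p := x + y + z + 1) (by omega)]
  have e1 : x + y + z + 2 - (x + y + 1) = z + 1 := by omega
  have e2 : x + y + z + 2 - (x + z + 2) = y := by omega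
  have e3 : x + y + z + 2 - (y + z + 1) = x + 1 := by omega
  have e4 : x + y + z + 1 - (x + y + 1) = z := by omega
  have e5 : x + y + z + 1 - (x + z) = y + 1 := by omega
  have e6 : x + y + z + 1 - (y + z + 1) = x := by omega
  have e7 : x + y + z + 2 - (x + y + 2) = z := by omega
  have e8 : x + y + z + 2 - (x + z + 1) = y + 1 := by omega
  have e9 : x + y + z + 1 - (x + y) = z + 1 := by omega
  have e10 : x + y + z + 1 - (x + z + 1) = y := by omega
  rw [e1, e2, e3, e4, e5, e6, e7, e8, e9, e10]
  ring

/-- The integral of a product of three Gegenbauer polynomials. -/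
def triple (a b c : ℕ) : ℝ :=
  ∫ x in (0 : ℝ)..Real.pi, gfun a x * gfun b x * gfun c x * Real.sin x ^ 4

theorem triple_swap_left (a b c : ℕ) : triple a b c = triple b a c := by
  unfold triple; congr 1; funext x; ring

theorem triple_swap_right (a b c : ℕ) : triple a b c = triple a c b := by
  unfold triple; congr 1; funext x; ring

theorem triple_recurrence_aux (a b c : ℕ) :
    a * triple (a + 2) b c + (a + 2) * triple a b c =
      2 * (a + 1) * ∫ x in (0 : ℝ)..Real.pi,
        gfun (a + 1) x * gfun b x * gfun c x * Real.cos x * Real.sin x ^ 4 := by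
  have ha := continuous_gfun a
  have ha2 := continuous_gfun (a + 2)
  have hb := continuous_gfun b
  have hc := continuous_gfun c
  unfold triple
  rw [← intervalIntegral.integral_const_mul, ← intervalIntegral.integral_const_mul,
    ← intervalIntegral.integral_const_mul, ← intervalIntegral.integral_add]
  · congr 1
    funext x
    have h := gfun_recurrence a x
    linear_combination (gfun b x * gfun c x * Real.sin x) * h
  all_goals exact Continuous.intervalIntegrable (by fun_prop) _ _

/-- Multiplication by `cos x` may be charged to the first factor or to the second; equating the two
expansions eliminates the integral with the cosine. -/
theorem triple_recurrence (a b c : ℕ) :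
    ((a : ℝ) + 1) * (b * triple (a + 1) (b + 2) c + (b + 2) * triple (a + 1) b c) =
      (b + 1) * (a * triple (a + 2) (b + 1) c + (a + 2) * triple a (b + 1) c) := by
  have h1 := triple_recurrence_aux a (b + 1) c
  have h2 := triple_recurrence_aux b (a + 1) c
  rw [triple_swap_left (b + 2), triple_swap_left b] at h2
  have e : ∀ x : ℝ, gfun (b + 1) x * gfun (a + 1) x * gfun c x * Real.cos x * Real.sin x ^ 4
      = gfun (a + 1) x * gfun (b + 1) x * gfun c x * Real.cos x * Real.sin x ^ 4 := by
    intro x; ring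
  simp only [e] at h2
  rw [h1, h2]
  ring

theorem triple_zero_left (b c : ℕ) : triple 0 b c = 0 := by simp [triple, gfun_zero]

theorem triple_one_left (b c : ℕ) : triple 1 b c = 0 := by simp [triple, gfun_one]

theorem triple_two_of_lt {n k : ℕ} (h : k < n) : triple (k + 2) 2 (n + 2) = 0 := by
  have := integral_eval_cos_mul_gfun (gpoly (k + 2)) n ((natDegree_gpoly_le k).trans_lt h)
  unfold triple
  rw [← this]
  congr 1
  funext x
  simp only [gfun_two]
  rw [gfun]
  ring

theorem triple_two_of_ne {a c : ℕ} (h : a ≠ c) : triple a 2 c = 0 := by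
  wlog hl : a < c generalizing a c
  · rw [triple_swap_left, triple_swap_right, triple_swap_left]
    exact this h.symm (by omega)
  match a, c with
  | 0, _ => exact triple_zero_left _ _
  | 1, _ => exact triple_one_left _ _
  | a + 2, 0 => omega
  | a + 2, 1 => omega
  | a + 2, c + 2 => exact triple_two_of_lt (by omega)

theorem triple_two_self (n : ℕ) :
    triple (n + 1) 2 (n + 1) = Real.pi / 8 * (n * (n + 2)) := by
  match n with
  | 0 => simp [triple_one_left]
  | 1 =>
    simp only [triple, Nat.reduceAdd, gfun_two]
    have := integral_sin_pow (a := 0) (b := Real.pi) 2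
    norm_num [integral_sin_sq] at this ⊢
    rw [this]; ring
  | n + 2 =>
    -- With third index 2, where the Gegenbauer polynomial is 1, orthogonality removes one term on
    -- each side and leaves a two-term recursion for the norms.
    have h := triple_recurrence (n + 2) (n + 1) 2
    have ih := triple_two_self (n + 1)
    rw [triple_swap_right (n + 2 + 1) (n + 1 + 2), triple_swap_right (n + 2 + 1) (n + 1),
      triple_swap_right (n + 2 + 2), triple_swap_right (n + 2) (n + 1 + 1),
      triple_two_of_ne (a := n + 2 + 1) (c := n + 1) (by omega),
      triple_two_of_ne (a := n + 2 + 2) (c := n + 1 + 1) (by omega)] at h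
    have e : triple (n + 2) 2 (n + 1 + 1) = triple (n + 1 + 1) 2 (n + 1 + 1) := rfl
    have e' : triple (n + 2 + 1) 2 (n + 1 + 2) = triple (n + 2 + 1) 2 (n + 2 + 1) := rfl
    rw [e, ih, e'] at h
    push_cast at h ⊢
    have hn : ((n : ℝ) + 2 + 1) * (n + 1) ≠ 0 := by positivity
    apply mul_left_cancel₀ hn
    linear_combination h

theorem triple_two (a c : ℕ) : triple a 2 c = Real.pi / 8 * heron a 2 c := by
  by_cases h : a = c
  · subst h
    match a with
    | 0 => simp [triple_zero_left, heron]
    | n + 1 =>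
      rw [triple_two_self, heron_eq (p := n + 2) (by omega)]
      have e1 : n + 2 - (n + 1) = 1 := by omega
      have e2 : n + 2 - 2 = n := by omega
      rw [e1, e2]
      push_cast; ring
  · rw [triple_two_of_ne h]
    by_cases hp : (a + c) % 2 = 0
    · rw [heron_of_not_triangle (by omega)]; simp
    · rw [heron_of_odd (p := (a + c + 1) / 2) (by omega)]; simp

/-- The common recurrence expresses the value at `(a+1, b+3)` by values with second index `b+1` and
`b+2`; the starting cases are zero functions (frequencies 0 and 1) and the orthogonality relations
(frequency 2). -/
theorem triple_eq (a b c : ℕ) : triple a b c = Real.pi / 8 * heron a b c := by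
  induction b using Nat.strong_induction_on generalizing a with
  | _ b ih =>
    match b with
    | 0 =>
      rw [triple_swap_left, triple_zero_left, heron_of_not_triangle (by omega)]; simp
    | 1 =>
      rw [triple_swap_left, triple_one_left]
      by_cases hp : (a + c) % 2 = 0
      · rw [heron_of_odd (p := (a + c) / 2) (by omega)]; simp
      · rw [heron_of_not_triangle (by omega)]; simp
    | 2 => exact triple_two a c
    | b + 3 =>
      match a with
      | 0 => rw [triple_zero_left, heron_of_not_triangle (by omega)]; simp
      | a + 1 =>
        have h := triple_recurrence a (b + 1) c
        have h' := heron_recurrence a (b + 1) c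
        rw [ih (b + 1) (by omega), ih (b + 1 + 1) (by omega), ih (b + 1 + 1) (by omega)] at h
        have h'' := congrArg (fun n : ℕ => (n : ℝ)) h'
        push_cast at h h''
        have hn : ((a : ℝ) + 1) * (b + 1) ≠ 0 := by positivity
        apply mul_left_cancel₀ hn
        show _ * triple (a + 1) (b + 1 + 2) c = _ * (_ * (heron (a + 1) (b + 1 + 2) c : ℝ))
        linear_combination h - Real.pi / 8 * h''

/-! ### Quartic coefficients -/

/-- The product of two instances of `two_mul_sin_cube_mul_gfun`. It reduces a quartic integral to
six Fourier coefficients of the product of the remaining two factors. -/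
theorem sin_pow_six_mul_gfun_mul_gfun (a b : ℕ) (x : ℝ) :
    32 * (Real.sin x ^ 6 * gfun a x * gfun b x) =
      2 * (a * b + 1) * Real.cos ((b - a : ℤ) * x)
      - (a + 1) * (b - 1) * Real.cos ((b - a + 2 : ℤ) * x)
      - (a - 1) * (b + 1) * Real.cos ((b - a - 2 : ℤ) * x)
      - (a + 1) * (b + 1) * Real.cos ((a + b - 2 : ℤ) * x)
      + 2 * (a * b - 1) * Real.cos ((a + b : ℤ) * x)
      - (a - 1) * (b - 1) * Real.cos ((a + b + 2 : ℤ) * x) := by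
  have h : 32 * (Real.sin x ^ 6 * gfun a x * gfun b x) =
      8 * (2 * Real.sin x ^ 3 * gfun a x) * (2 * Real.sin x ^ 3 * gfun b x) := by ring
  rw [h, two_mul_sin_cube_mul_gfun, two_mul_sin_cube_mul_gfun]
  push_cast
  have hs : Real.cos x ^ 2 = 1 - Real.sin x ^ 2 := by linarith [Real.sin_sq_add_cos_sq x]
  simp only [add_mul, sub_mul, Real.cos_add, Real.cos_sub, Real.sin_add, Real.sin_sub,
    Real.cos_two_mul, Real.sin_two_mul]
  ring_nf
  simp only [hs]
  ring

/-- The sign count as an integer. -/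
def signCountInt (a b c : ℤ) : ℤ :=
  (if a + b + c = 0 then 1 else 0) + (if a + b - c = 0 then 1 else 0) +
    (if a - b + c = 0 then 1 else 0) + (if a - b - c = 0 then 1 else 0)

theorem signCount_eq_cast (a b c : ℤ) : signCount a b c = signCountInt a b c := by
  unfold signCount signCountInt
  push_cast
  rfl

/-- The Fourier coefficients of the square of a Gegenbauer polynomial, up to a factor `π / 4`. -/
def squareCoeff (n : ℕ) (k : ℤ) : ℤ :=
  ∑ l ∈ range (n + 1), ∑ r ∈ range (n + 1),
    ((l : ℤ) + 1) * (n + 1 - l) * (((r : ℤ) + 1) * (n + 1 - r)) *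
      signCountInt (n - 2 * l) (n - 2 * r) k

theorem integral_gfun_sq_mul_cos (n : ℕ) (k : ℤ) :
    ∫ x in (0 : ℝ)..Real.pi, gfun (n + 2) x * gfun (n + 2) x * Real.cos (k * x) =
      Real.pi / 4 * squareCoeff n k := by
  have e : ∀ x : ℝ, gfun (n + 2) x * gfun (n + 2) x * Real.cos (k * x) =
      ∑ l ∈ range (n + 1), ∑ r ∈ range (n + 1),
        (((l : ℝ) + 1) * (n + 1 - l) * (((r : ℝ) + 1) * (n + 1 - r))) *
          (Real.cos ((n - 2 * l : ℤ) * x) * Real.cos ((n - 2 * r : ℤ) * x) *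
            Real.cos (k * x)) := by
    intro x
    rw [gfun_eq_sum, Finset.sum_mul_sum, Finset.sum_mul]
    refine Finset.sum_congr rfl fun l _ => ?_
    rw [Finset.sum_mul]
    refine Finset.sum_congr rfl fun r _ => ?_
    push_cast
    ring
  simp only [e]
  rw [intervalIntegral.integral_finsetSum]
  · unfold squareCoeff
    push_cast
    rw [Finset.mul_sum]
    refine Finset.sum_congr rfl fun l _ => ?_
    rw [intervalIntegral.integral_finsetSum]
    · rw [Finset.mul_sum]
      refine Finset.sum_congr rfl fun r _ => ?_
      have h := integral_cos_mul_cos_mul_cos (n - 2 * l) (n - 2 * r) k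
      rw [signCount_eq_cast] at h
      push_cast at h
      rw [intervalIntegral.integral_const_mul, h]
      ring
    · intro i _
      exact Continuous.intervalIntegrable (by fun_prop) _ _
  · intro i _
    exact Continuous.intervalIntegrable (by fun_prop) _ _

/-- The integral of `g_{n+2}² g_{i+2} g_{j+2} sin⁶`, up to a factor `π / 128`. -/
def quadCoeff (n i j : ℕ) : ℤ :=
  2 * ((i + 2) * (j + 2) + 1) * squareCoeff n (j - i)
  - (i + 3) * (j + 1) * squareCoeff n (j - i + 2)
  - (i + 1) * (j + 3) * squareCoeff n (j - i - 2)
  - (i + 3) * (j + 3) * squareCoeff n (i + j + 2)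
  + 2 * ((i + 2) * (j + 2) - 1) * squareCoeff n (i + j + 4)
  - (i + 1) * (j + 1) * squareCoeff n (i + j + 6)

theorem integral_gfun_sq_mul_gfun_mul_gfun (n i j : ℕ) :
    ∫ x in (0 : ℝ)..Real.pi, gfun (n + 2) x * gfun (n + 2) x * gfun (i + 2) x * gfun (j + 2) x *
      Real.sin x ^ 6 = Real.pi / 128 * quadCoeff n i j := by
  have e : ∀ x : ℝ, gfun (n + 2) x * gfun (n + 2) x * gfun (i + 2) x * gfun (j + 2) x *
      Real.sin x ^ 6 =
      1 / 32 *
      (2 * ((i + 2) * (j + 2) + 1) *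
        (gfun (n + 2) x * gfun (n + 2) x * Real.cos ((j - i : ℤ) * x))
      - (i + 3) * (j + 1) * (gfun (n + 2) x * gfun (n + 2) x * Real.cos ((j - i + 2 : ℤ) * x))
      - (i + 1) * (j + 3) * (gfun (n + 2) x * gfun (n + 2) x * Real.cos ((j - i - 2 : ℤ) * x))
      - (i + 3) * (j + 3) * (gfun (n + 2) x * gfun (n + 2) x * Real.cos ((i + j + 2 : ℤ) * x))
      + 2 * ((i + 2) * (j + 2) - 1) *
        (gfun (n + 2) x * gfun (n + 2) x * Real.cos ((i + j + 4 : ℤ) * x))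
      - (i + 1) * (j + 1) *
        (gfun (n + 2) x * gfun (n + 2) x * Real.cos ((i + j + 6 : ℤ) * x))) := by
    intro x
    have h := sin_pow_six_mul_gfun_mul_gfun (i + 2) (j + 2) x
    have e1 : ((j + 2 : ℕ) - (i + 2 : ℕ) : ℤ) = j - i := by push_cast; ring
    have e2 : ((i + 2 : ℕ) + (j + 2 : ℕ) : ℤ) = i + j + 4 := by push_cast; ring
    have e3 : ((i : ℤ) + j + 4) - 2 = i + j + 2 := by ring
    have e4 : ((i : ℤ) + j + 4) + 2 = i + j + 6 := by ring
    rw [e1, e2, e3, e4] at h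
    have e5 : ((i + 2 : ℕ) : ℝ) = i + 2 := by push_cast; ring
    have e6 : ((j + 2 : ℕ) : ℝ) = j + 2 := by push_cast; ring
    rw [e5, e6] at h
    linear_combination (gfun (n + 2) x * gfun (n + 2) x / 32) * h
  have hg := continuous_gfun (n + 2)
  have hi : ∀ (c : ℝ) (k : ℤ), IntervalIntegrable
      (fun x => c * (gfun (n + 2) x * gfun (n + 2) x * Real.cos (k * x)))
      MeasureTheory.volume 0 Real.pi :=
    fun c k => Continuous.intervalIntegrable (by fun_prop) _ _
  simp only [e]
  rw [intervalIntegral.integral_const_mul,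
    intervalIntegral.integral_sub (((((hi _ _).sub (hi _ _)).sub (hi _ _)).sub (hi _ _)).add
      (hi _ _)) (hi _ _),
    intervalIntegral.integral_add ((((hi _ _).sub (hi _ _)).sub (hi _ _)).sub (hi _ _)) (hi _ _),
    intervalIntegral.integral_sub (((hi _ _).sub (hi _ _)).sub (hi _ _)) (hi _ _),
    intervalIntegral.integral_sub ((hi _ _).sub (hi _ _)) (hi _ _),
    intervalIntegral.integral_sub (hi _ _) (hi _ _)]
  simp only [intervalIntegral.integral_const_mul, integral_gfun_sq_mul_cos, quadCoeff]
  push_cast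
  ring

theorem signCountInt_eq_zero {a b c : ℤ} (h : |a| + |b| < |c|) : signCountInt a b c = 0 := by
  unfold signCountInt
  have ha := abs_le.1 (le_refl |a|)
  have hb := abs_le.1 (le_refl |b|)
  rcases abs_cases c with ⟨hc, _⟩ | ⟨hc, _⟩ <;> rw [hc] at h <;>
  · rw [if_neg (by omega), if_neg (by omega), if_neg (by omega), if_neg (by omega)]
    rfl

/-- The square of the Gegenbauer polynomial of degree `n` is a trigonometric polynomial of degree `2
n`. -/
theorem squareCoeff_eq_zero {n : ℕ} {k : ℤ} (h : 2 * (n : ℤ) < k) : squareCoeff n k = 0 := by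
  unfold squareCoeff
  refine Finset.sum_eq_zero fun l hl => Finset.sum_eq_zero fun r hr => ?_
  have h1 := Finset.mem_range.1 hl
  have h2 := Finset.mem_range.1 hr
  rw [signCountInt_eq_zero, mul_zero]
  have h3 : |(n : ℤ) - 2 * l| ≤ n := abs_le.2 ⟨by omega, by omega⟩
  have h4 : |(n : ℤ) - 2 * r| ≤ n := abs_le.2 ⟨by omega, by omega⟩
  rw [abs_of_nonneg (by omega : 0 ≤ k)]
  omega

/-! ### Identification of the eigenfunctions -/

/-- The normalization factor of the Gegenbauer polynomials. -/
def gnorm (n : ℕ) : ℝ := Real.sqrt (8 / (Real.pi * (((n : ℝ) + 1) * (n + 3))))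

theorem gnorm_sq (n : ℕ) : gnorm n ^ 2 = 8 / Real.pi / (((n : ℝ) + 1) * (n + 3)) := by
  rw [gnorm, Real.sq_sqrt (by have := Real.pi_pos; positivity), div_div]

theorem gnorm_pos (n : ℕ) : 0 < gnorm n := by
  have := Real.pi_pos
  unfold gnorm
  positivity

theorem Gamma_nat_add_five_halves (k : ℕ) :
    Real.Gamma (k + 5 / 2) * (4 * 2 ^ k) =
      Real.sqrt Real.pi * ∏ l ∈ range (k + 1), (2 * (l : ℝ) + 3) := by
  induction k with
  | zero =>
    have h1 := Real.Gamma_add_one (s := 1 / 2) (by norm_num)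
    have h2 := Real.Gamma_add_one (s := 3 / 2) (by norm_num)
    rw [Real.Gamma_one_half_eq] at h1
    norm_num at h1 h2 ⊢
    rw [h2, h1]; ring
  | succ k ih =>
    have h := Real.Gamma_add_one (s := (k : ℝ) + 5 / 2) (by positivity)
    rw [show ((k + 1 : ℕ) : ℝ) + 5 / 2 = (k : ℝ) + 5 / 2 + 1 by push_cast; ring, h,
      Finset.prod_range_succ]
    push_cast
    rw [pow_succ]
    linear_combination ((2 : ℝ) * (k + 1) + 3) * ih

/-- Each factor splits as `(n + 1 - l)(n + 3 + l)`. The product is the numerator of a derivative of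
`U_{n+1}` at 1. -/
theorem prod_freq_sq_sub (n k : ℕ) (hk : k ≤ n) :
    (∏ l ∈ range (k + 1), (((n : ℝ) + 1 + 1) ^ 2 - ((l : ℝ) + 1) ^ 2)) *
      (((n - k).factorial : ℝ) * (n + 2)) = (n + k + 3).factorial := by
  induction k with
  | zero =>
    simp only [zero_add, prod_range_one, Nat.sub_zero, add_zero, Nat.factorial_succ]
    push_cast; ring
  | succ k ih =>
    have ih := ih (by omega)
    rw [Finset.prod_range_succ]
    have e1 : n - k = (n - (k + 1)) + 1 := by omega
    have e2 : ((n - (k + 1) : ℕ) : ℝ) = n - (k + 1) := by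
      rw [Nat.cast_sub hk]; push_cast; ring
    rw [e1, Nat.factorial_succ] at ih
    push_cast [e2] at ih
    rw [show n + (k + 1) + 3 = (n + k + 3) + 1 by ring, Nat.factorial_succ]
    push_cast
    rw [← ih]
    ring

theorem eval_iterate_derivative_gpoly (n k : ℕ) (hk : k ≤ n) :
    (derivative^[k] (gpoly (n + 2))).eval 1 * (2 * ((n - k).factorial : ℝ) *
      ∏ l ∈ range (k + 1), (2 * (l : ℝ) + 3)) = (n + k + 3).factorial := by
  have h := Chebyshev.iterate_derivative_U_eval_one (R := ℝ) (n + 1) (k + 1)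
  have h2 := prod_freq_sq_sub n k hk
  have e : ((n + 2 : ℕ) : ℤ) - 1 = n + 1 := by push_cast; ring
  rw [gpoly, e, iterate_derivative_C_mul, eval_C_mul, ← Function.iterate_succ_apply]
  rw [Nat.succ_eq_add_one]
  push_cast at h
  rw [← h2]
  linear_combination ((n - k).factorial : ℝ) * h

/-- The Jacobi polynomial is given by its expansion in powers of `x - 1`, so its coefficients are
compared with the Taylor coefficients of the Gegenbauer polynomial at 1, known from the derivatives
of `U` there. -/
theorem jacobiP_eq_gpoly (n : ℕ) (x : ℝ) :
    jacobiP (3 / 2) (3 / 2) n x =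
      8 * Real.Gamma (5 / 2 + n) / (((n + 3).factorial : ℝ) * Real.sqrt Real.pi) *
        (gpoly (n + 2)).eval x := by
  have hdeg : (taylor 1 (gpoly (n + 2))).natDegree < n + 1 := by
    rw [natDegree_taylor]
    exact Nat.lt_succ_of_le (natDegree_gpoly_le n)
  have hT : (gpoly (n + 2)).eval x = ∑ k ∈ range (n + 1),
      (derivative^[k] (gpoly (n + 2))).eval 1 / k.factorial * (x - 1) ^ k := by
    have h1 : (gpoly (n + 2)).eval x = (taylor 1 (gpoly (n + 2))).eval (x - 1) := by
      rw [taylor_eval]; congr 1; ring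
    rw [h1, eval_eq_sum_range' hdeg]
    refine Finset.sum_congr rfl fun k _ => ?_
    congr 1
    rw [taylor_coeff, eq_div_iff (by positivity), ← factorial_smul_hasseDeriv]
    simp [mul_comm]
  rw [jacobiP, hT, Finset.mul_sum, Finset.mul_sum]
  refine Finset.sum_congr rfl fun k hk => ?_
  have hk' : k ≤ n := by have := Finset.mem_range.1 hk; omega
  have hD := eval_iterate_derivative_gpoly n k hk'
  have hG := Gamma_nat_add_five_halves k
  have hc : (n.choose k : ℝ) * (k.factorial * (n - k).factorial) = n.factorial := by
    rw [← mul_assoc]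
    exact_mod_cast Nat.choose_mul_factorial_mul_factorial hk'
  have hg1 : Real.Gamma (3 / 2 + 3 / 2 + n + 1) = (n + 3).factorial := by
    rw [← Real.Gamma_nat_eq_factorial]; congr 1; push_cast; ring
  have hg2 : Real.Gamma (3 / 2 + 3 / 2 + n + k + 1) = (n + k + 3).factorial := by
    rw [← Real.Gamma_nat_eq_factorial]; congr 1; push_cast; ring
  have hg3 : (3 / 2 + (k : ℝ) + 1) = k + 5 / 2 := by ring
  have hg4 : (3 / 2 + (n : ℝ) + 1) = 5 / 2 + n := by ring
  rw [hg1, hg2, hg3, hg4, ← hD]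
  set P := ∏ l ∈ range (k + 1), (2 * (l : ℝ) + 3) with hP
  set D := (derivative^[k] (gpoly (n + 2))).eval 1
  have hPpos : 0 < P := Finset.prod_pos fun l _ => by positivity
  have hpi : 0 < Real.sqrt Real.pi := Real.sqrt_pos.2 Real.pi_pos
  have hGk : Real.Gamma (k + 5 / 2) = Real.sqrt Real.pi * P / (4 * 2 ^ k) := by
    rw [eq_div_iff (by positivity), hG]
  have hcc : (n.choose k : ℝ) = n.factorial / (k.factorial * (n - k).factorial) := by
    rw [eq_div_iff (by positivity), hc]
  rw [hGk, hcc, div_pow]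
  field_simp
  ring

theorem eigenfun_eq (n : ℕ) (x : ℝ) : eigenfun n x = gnorm n * gfun (n + 2) x := by
  rw [eigenfun, jacobiP_eq_gpoly, ← mul_assoc, gfun]
  congr 1
  have h1 : Real.Gamma (1 + n) = n.factorial := by
    rw [← Real.Gamma_nat_eq_factorial]; congr 1; ring
  have h2 : Real.Gamma (4 + n) = (n + 3).factorial := by
    rw [← Real.Gamma_nat_eq_factorial]; congr 1; push_cast; ring
  have h3 : 0 < Real.Gamma (5 / 2 + n) := Real.Gamma_pos_of_pos (by positivity)
  have hf : ((n + 3).factorial : ℝ) = (n + 3) * ((n + 2) * ((n + 1) * n.factorial)) := by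
    simp only [Nat.factorial_succ]; push_cast; ring
  have hpi := Real.pi_pos
  have hsp : 0 < Real.sqrt Real.pi := Real.sqrt_pos.2 hpi
  rw [gnorm, normConst, h1, h2]
  symm
  rw [Real.sqrt_eq_iff_mul_self_eq (by positivity) (by positivity)]
  have hfr : (freq n : ℝ) = n + 2 := by simp [freq]
  rw [hfr, hf]
  have hfac : (0 : ℝ) < n.factorial := by positivity
  rw [show ∀ s t u v w : ℝ, s / (2 * t * u) * (8 * u / (v * w)) * (s / (2 * t * u) * (8 * u / (v * w)))
      = (s ^ 2 * (8 * u) ^ 2) / ((2 * u) ^ 2 * t ^ 2 * (v ^ 2 * w ^ 2)) by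
        intros; field_simp]
  rw [Real.sq_sqrt (by positivity), Real.sq_sqrt (by positivity), Real.sq_sqrt (by positivity)]
  field_simp
  ring

theorem cbar_eq (i j m : ℕ) :
    cbar i j m = gnorm i * gnorm j * gnorm m * (Real.pi / 8 * heron (i + 2) (j + 2) (m + 2)) := by
  rw [← triple_eq, triple, ← intervalIntegral.integral_const_mul, cbar]
  congr 1
  funext x
  simp only [eigenfun_eq]
  ring

theorem ccub_eq (n i j : ℕ) :
    ccub n n i j = gnorm n ^ 2 * gnorm i * gnorm j * (Real.pi / 128 * quadCoeff n i j) := by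
  rw [← integral_gfun_sq_mul_gfun_mul_gfun, ← intervalIntegral.integral_const_mul, ccub]
  congr 1
  funext x
  simp only [eigenfun_eq]
  ring

end YM

end

noncomputable section

namespace YM

open Finset

/-! ### Reduction to rational arithmetic -/

/-- The product `(ω_n - 1) (ω_n + 1)`. -/
def zQ (n : ℕ) : ℚ := (n + 1) * (n + 3)

/-- The rational value of `π q_n / 8`. -/
def qQ (n : ℕ) : ℚ :=
  9 / 4 * ∑ ν ∈ range (2 * n + 1),
    (heron (n + 2) (n + 2) (ν + 2) : ℚ) ^ 2 / (zQ n * zQ n * zQ ν) *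
      (2 / ((ν : ℚ) + 2) ^ 2 + 1 / (((ν : ℚ) + 2) ^ 2 - (2 * ((n : ℚ) + 2)) ^ 2))

/-- The rational value of `π C_{nnmm} / 8`. -/
def cQ (n m : ℕ) : ℚ := (quadCoeff n m m : ℚ) / (16 * (zQ n * zQ m))

/-- The rational value of `π u_{nm} / 8`. -/
def uQ (c : ℚ) (n m : ℕ) : ℚ :=
  ((m : ℚ) + 2) ^ 2 * ((8 * qQ n - 3 * cQ n n) / (8 * ((n : ℚ) + 2) ^ 2)) + 3 / 4 * cQ n m
  - 9 / 2 * ∑ ν ∈ range (m + n + 1),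
      (heron (n + 2) (ν + 2) (m + 2) : ℚ) ^ 2 / (zQ n * zQ ν * zQ m) /
        (((ν : ℚ) + 2) ^ 2 - ((m + 2) + (n + 2)) ^ 2)
  - c * ∑ ν ∈ range (2 * n + 1),
      (heron (m + 2) (ν + 2) (m + 2) * heron (n + 2) (n + 2) (ν + 2) : ℚ) /
        (zQ n * zQ ν * zQ m) / ((ν : ℚ) + 2) ^ 2
  - 9 / 2 * ∑ ν ∈ range (m + n + 1),
      (heron (n + 2) (ν + 2) (m + 2) : ℚ) ^ 2 / (zQ n * zQ ν * zQ m) /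
        (((ν : ℚ) + 2) ^ 2 - ((m + 2) - (n + 2)) ^ 2)

/-- The rational value of `v_{nm}`, without the normalization factors. -/
def vQ (n m : ℕ) : ℚ :=
  3 / 8 * ((quadCoeff n (2 * n - m) m : ℚ) / (16 * zQ n))
  - 9 / 4 * ∑ ν ∈ range (2 * n + 1),
      (heron ((2 * n - m) + 2) (ν + 2) (m + 2) * heron (n + 2) (n + 2) (ν + 2) : ℚ) /
        (zQ n * zQ ν) / (((ν : ℚ) + 2) ^ 2 - (2 * ((n : ℚ) + 2)) ^ 2)
  - 9 / 2 * ∑ ν ∈ range (m + n + 1),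
      (heron (n + 2) (ν + 2) (m + 2) * heron ((2 * n - m) + 2) (n + 2) (ν + 2) : ℚ) /
        (zQ n * zQ ν) / (((ν : ℚ) + 2) ^ 2 - ((((2 * n - m : ℕ) : ℚ) + 2) - (n + 2)) ^ 2)

theorem gnorm_sq_eq_zQ (n : ℕ) : gnorm n ^ 2 = 8 / Real.pi / (zQ n : ℝ) := by
  rw [gnorm_sq]; simp [zQ]

theorem zQ_pos (n : ℕ) : (0 : ℚ) < zQ n := by unfold zQ; positivity

theorem zQ_cast_pos (n : ℕ) : (0 : ℝ) < (zQ n : ℝ) := by exact_mod_cast zQ_pos n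

theorem freq_cast (n : ℕ) : (freq n : ℝ) = n + 2 := by simp [freq]

/-- The shared index contributes the square of its normalization factor, which is rational up to π;
only the outer indices keep square roots. -/
theorem cbar_mul_cbar (i j k l m : ℕ) :
    cbar i k l * cbar j m k = gnorm i * gnorm j * gnorm l * gnorm m *
      ((Real.pi / 8) * ((heron (i + 2) (k + 2) (l + 2) * heron (j + 2) (m + 2) (k + 2) : ℝ) /
        (zQ k : ℝ))) := by
  have h := gnorm_sq_eq_zQ k
  have hz := zQ_cast_pos k
  have hpi := Real.pi_pos
  have e : gnorm k ^ 2 * (Real.pi / 8) ^ 2 = Real.pi / 8 / (zQ k : ℝ) := by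
    rw [h]; field_simp
  rw [cbar_eq, cbar_eq]
  linear_combination (gnorm i * gnorm j * gnorm l * gnorm m *
    (heron (i + 2) (k + 2) (l + 2) * heron (j + 2) (m + 2) (k + 2))) * e

theorem cbar_sq (i k l : ℕ) :
    cbar i k l ^ 2 = 8 / Real.pi * ((heron (i + 2) (k + 2) (l + 2) : ℝ) ^ 2 /
      ((zQ i : ℝ) * zQ k * zQ l)) := by
  have hi := zQ_cast_pos i
  have hk := zQ_cast_pos k
  have hl := zQ_cast_pos l
  have hpi := Real.pi_pos
  have e : cbar i k l ^ 2 = (gnorm i ^ 2) * (gnorm k ^ 2) * (gnorm l ^ 2) *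
      ((Real.pi / 8) ^ 2 * (heron (i + 2) (k + 2) (l + 2) : ℝ) ^ 2) := by
    rw [cbar_eq]; ring
  rw [e, gnorm_sq_eq_zQ, gnorm_sq_eq_zQ, gnorm_sq_eq_zQ]
  field_simp

theorem ccub_self_eq (n m : ℕ) : ccub n n m m = 8 / Real.pi * (cQ n m : ℝ) := by
  have hn := zQ_cast_pos n
  have hm := zQ_cast_pos m
  have hpi := Real.pi_pos
  have e : ccub n n m m = gnorm n ^ 2 * gnorm m ^ 2 * (Real.pi / 128 * quadCoeff n m m) := by
    rw [ccub_eq]; ring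
  rw [e, gnorm_sq_eq_zQ, gnorm_sq_eq_zQ, cQ]
  push_cast
  field_simp
  ring

theorem q_eq (n : ℕ) : q n = 8 / Real.pi * (qQ n : ℝ) := by
  rw [q, qQ]
  push_cast
  rw [mul_left_comm, Finset.mul_sum (a := 8 / Real.pi)]
  congr 1
  refine Finset.sum_congr rfl fun ν _ => ?_
  rw [cbar_sq, freq_cast, freq_cast]
  ring

/-- The excluded indices are those where the denominator vanishes, and division by zero gives zero,
so the filter can be dropped. -/
theorem sum_nonresonantRange (f : ℕ → ℝ) (n m : ℕ) :
    ∑ ν ∈ nonresonantRange n m, f ν / ((freq ν : ℝ) ^ 2 - ((freq m : ℝ) - freq n) ^ 2) =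
      ∑ ν ∈ range (m + n + 1), f ν / ((freq ν : ℝ) ^ 2 - ((freq m : ℝ) - freq n) ^ 2) := by
  unfold nonresonantRange
  refine Finset.sum_filter_of_ne fun ν _ h => ?_
  by_contra hc
  apply h
  have : (freq ν : ℝ) ^ 2 - ((freq m : ℝ) - freq n) ^ 2 = 0 := by
    have h1 : (freq ν : ℤ) = freq m - freq n ∨ freq ν = - (freq m - freq n) := by
      unfold freq; omega
    have h2 : ((freq ν : ℝ) = freq m - freq n) ∨ ((freq ν : ℝ) = - (freq m - freq n)) := by
      rcases h1 with h1 | h1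
      · left; exact_mod_cast h1
      · right; exact_mod_cast h1
    rcases h2 with h2 | h2 <;> rw [h2] <;> ring
  rw [this, div_zero]

/-- Positivity of the radicand removes the square root; the amplitude enters `u` only through its
square. -/
theorem amplitude_sq {n : ℕ} (h : 0 < 8 * qQ n - 3 * cQ n n) :
    amplitude n ^ 2 * (8 / Real.pi * ((8 * qQ n - 3 * cQ n n : ℚ) : ℝ)) =
      8 * ((n : ℝ) + 2) ^ 2 := by
  have h' : (0 : ℝ) < ((8 * qQ n - 3 * cQ n n : ℚ) : ℝ) := by exact_mod_cast h
  have hpi := Real.pi_pos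
  have e : 8 * q n - 3 * ccub n n n n = 8 / Real.pi * ((8 * qQ n - 3 * cQ n n : ℚ) : ℝ) := by
    rw [q_eq, ccub_self_eq]; push_cast; ring
  rw [amplitude, e, mul_pow, Real.sq_sqrt (by positivity), freq_cast]
  field_simp
  norm_num

theorem coeffU_eq {n : ℕ} (h : 0 < 8 * qQ n - 3 * cQ n n) (c : ℚ) (m : ℕ) :
    coeffU (c : ℝ) n m = 8 / Real.pi * (uQ c n m : ℝ) := by
  have hA := amplitude_sq h
  have h' : (0 : ℝ) < ((8 * qQ n - 3 * cQ n n : ℚ) : ℝ) := by exact_mod_cast h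
  have hpi := Real.pi_pos
  have e1 : ((freq m : ℝ) / amplitude n) ^ 2 = 8 / Real.pi *
      (((m : ℝ) + 2) ^ 2 * (((8 * qQ n - 3 * cQ n n : ℚ) : ℝ) / (8 * ((n : ℝ) + 2) ^ 2))) := by
    have hA0 : amplitude n ^ 2 ≠ 0 := by
      intro h0
      rw [h0] at hA
      have : (0 : ℝ) < 8 * ((n : ℝ) + 2) ^ 2 := by positivity
      linarith
    rw [← hA, div_pow, freq_cast]
    generalize amplitude n ^ 2 = A at hA0
    field_simp
  rw [coeffU, sum_nonresonantRange, e1, ccub_self_eq]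
  have e2 : ∀ ν : ℕ, cbar n ν m ^ 2 / ((freq ν : ℝ) ^ 2 - ((freq m : ℝ) + freq n) ^ 2) =
      8 / Real.pi * ((heron (n + 2) (ν + 2) (m + 2) : ℝ) ^ 2 / ((zQ n : ℝ) * zQ ν * zQ m) /
        (((ν : ℝ) + 2) ^ 2 - ((m + 2) + (n + 2)) ^ 2)) := by
    intro ν; rw [cbar_sq]; simp only [freq_cast]; ring
  have e3 : ∀ ν : ℕ, cbar m n ν ^ 2 / ((freq ν : ℝ) ^ 2 - ((freq m : ℝ) - freq n) ^ 2) =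
      8 / Real.pi * ((heron (n + 2) (ν + 2) (m + 2) : ℝ) ^ 2 / ((zQ n : ℝ) * zQ ν * zQ m) /
        (((ν : ℝ) + 2) ^ 2 - ((m + 2) - (n + 2)) ^ 2)) := by
    intro ν
    have : cbar m n ν = cbar n ν m := by
      unfold cbar; congr 1; funext x; ring
    rw [this, cbar_sq]; simp only [freq_cast]; ring
  have e4 : ∀ ν : ℕ, cbar m ν m * cbar n n ν / (freq ν : ℝ) ^ 2 =
      8 / Real.pi * ((heron (m + 2) (ν + 2) (m + 2) * heron (n + 2) (n + 2) (ν + 2) : ℝ) /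
        ((zQ n : ℝ) * zQ ν * zQ m) / ((ν : ℝ) + 2) ^ 2) := by
    intro ν
    have hn := zQ_cast_pos n
    have hm := zQ_cast_pos m
    have e : ∀ X : ℝ, gnorm m * gnorm n * gnorm m * gnorm n * X =
      gnorm m ^ 2 * gnorm n ^ 2 * X := by intro X; ring
    rw [cbar_mul_cbar, e, gnorm_sq_eq_zQ, gnorm_sq_eq_zQ, freq_cast]
    field_simp
  simp only [e2, e3, e4, ← Finset.mul_sum]
  rw [uQ]
  push_cast
  ring

/-- The two remaining irrational factors are symmetric under `m ↔ 2 n - m` for `m ≤ 2 n`, so they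
appear squared in the determinant and in `v_{nn}`. -/
theorem coeffV_eq (n m : ℕ) :
    coeffV n m = gnorm m * gnorm (2 * n - m) * (vQ n m : ℝ) := by
  have hz := zQ_cast_pos n
  have hpi := Real.pi_pos
  rw [coeffV]
  set m' := 2 * n - m with hm'
  have hr : ∑ ν ∈ nonresonantRange n m, cbar n ν m * cbar m' n ν /
      ((freq ν : ℝ) ^ 2 - ((freq m' : ℝ) - freq n) ^ 2) =
      ∑ ν ∈ range (m + n + 1), cbar n ν m * cbar m' n ν /
      ((freq ν : ℝ) ^ 2 - ((freq m' : ℝ) - freq n) ^ 2) := by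
    by_cases hm : m ≤ 2 * n
    · have e : ((freq m' : ℝ) - freq n) ^ 2 = ((freq m : ℝ) - freq n) ^ 2 := by
        simp only [freq_cast, hm', Nat.cast_sub hm]; push_cast; ring
      rw [e]
      exact sum_nonresonantRange (fun ν => cbar n ν m * cbar m' n ν) n m
    -- For `m > 2 n` the truncated `2 n - m` no longer gives the same denominator, but the only
    -- excluded index, `m - n - 2`, violates the triangle inequality.
    · unfold nonresonantRange
      refine Finset.sum_filter_of_ne fun ν _ h => ?_
      by_contra hc
      apply h
      have h0 : heron (n + 2) (ν + 2) (m + 2) = 0 := heron_of_not_triangle (by omega)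
      simp [cbar_eq, h0]
  have h1 : ccub n m' n m = gnorm m * gnorm m' * ((quadCoeff n m' m : ℝ) / (16 * zQ n)) := by
    have : ccub n m' n m = ccub n n m' m := by unfold ccub; congr 1; funext x; ring
    rw [this, ccub_eq, gnorm_sq_eq_zQ]
    field_simp
    ring
  have e2 : ∀ ν : ℕ, cbar m' ν m * cbar n n ν /
      ((freq ν : ℝ) ^ 2 - (2 * (freq n : ℝ)) ^ 2) =
      gnorm m * gnorm m' *
      ((heron (m' + 2) (ν + 2) (m + 2) * heron (n + 2) (n + 2) (ν + 2) : ℝ) /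
        ((zQ n : ℝ) * zQ ν) / (((ν : ℝ) + 2) ^ 2 - (2 * ((n : ℝ) + 2)) ^ 2)) := by
    intro ν
    have e : ∀ X : ℝ, gnorm m' * gnorm n * gnorm m * gnorm n * X =
      gnorm m * gnorm m' * (gnorm n ^ 2 * X) := by intro X; ring
    rw [cbar_mul_cbar, e, gnorm_sq_eq_zQ, freq_cast, freq_cast]
    field_simp
  have e3 : ∀ ν : ℕ, cbar n ν m * cbar m' n ν /
      ((freq ν : ℝ) ^ 2 - ((freq m' : ℝ) - freq n) ^ 2) =
      gnorm m * gnorm m' *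
      ((heron (n + 2) (ν + 2) (m + 2) * heron (m' + 2) (n + 2) (ν + 2) : ℝ) /
        ((zQ n : ℝ) * zQ ν) / (((ν : ℝ) + 2) ^ 2 - (((m' : ℝ) + 2) - (n + 2)) ^ 2)) := by
    intro ν
    have e : ∀ X : ℝ, gnorm n * gnorm m' * gnorm m * gnorm n * X =
      gnorm m * gnorm m' * (gnorm n ^ 2 * X) := by intro X; ring
    rw [cbar_mul_cbar, e, gnorm_sq_eq_zQ]
    simp only [freq_cast]
    field_simp
  rw [hr, h1]
  simp only [e2, e3, ← Finset.mul_sum]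
  rw [vQ]
  push_cast
  rw [← hm']
  ring

/-! ### Finite checks for γ ≤ 5 -/

set_option maxRecDepth 100000 in
theorem quartic_lt_quadratic_rat : ∀ n ≤ 5, 0 < 8 * qQ n - 3 * cQ n n := by
  decide +kernel

set_option maxRecDepth 100000 in
theorem det_rat_ne_zero : ∀ n ≤ 5, ∀ m < n, ∀ c ∈ ({9 / 2, 9 / 4} : Finset ℚ),
    uQ c n m * uQ c n (2 * n - m) -
      vQ n m * vQ n (2 * n - m) / (zQ m * zQ (2 * n - m)) ≠ 0 := by
  decide +kernel

set_option maxRecDepth 100000 in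
theorem diag_rat_ne_zero : ∀ n ≤ 5, ∀ c ∈ ({9 / 2, 9 / 4} : Finset ℚ),
    uQ c n n + vQ n n / zQ n ≠ 0 := by
  decide +kernel

/-! ### Closed form and positivity of `u` for large m -/

theorem sum_range_even {M : Type*} [AddCommMonoid M] (f : ℕ → M) (h : ∀ k, f (2 * k + 1) = 0)
    (n : ℕ) : ∑ l ∈ range (2 * n + 1), f l = ∑ k ∈ range (n + 1), f (2 * k) := by
  induction n with
  | zero => simp
  | succ n ih =>
    rw [show 2 * (n + 1) + 1 = 2 * n + 1 + 1 + 1 by ring, Finset.sum_range_succ,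
      Finset.sum_range_succ, ih, h, add_zero, Finset.sum_range_succ _ (n + 1)]
    rfl

/-- Telescopes, because `1/(c² - 1)` is half of `1/(c - 1) - 1/(c + 1)` and `c` advances by 2. -/
theorem sum_inv_sq_sub_one (d : ℚ) (hd : 0 < d) (J : ℕ) :
    ∑ k ∈ range J, 1 / ((d + 2 * (k + 1)) ^ 2 - 1) = J / ((d + 1) * (d + 2 * J + 1)) := by
  induction J with
  | zero => simp
  | succ J ih =>
    rw [Finset.sum_range_succ, ih]
    have e : (d + 2 * ((J : ℚ) + 1)) ^ 2 - 1 = (d + 2 * J + 1) * (d + 2 * J + 3) := by ring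
    rw [e]
    push_cast
    have h3 : d + 2 * ((J : ℚ) + 1) + 1 = d + 2 * J + 3 := by ring
    rw [h3]
    field_simp
    ring

/-- Heron's formula as `((a + b)² - c²)(c² - (a - b)²)`: the two factors are, up to sign, the
denominators in the two sums of squares. -/
theorem sixteen_mul_heron {n k d : ℕ} (hk : k ≤ n) :
    (16 * heron (n + 2) (d + 2 * k + 2) (n + d + 2) : ℚ) =
      ((2 * n + d + 4 : ℚ) ^ 2 - (d + 2 * (k + 1)) ^ 2) *
        ((d + 2 * (k + 1) : ℚ) ^ 2 - d ^ 2) := by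
  rw [heron_eq (p := n + d + k + 3) (by omega)]
  have e1 : n + d + k + 3 - (n + 2) = d + k + 1 := by omega
  have e2 : n + d + k + 3 - (d + 2 * k + 2) = n - k + 1 := by omega
  have e3 : n + d + k + 3 - (n + d + 2) = k + 1 := by omega
  rw [e1, e2, e3]
  push_cast [Nat.cast_sub hk]
  ring

/-- The two sums in `u` with the squares of the cubic coefficients, in closed form. -/
theorem sum_heron_sq_eq (n d : ℕ) (hd : 0 < d) :
    (∑ ν ∈ range (n + d + n + 1),
      (heron (n + 2) (ν + 2) (n + d + 2) : ℚ) ^ 2 / (zQ n * zQ ν * zQ (n + d)) /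
        (((ν : ℚ) + 2) ^ 2 - (((n + d : ℕ) + 2) + (n + 2)) ^ 2)) +
    (∑ ν ∈ range (n + d + n + 1),
      (heron (n + 2) (ν + 2) (n + d + 2) : ℚ) ^ 2 / (zQ n * zQ ν * zQ (n + d)) /
        (((ν : ℚ) + 2) ^ 2 - (((n + d : ℕ) + 2) - (n + 2)) ^ 2)) =
    1 / (zQ n * zQ (n + d)) * (1 / 128) *
      ((∑ k ∈ range (n + 1),
        ((d + 2 * (k + 1)) ^ 4
          + (1 - (d ^ 2 + (2 * n + d + 4) ^ 2 + ((n + d + 2) ^ 2 + (n + 2) ^ 2)))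
            * (d + 2 * (k + 1)) ^ 2
          + (1 - (d ^ 2 + (2 * n + d + 4) ^ 2 + ((n + d + 2) ^ 2 + (n + 2) ^ 2))
            + (d ^ 2 * (2 * n + d + 4) ^ 2
              + (d ^ 2 + (2 * n + d + 4) ^ 2) * ((n + d + 2) ^ 2 + (n + 2) ^ 2))) : ℚ))
        + (d - 1) * (2 * n + d + 5) * (1 - ((n + d + 2) ^ 2 + (n + 2) ^ 2)) * (n + 1)) := by
  rw [← Finset.sum_add_distrib, show n + d + n + 1 = d + (2 * n + 1) by ring,
    Finset.sum_range_add]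
  have hd' : (0 : ℚ) < d := by exact_mod_cast hd
  have hz1 := zQ_pos n
  have hz2 := zQ_pos (n + d)
  -- By the triangle inequality and parity only `ν = d + 2 k` with `k ≤ n` contributes.
  have h0 : ∀ ν ∈ range d, heron (n + 2) (ν + 2) (n + d + 2) = 0 := by
    intro ν hν
    have hν := Finset.mem_range.1 hν
    by_cases hp : ν + 1 = d
    · exact heron_of_odd (p := n + d + 2) (by omega)
    · exact heron_of_not_triangle (by omega)
  rw [Finset.sum_eq_zero (s := range d), zero_add, sum_range_even]
  · have e : ∀ k ∈ range (n + 1),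
        ((heron (n + 2) (d + 2 * k + 2) (n + d + 2) : ℚ) ^ 2 /
          (zQ n * zQ (d + 2 * k) * zQ (n + d)) /
          ((((d + 2 * k : ℕ) : ℚ) + 2) ^ 2 - (((n + d : ℕ) + 2) + (n + 2)) ^ 2) +
        (heron (n + 2) (d + 2 * k + 2) (n + d + 2) : ℚ) ^ 2 /
          (zQ n * zQ (d + 2 * k) * zQ (n + d)) /
          ((((d + 2 * k : ℕ) : ℚ) + 2) ^ 2 - (((n + d : ℕ) + 2) - (n + 2)) ^ 2)) =
        1 / (zQ n * zQ (n + d)) * (1 / 128) *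
        (((d + 2 * (k + 1)) ^ 4
          + (1 - (d ^ 2 + (2 * n + d + 4) ^ 2 + ((n + d + 2) ^ 2 + (n + 2) ^ 2)))
            * (d + 2 * (k + 1)) ^ 2
          + (1 - (d ^ 2 + (2 * n + d + 4) ^ 2 + ((n + d + 2) ^ 2 + (n + 2) ^ 2))
            + (d ^ 2 * (2 * n + d + 4) ^ 2
              + (d ^ 2 + (2 * n + d + 4) ^ 2) * ((n + d + 2) ^ 2 + (n + 2) ^ 2)))) +
          (1 - d ^ 2) * (1 - (2 * n + d + 4) ^ 2) * (1 - ((n + d + 2) ^ 2 + (n + 2) ^ 2)) *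
            (1 / ((d + 2 * (k + 1)) ^ 2 - 1))) := by
      intro k hk
      have hk' : k ≤ n := by have := Finset.mem_range.1 hk; omega
      have hkq : (k : ℚ) ≤ n := by exact_mod_cast hk'
      have hk0 : (0 : ℚ) ≤ k := Nat.cast_nonneg k
      have hH := sixteen_mul_heron (d := d) hk'
      have hH' : (heron (n + 2) (d + 2 * k + 2) (n + d + 2) : ℚ) =
          ((2 * n + d + 4 : ℚ) ^ 2 - (d + 2 * (k + 1)) ^ 2) *
            ((d + 2 * (k + 1) : ℚ) ^ 2 - d ^ 2) / 16 := by linarith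
      rw [hH']
      have hz3 : zQ (d + 2 * k) = (d + 2 * (k + 1)) ^ 2 - 1 := by
        unfold zQ; push_cast; ring
      rw [hz3]
      push_cast
      have h1 : ((d : ℚ) + 2 * k + 2) ^ 2 - ((n + d + 2) + (n + 2)) ^ 2 =
        - ((2 * n + d + 4 : ℚ) ^ 2 - (d + 2 * (k + 1)) ^ 2) := by ring
      have h2 : ((d : ℚ) + 2 * k + 2) ^ 2 - ((n + d + 2) - (n + 2)) ^ 2 =
        ((d + 2 * (k + 1) : ℚ) ^ 2 - d ^ 2) := by ring
      rw [h1, h2]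
      have hA : (2 * n + d + 4 : ℚ) ^ 2 - (d + 2 * (k + 1)) ^ 2 ≠ 0 := by
        have : 0 < (2 * n + d + 4 : ℚ) ^ 2 - (d + 2 * (k + 1)) ^ 2 := by nlinarith
        exact this.ne'
      have hB : (d + 2 * (k + 1) : ℚ) ^ 2 - d ^ 2 ≠ 0 := by
        have : 0 < (d + 2 * (k + 1) : ℚ) ^ 2 - d ^ 2 := by nlinarith
        exact this.ne'
      have hC : (d + 2 * (k + 1) : ℚ) ^ 2 - 1 ≠ 0 := by
        have : 0 < (d + 2 * (k + 1) : ℚ) ^ 2 - 1 := by nlinarith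
        exact this.ne'
      -- With `A = s² - c²`, `B = c² - d²` and `r = (s² + d²)/2`, the two terms add up to a multiple
      -- of `A B (r - c²)/(c² - 1)`. Division by `c² - 1` leaves the remainder `(1 - d²)(1 - s²)(1 -
      -- r)`.
      have hr : ((n : ℚ) + d + 2) ^ 2 + (n + 2) ^ 2 =
          ((2 * n + d + 4 : ℚ) ^ 2 + d ^ 2) / 2 := by ring
      rw [hr]
      generalize (d + 2 * ((k : ℚ) + 1)) = c at hA hB hC ⊢
      generalize (2 * (n : ℚ) + d + 4) = s at hA ⊢
      field_simp
      ring
    -- The remainders telescope to a multiple of `1/((d + 1)(s - 1))`, which cancels against `(1 -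
    -- d²)(1 - s²)`.
    rw [Finset.sum_congr rfl e, ← Finset.mul_sum, Finset.sum_add_distrib, ← Finset.mul_sum,
      sum_inv_sq_sub_one _ hd']
    congr 2
    have h3 : (d : ℚ) + 2 * ((n + 1 : ℕ) : ℚ) + 1 = 2 * n + d + 3 := by push_cast; ring
    rw [h3]
    push_cast
    field_simp
    ring
  · intro k
    have : heron (n + 2) (d + (2 * k + 1) + 2) (n + d + 2) = 0 :=
      heron_of_odd (p := n + d + k + 3) (by omega)
    simp [this]
  · intro ν hν
    simp [h0 ν hν]

theorem heron_isosceles {m k : ℕ} (hk : k ≤ m) :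
    (heron (m + 2) (2 * k + 2) (m + 2) : ℚ) = (m + k + 3) * (k + 1) ^ 2 * (m + 1 - k) := by
  rw [heron_eq (p := m + k + 3) (by omega)]
  have e1 : m + k + 3 - (m + 2) = k + 1 := by omega
  have e2 : m + k + 3 - (2 * k + 2) = m - k + 1 := by omega
  rw [e1, e2]
  push_cast [Nat.cast_sub hk]
  ring

theorem heron_isosceles' {m k : ℕ} (hk : k ≤ m) :
    (heron (m + 2) (m + 2) (2 * k + 2) : ℚ) = (m + k + 3) * (k + 1) ^ 2 * (m + 1 - k) := by
  rw [← heron_isosceles hk]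
  rw [heron_eq (p := m + k + 3) (by omega), heron_eq (p := m + k + 3) (by omega)]
  push_cast; ring

/-- The sum in `u` with the squares of the frequencies in the denominator, in closed form. -/
theorem sum_heron_mul_heron_eq (n m : ℕ) (h : n ≤ m) :
    ∑ ν ∈ range (2 * n + 1),
      (heron (m + 2) (ν + 2) (m + 2) * heron (n + 2) (n + 2) (ν + 2) : ℚ) /
        (zQ n * zQ ν * zQ m) / ((ν : ℚ) + 2) ^ 2 =
    1 / (zQ n * zQ m) * ∑ k ∈ range (n + 1),
      (((m : ℚ) + 2) ^ 2 - (k + 1) ^ 2) * (((n : ℚ) + 2) ^ 2 - (k + 1) ^ 2) * (k + 1) ^ 2 /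
        (4 * ((2 * k + 1) * (2 * k + 3))) := by
  have hz1 := zQ_pos n
  have hz2 := zQ_pos m
  rw [sum_range_even, Finset.mul_sum]
  · refine Finset.sum_congr rfl fun k hk => ?_
    have hk' : k ≤ n := by have := Finset.mem_range.1 hk; omega
    rw [heron_isosceles (hk'.trans h), heron_isosceles' hk']
    have hz3 : zQ (2 * k) = (2 * k + 1) * (2 * k + 3) := by
      unfold zQ; push_cast; ring
    rw [hz3]
    push_cast
    have h2 : (2 * (k : ℚ) + 2) ^ 2 = 4 * (k + 1) ^ 2 := by ring
    rw [h2]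
    field_simp
    ring
  · intro k
    have : heron (m + 2) (2 * k + 1 + 2) (m + 2) = 0 :=
      heron_of_odd (p := m + k + 3) (by omega)
    simp [this]

/-- The frequencies `2m + 2`, `2m + 4`, `2m + 6` exceed the degree `2 n` of the square. -/
theorem quadCoeff_diag {n m : ℕ} (h : n ≤ m) :
    (quadCoeff n m m : ℚ) = 2 * ((m + 2) * (m + 2) + 1) * squareCoeff n 0
      - (m + 3) * (m + 1) * (squareCoeff n 2 + squareCoeff n (-2)) := by
  unfold quadCoeff
  rw [squareCoeff_eq_zero (k := (m : ℤ) + m + 2) (by omega),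
    squareCoeff_eq_zero (k := (m : ℤ) + m + 4) (by omega),
    squareCoeff_eq_zero (k := (m : ℤ) + m + 6) (by omega)]
  simp only [sub_self, zero_add, zero_sub]
  push_cast
  ring

/-- A closed form of `u`. -/
theorem zQ_mul_uQ_eq (c : ℚ) (n d : ℕ) (hd : 0 < d) :
    zQ (n + d) * uQ c n (n + d) =
      zQ (n + d) * ((n + d : ℚ) + 2) ^ 2 *
        ((8 * qQ n - 3 * cQ n n) / (8 * ((n : ℚ) + 2) ^ 2)) +
      1 / zQ n * (
        3 / 64 * (2 * ((n + d + 2) * (n + d + 2) + 1) * squareCoeff n 0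
          - (n + d + 3) * (n + d + 1) * (squareCoeff n 2 + squareCoeff n (-2)))
        - 9 / 256 *
      ((∑ k ∈ range (n + 1),
        ((d + 2 * (k + 1)) ^ 4
          + (1 - (d ^ 2 + (2 * n + d + 4) ^ 2 + ((n + d + 2) ^ 2 + (n + 2) ^ 2)))
            * (d + 2 * (k + 1)) ^ 2
          + (1 - (d ^ 2 + (2 * n + d + 4) ^ 2 + ((n + d + 2) ^ 2 + (n + 2) ^ 2))
            + (d ^ 2 * (2 * n + d + 4) ^ 2
              + (d ^ 2 + (2 * n + d + 4) ^ 2) * ((n + d + 2) ^ 2 + (n + 2) ^ 2))) : ℚ))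
        + (d - 1) * (2 * n + d + 5) * (1 - ((n + d + 2) ^ 2 + (n + 2) ^ 2)) * (n + 1))
        - c * ∑ k ∈ range (n + 1),
      (((n : ℚ) + d + 2) ^ 2 - (k + 1) ^ 2) * (((n : ℚ) + 2) ^ 2 - (k + 1) ^ 2) * (k + 1) ^ 2 /
        (4 * ((2 * k + 1) * (2 * k + 3)))) := by
  have h1 := sum_heron_sq_eq n d hd
  have h2 := sum_heron_mul_heron_eq n (n + d) (by omega)
  have hz1 := zQ_pos n
  have hz2 := zQ_pos (n + d)
  have h3 : cQ n (n + d) = (2 * ((n + d + 2) * (n + d + 2) + 1) * squareCoeff n 0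
      - (n + d + 3) * (n + d + 1) * (squareCoeff n 2 + squareCoeff n (-2))) /
        (16 * (zQ n * zQ (n + d))) := by
    rw [cQ, quadCoeff_diag (by omega)]; push_cast; ring
  rw [uQ, h2, h3]
  rw [← eq_sub_iff_add_eq] at h1
  rw [h1]
  push_cast
  generalize zQ (n + d) = z2 at *
  generalize zQ n = z1 at *
  field_simp
  ring

set_option maxRecDepth 100000 in
theorem quartic_values :
    (8 * qQ 0 - 3 * cQ 0 0 = 5 / 3 ∧ 8 * qQ 1 - 3 * cQ 1 1 = 9 / 4 ∧
      8 * qQ 2 - 3 * cQ 2 2 = 218 / 75 ∧ 8 * qQ 3 - 3 * cQ 3 3 = 43 / 12 ∧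
      8 * qQ 4 - 3 * cQ 4 4 = 747 / 175 ∧ 8 * qQ 5 - 3 * cQ 5 5 = 119 / 24) := by
  decide +kernel

set_option maxRecDepth 100000 in
theorem squareCoeff_values :
    (squareCoeff 0 0 = 4 ∧ squareCoeff 1 0 = 32 ∧ squareCoeff 2 0 = 136 ∧
      squareCoeff 3 0 = 416 ∧ squareCoeff 4 0 = 1036 ∧ squareCoeff 5 0 = 2240) ∧
    (squareCoeff 0 2 = 0 ∧ squareCoeff 1 2 = 16 ∧ squareCoeff 2 2 = 96 ∧
      squareCoeff 3 2 = 336 ∧ squareCoeff 4 2 = 896 ∧ squareCoeff 5 2 = 2016) ∧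
    (squareCoeff 0 (-2) = 0 ∧ squareCoeff 1 (-2) = 16 ∧ squareCoeff 2 (-2) = 96 ∧
      squareCoeff 3 (-2) = 336 ∧ squareCoeff 4 (-2) = 896 ∧ squareCoeff 5 (-2) = 2016) := by
  decide +kernel

/-- For fixed `n` all sums in `zQ_mul_uQ_eq` have length `n + 1`, so the expression is a polynomial
in `m`. -/
theorem uQ_pos {n m : ℕ} (hn : n ≤ 5) (hm : 2 * n + 1 ≤ m) (c : ℚ)
    (hc : c = 9 / 2 ∨ c = 9 / 4) : 0 < uQ c n m := by
  -- Counting from `m = 2 n + 1` leaves no negative coefficient in `t` and a positive constant term,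
  -- for each `n ≤ 5` and both values of `c`.
  obtain ⟨t, rfl⟩ : ∃ t, m = n + (n + 1 + t) := ⟨m - (2 * n + 1), by omega⟩
  have h := zQ_mul_uQ_eq c n (n + 1 + t) (by omega)
  have hz := zQ_pos (n + (n + 1 + t))
  refine pos_of_mul_pos_right ?_ hz.le
  rw [h]
  clear h hz hm
  obtain ⟨q0, q1, q2, q3, q4, q5⟩ := quartic_values
  obtain ⟨⟨a0, a1, a2, a3, a4, a5⟩, ⟨b0, b1, b2, b3, b4, b5⟩, ⟨c0, c1, c2, c3, c4, c5⟩⟩ :=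
    squareCoeff_values
  interval_cases n
  · rw [q0, a0, b0, c0]
    rcases hc with rfl | rfl <;>
    · simp only [Finset.sum_range_succ, Finset.sum_range_zero, zQ]
      push_cast
      ring_nf
      positivity
  · rw [q1, a1, b1, c1]
    rcases hc with rfl | rfl <;>
    · simp only [Finset.sum_range_succ, Finset.sum_range_zero, zQ]
      push_cast
      ring_nf
      positivity
  · rw [q2, a2, b2, c2]
    rcases hc with rfl | rfl <;>
    · simp only [Finset.sum_range_succ, Finset.sum_range_zero, zQ]
      push_cast
      ring_nf
      positivity
  · rw [q3, a3, b3, c3]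
    rcases hc with rfl | rfl <;>
    · simp only [Finset.sum_range_succ, Finset.sum_range_zero, zQ]
      push_cast
      ring_nf
      positivity
  · rw [q4, a4, b4, c4]
    rcases hc with rfl | rfl <;>
    · simp only [Finset.sum_range_succ, Finset.sum_range_zero, zQ]
      push_cast
      ring_nf
      positivity
  · rw [q5, a5, b5, c5]
    rcases hc with rfl | rfl <;>
    · simp only [Finset.sum_range_succ, Finset.sum_range_zero, zQ]
      push_cast
      ring_nf
      positivity

theorem cast_rat_of_mem {c : ℝ} (hc : c = 9 / 2 ∨ c = 9 / 4) :
    ∃ c' : ℚ, c = c' ∧ (c' = 9 / 2 ∨ c' = 9 / 4) := by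
  rcases hc with rfl | rfl
  · exact ⟨9 / 2, by norm_num, Or.inl rfl⟩
  · exact ⟨9 / 4, by norm_num, Or.inr rfl⟩

theorem nondegeneracyInequalities {n : ℕ} (hn : n ≤ 5) (c : ℝ) (hc : c = 9 / 2 ∨ c = 9 / 4) :
    NondegeneracyInequalities c n := by
  obtain ⟨c, rfl, hc'⟩ := cast_rat_of_mem hc
  have hq := quartic_lt_quadratic_rat n hn
  have hmem : c ∈ ({9 / 2, 9 / 4} : Finset ℚ) := by simpa using hc'
  have hpi := Real.pi_pos
  refine ⟨?_, fun m hm => ?_, fun m hm => ?_⟩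
  · have h := diag_rat_ne_zero n hn c hmem
    rw [coeffU_eq hq, coeffV_eq, show 2 * n - n = n by omega]
    have e : 8 / Real.pi * (uQ c n n : ℝ) + gnorm n * gnorm n * (vQ n n : ℝ) =
        8 / Real.pi * ((uQ c n n + vQ n n / zQ n : ℚ) : ℝ) := by
      rw [← pow_two, gnorm_sq_eq_zQ]; push_cast; ring
    rw [e]
    exact mul_ne_zero (by positivity) (by exact_mod_cast h)
  · rw [coeffU_eq hq]
    have := uQ_pos hn hm c hc'
    exact mul_ne_zero (by positivity) (by exact_mod_cast this.ne')
  · have h := det_rat_ne_zero n hn m hm c hmem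
    rw [coeffD, coeffU_eq hq, coeffU_eq hq, coeffV_eq, coeffV_eq,
      show 2 * n - (2 * n - m) = m by omega]
    have e : 8 / Real.pi * (uQ c n m : ℝ) * (8 / Real.pi * (uQ c n (2 * n - m) : ℝ)) -
        gnorm m * gnorm (2 * n - m) * (vQ n m : ℝ) *
          (gnorm (2 * n - m) * gnorm m * (vQ n (2 * n - m) : ℝ)) =
        (8 / Real.pi) ^ 2 * ((uQ c n m * uQ c n (2 * n - m) -
          vQ n m * vQ n (2 * n - m) / (zQ m * zQ (2 * n - m)) : ℚ) : ℝ) := by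
      have e1 : ∀ x y v w : ℝ, x * y * v * (y * x * w) = x ^ 2 * y ^ 2 * (v * w) := by
        intros; ring
      rw [e1, gnorm_sq_eq_zQ, gnorm_sq_eq_zQ]; push_cast; ring
    rw [e]
    exact mul_ne_zero (by positivity) (by exact_mod_cast h)

theorem ccub_lt_q {n : ℕ} (hn : n ≤ 5) : 3 * ccub n n n n < 8 * q n := by
  have h := quartic_lt_quadratic_rat n hn
  have h' : (0 : ℝ) < ((8 * qQ n - 3 * cQ n n : ℚ) : ℝ) := by exact_mod_cast h
  have hpi := Real.pi_pos
  have e : 8 * q n - 3 * ccub n n n n = 8 / Real.pi * ((8 * qQ n - 3 * cQ n n : ℚ) : ℝ) := by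
    rw [q_eq, ccub_self_eq]; push_cast; ring
  have : 0 < 8 * q n - 3 * ccub n n n n := by rw [e]; positivity
  linarith

/-! ### Growth bounds and selection rules -/

theorem gnorm_le (n : ℕ) : gnorm n ≤ 2 / (n + 1) := by
  have hpi := Real.pi_gt_three
  have h := gnorm_sq n
  have h2 : gnorm n ^ 2 ≤ (2 / ((n : ℝ) + 1)) ^ 2 := by
    rw [h, div_pow, div_div, div_le_div_iff₀ (by positivity) (by positivity)]
    have h0 : (0 : ℝ) ≤ n := Nat.cast_nonneg n
    nlinarith [mul_nonneg h0 h0, mul_nonneg (mul_nonneg h0 h0) (sub_nonneg.2 hpi.le),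
      mul_nonneg h0 (sub_nonneg.2 hpi.le)]
  exact (sq_le_sq₀ (gnorm_pos n).le (by positivity)).1 h2

/-- The area is half of `a b` times the sine of the enclosed angle. -/
theorem four_mul_heron_le (a b c : ℕ) : 4 * heron a b c ≤ a ^ 2 * b ^ 2 := by
  by_cases hp : (a + b + c) % 2 = 0
  · by_cases h : b + c ≤ a ∨ a + c ≤ b ∨ a + b ≤ c
    · rw [heron_of_not_triangle h]; simp
    · obtain ⟨x, y, z, rfl, rfl, rfl⟩ : ∃ x y z, a = y + z ∧ b = x + z ∧ c = x + y :=
        ⟨(b + c - a) / 2, (a + c - b) / 2, (a + b - c) / 2, by omega, by omega, by omega⟩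
      rw [heron_eq (p := x + y + z) (by omega)]
      have e1 : x + y + z - (y + z) = x := by omega
      have e2 : x + y + z - (x + z) = y := by omega
      have e3 : x + y + z - (x + y) = z := by omega
      rw [e1, e2, e3]
      zify
      -- The difference of the two sides is exactly this square, as `(y + z)(x + z) = x y + z (x + y
      -- + z)`.
      nlinarith [sq_nonneg ((z : ℤ) * (x + y + z) - x * y)]
  · rw [heron_of_odd (p := (a + b + c) / 2) (by omega)]; simp

theorem cbar_swap_left (i j m : ℕ) : cbar i j m = cbar j i m := by
  unfold cbar; congr 1; funext x; ring

theorem cbar_swap_right (i j m : ℕ) : cbar i j m = cbar i m j := by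
  unfold cbar; congr 1; funext x; ring

theorem abs_cbar_le_div (i j m : ℕ) :
    |cbar i j m| ≤ 16 * ((i + 1) * ((j : ℝ) + 1) / (m + 1)) := by
  have hpi := Real.pi_pos
  have hpi4 := Real.pi_le_four
  have hi := gnorm_le i
  have hj := gnorm_le j
  have hm := gnorm_le m
  have hi0 := gnorm_pos i
  have hj0 := gnorm_pos j
  have hm0 := gnorm_pos m
  have hH : (4 * heron (i + 2) (j + 2) (m + 2) : ℝ) ≤ ((i : ℝ) + 2) ^ 2 * (j + 2) ^ 2 := by
    exact_mod_cast four_mul_heron_le (i + 2) (j + 2) (m + 2)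
  have h0 : (0 : ℝ) ≤ i := Nat.cast_nonneg i
  have h1 : (0 : ℝ) ≤ j := Nat.cast_nonneg j
  have hH' : (heron (i + 2) (j + 2) (m + 2) : ℝ) ≤ 4 * (((i : ℝ) + 1) ^ 2 * (j + 1) ^ 2) := by
    have h2 : ((i : ℝ) + 2) ^ 2 ≤ 4 * (i + 1) ^ 2 := by nlinarith
    have h3 : ((j : ℝ) + 2) ^ 2 ≤ 4 * (j + 1) ^ 2 := by nlinarith
    have := mul_le_mul h2 h3 (by positivity) (by positivity)
    linarith
  rw [cbar_eq, abs_of_nonneg (by positivity)]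
  calc gnorm i * gnorm j * gnorm m * (Real.pi / 8 * (heron (i + 2) (j + 2) (m + 2) : ℝ))
      ≤ (2 / (i + 1)) * (2 / (j + 1)) * (2 / (m + 1)) *
        (4 / 8 * (4 * (((i : ℝ) + 1) ^ 2 * (j + 1) ^ 2))) := by gcongr
    _ = 16 * ((i + 1) * ((j : ℝ) + 1) / (m + 1)) := by field_simp; norm_num

/-- By symmetry the larger of `j`, `m` may be put in the denominator of `abs_cbar_le_div`. Any one
index thus controls the coefficient. -/
theorem abs_cbar_le (i j m : ℕ) : |cbar i j m| ≤ 16 * ((i : ℝ) + 1) := by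
  rcases le_total j m with h | h
  · refine (abs_cbar_le_div i j m).trans ?_
    have hjm : (j : ℝ) ≤ m := by exact_mod_cast h
    gcongr
    rw [div_le_iff₀ (by positivity)]
    gcongr
  · rw [cbar_swap_right]
    refine (abs_cbar_le_div i m j).trans ?_
    have hjm : (m : ℝ) ≤ j := by exact_mod_cast h
    gcongr
    rw [div_le_iff₀ (by positivity)]
    gcongr

theorem cbar_eq_zero {i j m : ℕ} (h : j + m < i ∨ i + m < j ∨ i + j < m) :
    cbar i j m = 0 := by
  have : heron (i + 2) (j + 2) (m + 2) = 0 := by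
    by_cases hp : (i + j + m) % 2 = 0
    · exact heron_of_not_triangle (by omega)
    · exact heron_of_odd (p := (i + j + m) / 2 + 3) (by omega)
  simp [cbar_eq, this]

theorem abs_eigenfun_le (n : ℕ) (x : ℝ) : |eigenfun n x| ≤ 16 * ((n : ℝ) + 1) ^ 2 := by
  have hn := gnorm_le n
  have hn0 := gnorm_pos n
  have h0 : (0 : ℝ) ≤ n := Nat.cast_nonneg n
  have hg := abs_gfun_le (n + 2) x
  push_cast at hg
  have hg' : |gfun (n + 2) x| ≤ (2 * ((n : ℝ) + 1)) ^ 3 :=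
    hg.trans (pow_le_pow_left₀ (by positivity) (by linarith) 3)
  rw [eigenfun_eq, abs_mul, abs_of_pos hn0]
  calc gnorm n * |gfun (n + 2) x| ≤ (2 / (n + 1)) * (2 * ((n : ℝ) + 1)) ^ 3 := by gcongr
    _ = 16 * ((n : ℝ) + 1) ^ 2 := by field_simp; norm_num

/-- The linear growth of `two_mul_sin_cube_mul_gfun` is compensated by the normalization factor. -/
theorem abs_sin_pow_three_mul_eigenfun_le (n : ℕ) (x : ℝ) :
    |Real.sin x ^ 3 * eigenfun n x| ≤ 3 := by
  have hn := gnorm_le n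
  have hn0 := gnorm_pos n
  have h0 : (0 : ℝ) ≤ n := Nat.cast_nonneg n
  have h := two_mul_sin_cube_mul_gfun (n + 2) x
  have hb : |2 * Real.sin x ^ 3 * gfun (n + 2) x| ≤ (n : ℝ) + 3 := by
    rw [h]
    push_cast
    refine (abs_sub _ _).trans ?_
    rw [abs_mul, abs_mul, abs_mul, abs_of_nonneg (by positivity : (0 : ℝ) ≤ n + 2)]
    have a1 := Real.abs_sin_le_one (((n : ℝ) + 2) * x)
    have a2 := Real.abs_cos_le_one (((n : ℝ) + 2) * x)
    have a3 := Real.abs_sin_le_one x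
    have a4 := Real.abs_cos_le_one x
    have b1 := mul_le_one₀ a1 (abs_nonneg _) a4
    have b2 := mul_le_one₀ a2 (abs_nonneg _) a3
    have b3 := mul_le_mul_of_nonneg_left b2 (by positivity : (0 : ℝ) ≤ n + 2)
    linarith
  rw [eigenfun_eq]
  have e : Real.sin x ^ 3 * (gnorm n * gfun (n + 2) x) =
      gnorm n / 2 * (2 * Real.sin x ^ 3 * gfun (n + 2) x) := by ring
  rw [e, abs_mul, abs_of_pos (by positivity)]
  calc gnorm n / 2 * |2 * Real.sin x ^ 3 * gfun (n + 2) x|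
      ≤ (2 / (n + 1)) / 2 * (n + 3) := by gcongr
    _ ≤ 3 := by
      rw [div_div, div_mul_eq_mul_div, div_le_iff₀ (by positivity)]
      nlinarith

theorem ccub_swap₁₂ (i j k m : ℕ) : ccub i j k m = ccub j i k m := by
  unfold ccub; congr 1; funext x; ring

theorem ccub_swap₂₃ (i j k m : ℕ) : ccub i j k m = ccub i k j m := by
  unfold ccub; congr 1; funext x; ring

/-- The weight `sin⁶` is spent on the factors `i` and `m`, so neither contributes growth; `i` will
be taken as the largest input index. -/
theorem abs_ccub_le (i j k m : ℕ) :
    |ccub i j k m| ≤ 9216 * (((j : ℝ) + 1) ^ 2 * ((k : ℝ) + 1) ^ 2) := by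
  have hb : ∀ x ∈ Set.uIoc 0 Real.pi,
      ‖eigenfun i x * eigenfun j x * eigenfun k x * eigenfun m x * Real.sin x ^ 6‖ ≤
        2304 * (((j : ℝ) + 1) ^ 2 * ((k : ℝ) + 1) ^ 2) := by
    intro x _
    have e : eigenfun i x * eigenfun j x * eigenfun k x * eigenfun m x * Real.sin x ^ 6 =
      (Real.sin x ^ 3 * eigenfun i x) * (Real.sin x ^ 3 * eigenfun m x) *
        (eigenfun j x * eigenfun k x) := by ring
    rw [e, Real.norm_eq_abs, abs_mul, abs_mul, abs_mul (eigenfun j x)]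
    calc _ ≤ 3 * 3 * ((16 * ((j : ℝ) + 1) ^ 2) * (16 * ((k : ℝ) + 1) ^ 2)) := by
          have h1 := abs_sin_pow_three_mul_eigenfun_le i x
          have h2 := abs_sin_pow_three_mul_eigenfun_le m x
          have h3 := abs_eigenfun_le j x
          have h4 := abs_eigenfun_le k x
          gcongr
      _ = _ := by ring
  have h := intervalIntegral.norm_integral_le_of_norm_le_const hb
  rw [Real.norm_eq_abs, sub_zero, abs_of_pos Real.pi_pos] at h
  refine h.trans ?_
  have hpi := Real.pi_le_four
  calc _ ≤ 2304 * (((j : ℝ) + 1) ^ 2 * ((k : ℝ) + 1) ^ 2) * 4 := by gcongr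
    _ = _ := by ring

/-- Writing `sin⁶ = sin⁴ (1 - cos²)`, the first three factors with `1 - X²` form a polynomial of
degree at most `i + j + k + 2`, orthogonal to the eigenfunction `m`. -/
theorem ccub_eq_zero {i j k m : ℕ} (h : i + j + k + 2 < m) : ccub i j k m = 0 := by
  set p : Polynomial ℝ := gpoly (i + 2) * gpoly (j + 2) * gpoly (k + 2) * (1 - Polynomial.X ^ 2)
    with hp
  have hdeg : p.natDegree < m := by
    have h1 := natDegree_gpoly_le i
    have h2 := natDegree_gpoly_le j
    have h3 := natDegree_gpoly_le k
    have h4 : (1 - Polynomial.X ^ 2 : Polynomial ℝ).natDegree ≤ 2 := by compute_degree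
    have h5 := Polynomial.natDegree_mul_le_of_le
      (Polynomial.natDegree_mul_le_of_le (Polynomial.natDegree_mul_le_of_le h1 h2) h3) h4
    rw [← hp] at h5
    omega
  have h0 := integral_eval_cos_mul_gfun p m hdeg
  have e : ccub i j k m = gnorm i * gnorm j * gnorm k * gnorm m *
      ∫ x in (0 : ℝ)..Real.pi, p.eval (Real.cos x) * (gfun (m + 2) x * Real.sin x ^ 4) := by
    rw [← intervalIntegral.integral_const_mul, ccub]
    congr 1
    funext x
    have hs : Real.sin x ^ 2 = 1 - Real.cos x ^ 2 := by linarith [Real.sin_sq_add_cos_sq x]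
    simp only [eigenfun_eq, hp, Polynomial.eval_mul, Polynomial.eval_sub, Polynomial.eval_one,
      Polynomial.eval_pow, Polynomial.eval_X, gfun]
    rw [← hs]
    ring
  rw [e, h0, mul_zero]

/-- The largest input `x` absorbs the output weight, since `M ≤ 3 x`; the quadratic losses in `y`
and `z` fit into their own weights because `r ≥ 2`. -/
theorem weight_le {r : ℕ} (hr : 2 ≤ r) {x y z M : ℝ} (hx : 1 ≤ x) (hy : 1 ≤ y) (hz : 1 ≤ z)
    (hxy : y ≤ x) (hxz : z ≤ x) (hM0 : 0 ≤ M) (hM : M ≤ x + y + z) :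
    M ^ r * (y ^ 2 * z ^ 2) ≤ 3 ^ r * (x * y * z) ^ r := by
  have h1 : M ^ r ≤ (3 * x) ^ r := pow_le_pow_left₀ hM0 (by linarith) r
  have h2 : y ^ 2 ≤ y ^ r := pow_le_pow_right₀ hy hr
  have h3 : z ^ 2 ≤ z ^ r := pow_le_pow_right₀ hz hr
  calc M ^ r * (y ^ 2 * z ^ 2) ≤ (3 * x) ^ r * (y ^ r * z ^ r) := by gcongr
    _ = _ := by rw [mul_pow, mul_pow, mul_pow]; ring

theorem abs_ccub_mul_weight_le {r : ℕ} (hr : 2 ≤ r) (i j k m : ℕ) :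
    |ccub i j k m| * ((m : ℝ) + 1) ^ r ≤
      9216 * 3 ^ r * (((i : ℝ) + 1) * (j + 1) * (k + 1)) ^ r := by
  by_cases h : i + j + k + 2 < m
  · rw [ccub_eq_zero h]; simp; positivity
  have hM : (m : ℝ) + 1 ≤ (i + 1) + (j + 1) + (k + 1) := by
    have : (m : ℝ) ≤ i + j + k + 2 := by exact_mod_cast (by omega : m ≤ i + j + k + 2)
    linarith
  have hi : (1 : ℝ) ≤ i + 1 := by linarith [(Nat.cast_nonneg i : (0 : ℝ) ≤ i)]
  have hj : (1 : ℝ) ≤ j + 1 := by linarith [(Nat.cast_nonneg j : (0 : ℝ) ≤ j)]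
  have hk : (1 : ℝ) ≤ k + 1 := by linarith [(Nat.cast_nonneg k : (0 : ℝ) ≤ k)]
  have key : ∀ i' j' k' : ℕ, (1 : ℝ) ≤ i' + 1 → (1 : ℝ) ≤ j' + 1 → (1 : ℝ) ≤ k' + 1 →
      (j' : ℝ) ≤ i' → (k' : ℝ) ≤ i' → (m : ℝ) + 1 ≤ (i' + 1) + (j' + 1) + (k' + 1) →
      |ccub i' j' k' m| * ((m : ℝ) + 1) ^ r ≤
        9216 * 3 ^ r * (((i' : ℝ) + 1) * (j' + 1) * (k' + 1)) ^ r := by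
    intro i' j' k' h1 h2 h3 h4 h5 h6
    have hw := weight_le hr h1 h2 h3 (by linarith) (by linarith) (by positivity) h6
    calc _ ≤ 9216 * (((j' : ℝ) + 1) ^ 2 * ((k' : ℝ) + 1) ^ 2) * ((m : ℝ) + 1) ^ r := by
          gcongr; exact abs_ccub_le i' j' k' m
      _ = 9216 * (((m : ℝ) + 1) ^ r * (((j' : ℝ) + 1) ^ 2 * ((k' : ℝ) + 1) ^ 2)) := by ring
      _ ≤ 9216 * (3 ^ r * (((i' : ℝ) + 1) * (j' + 1) * (k' + 1)) ^ r) := by gcongr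
      _ = _ := by ring
  rcases le_total (j : ℝ) i with h1 | h1
  · rcases le_total (k : ℝ) i with h2 | h2
    · exact key i j k hi hj hk h1 h2 hM
    · have := key k i j hk hi hj h2 (h1.trans h2) (by linarith)
      rw [ccub_swap₁₂, ccub_swap₂₃] at this
      convert this using 3; ring
  · rcases le_total (k : ℝ) j with h2 | h2
    · have := key j i k hj hi hk h1 h2 (by linarith)
      rw [ccub_swap₁₂] at this
      convert this using 3; ring
    · have := key k i j hk hi hj (h1.trans h2) h2 (by linarith)
      rw [ccub_swap₁₂, ccub_swap₂₃] at this
      convert this using 3; ring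

theorem sum_abs_cbar_mul_le (κ i j m : ℕ) :
    ∑ ν ∈ range (i + j + 1), |cbar κ ν m| * |cbar i j ν| ≤
      512 * (min ((i : ℝ) + 1) (j + 1)) ^ 2 * min ((κ : ℝ) + 1) (i + j + 1) := by
  set n1 := min ((i : ℝ) + 1) (j + 1) with hn1
  have hn0 : 0 ≤ n1 := by rw [hn1]; positivity
  -- With truncated subtraction the lower end is `|i - j|`. The triangle rule leaves at most twice
  -- the smaller of `i + 1`, `j + 1` values of ν.
  have hsub : Finset.Icc ((i - j) + (j - i)) (i + j) ⊆ range (i + j + 1) := by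
    intro ν hν
    have := Finset.mem_Icc.1 hν
    exact Finset.mem_range.2 (by omega)
  rw [← Finset.sum_subset hsub]
  · have hb : ∀ ν ∈ Finset.Icc ((i - j) + (j - i)) (i + j), |cbar κ ν m| * |cbar i j ν| ≤
        (16 * min ((κ : ℝ) + 1) (i + j + 1)) * (16 * n1) := by
      intro ν hν
      have hν' : (ν : ℝ) ≤ i + j := by exact_mod_cast (Finset.mem_Icc.1 hν).2
      have h1 := abs_cbar_le κ ν m
      have h2 := abs_cbar_le ν κ m
      rw [cbar_swap_left] at h2
      have h3 := abs_cbar_le i j ν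
      have h4 := abs_cbar_le j i ν
      rw [cbar_swap_left] at h4
      have h5 : |cbar κ ν m| ≤ 16 * min ((κ : ℝ) + 1) (i + j + 1) := by
        rw [mul_min_of_nonneg _ _ (by norm_num)]
        exact le_min h1 (by linarith)
      have h6 : |cbar i j ν| ≤ 16 * n1 := by
        rw [hn1, mul_min_of_nonneg _ _ (by norm_num)]
        exact le_min h3 h4
      exact mul_le_mul h5 h6 (abs_nonneg _) (by positivity)
    refine (Finset.sum_le_card_nsmul _ _ _ hb).trans ?_
    have hcard : ((Finset.Icc ((i - j) + (j - i)) (i + j)).card : ℝ) ≤ 2 * n1 := by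
      rw [Nat.card_Icc, hn1, mul_min_of_nonneg _ _ (by norm_num)]
      apply le_min
      · have : i + j + 1 - (i - j + (j - i)) ≤ 2 * (i + 1) := by omega
        exact_mod_cast this
      · have : i + j + 1 - (i - j + (j - i)) ≤ 2 * (j + 1) := by omega
        exact_mod_cast this
    rw [nsmul_eq_mul]
    calc _ ≤ 2 * n1 * (16 * min ((κ : ℝ) + 1) (i + j + 1) * (16 * n1)) := by gcongr
      _ = _ := by ring
  · intro ν hν hν'
    have h1 := Finset.mem_range.1 hν
    have h2 : cbar i j ν = 0 := by
      apply cbar_eq_zero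
      by_contra hc
      apply hν'
      rw [Finset.mem_Icc]
      omega
    simp [h2]

theorem sum_abs_cbar_mul_weight_le {r : ℕ} (hr : 2 ≤ r) (κ i j m : ℕ) :
    (∑ ν ∈ range (i + j + 1), |cbar κ ν m| * |cbar i j ν|) * ((m : ℝ) + 1) ^ r ≤
      1024 * 3 ^ r * (((κ : ℝ) + 1) * (i + 1) * (j + 1)) ^ r := by
  by_cases h : κ + i + j < m
  · rw [Finset.sum_eq_zero]
    · simp; positivity
    · intro ν hν
      have := Finset.mem_range.1 hν
      rw [cbar_eq_zero (i := κ) (j := ν) (m := m) (by omega)]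
      simp
  have hκ0 : (0 : ℝ) ≤ κ := Nat.cast_nonneg κ
  have hi0 : (0 : ℝ) ≤ i := Nat.cast_nonneg i
  have hj0 : (0 : ℝ) ≤ j := Nat.cast_nonneg j
  have hM : (m : ℝ) + 1 ≤ (κ + 1) + (i + 1) + (j + 1) := by
    have : (m : ℝ) ≤ κ + i + j := by exact_mod_cast (by omega : m ≤ κ + i + j)
    linarith
  refine (mul_le_mul_of_nonneg_right (sum_abs_cbar_mul_le κ i j m) (by positivity)).trans ?_
  set x := (κ : ℝ) + 1 with hx
  set y := (i : ℝ) + 1 with hy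
  set z := (j : ℝ) + 1 with hz
  set M := (m : ℝ) + 1
  have hM0 : 0 ≤ M := by positivity
  have hx1 : 1 ≤ x := by linarith
  have hy1 : 1 ≤ y := by linarith
  have hz1 : 1 ≤ z := by linarith
  have hpos : 0 ≤ (x * y * z) ^ r := by positivity
  have hpos3 : (0 : ℝ) ≤ 3 ^ r * (x * y * z) ^ r := by positivity
  have hs : (i : ℝ) + j + 1 ≤ 2 * (y * z) := by nlinarith
  -- One bound for each choice of the largest index, which must not appear in it, so that
  -- `weight_le` applies.
  have key : (min y z) ^ 2 * min x ((i : ℝ) + j + 1) ≤ 2 * (y ^ 2 * z ^ 2) ∧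
      (min y z) ^ 2 * min x ((i : ℝ) + j + 1) ≤ x ^ 2 * z ^ 2 ∧
      (min y z) ^ 2 * min x ((i : ℝ) + j + 1) ≤ x ^ 2 * y ^ 2 := by
    have hm0 : 0 ≤ min y z := by positivity
    have hq0 : 0 ≤ min x ((i : ℝ) + j + 1) := by positivity
    have hmy : min y z ≤ y := min_le_left _ _
    have hmz : min y z ≤ z := min_le_right _ _
    have hqx : min x ((i : ℝ) + j + 1) ≤ x := min_le_left _ _
    have hqs : min x ((i : ℝ) + j + 1) ≤ 2 * (y * z) := (min_le_right _ _).trans hs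
    have hxx : x ≤ x ^ 2 := by nlinarith
    refine ⟨?_, ?_, ?_⟩
    · calc (min y z) ^ 2 * min x ((i : ℝ) + j + 1) ≤ (y * z) * (2 * (y * z)) := by
            rw [pow_two]; gcongr
        _ = _ := by ring
    · calc (min y z) ^ 2 * min x ((i : ℝ) + j + 1) ≤ z ^ 2 * x ^ 2 := by
            gcongr; exact hqx.trans hxx
        _ = _ := by ring
    · calc (min y z) ^ 2 * min x ((i : ℝ) + j + 1) ≤ y ^ 2 * x ^ 2 := by
            gcongr; exact hqx.trans hxx
        _ = _ := by ring
  obtain ⟨k1, k2, k3⟩ := key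
  have hMr : 0 ≤ M ^ r := by positivity
  have fin : ∀ S : ℝ, (min y z) ^ 2 * min x ((i : ℝ) + j + 1) ≤ 2 * S →
      M ^ r * S ≤ 3 ^ r * (x * y * z) ^ r →
      512 * (min y z) ^ 2 * min x ((i : ℝ) + j + 1) * M ^ r ≤
        1024 * 3 ^ r * (x * y * z) ^ r := by
    intro S h1 h2
    calc 512 * (min y z) ^ 2 * min x ((i : ℝ) + j + 1) * M ^ r =
        512 * (((min y z) ^ 2 * min x ((i : ℝ) + j + 1)) * M ^ r) := by ring
      _ ≤ 512 * ((2 * S) * M ^ r) := by gcongr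
      _ = 1024 * (M ^ r * S) := by ring
      _ ≤ 1024 * (3 ^ r * (x * y * z) ^ r) := by gcongr
      _ = _ := by ring
  rcases le_total y x with h1 | h1
  · rcases le_total z x with h2 | h2
    · exact fin _ k1 (weight_le hr hx1 hy1 hz1 h1 h2 hM0 hM)
    · refine fin (x ^ 2 * y ^ 2) (by nlinarith [sq_nonneg (x * y)]) ?_
      have := weight_le hr hz1 hx1 hy1 h2 (h1.trans h2) hM0 (by linarith)
      rwa [show z * x * y = x * y * z by ring] at this
  · rcases le_total z y with h2 | h2
    · refine fin (x ^ 2 * z ^ 2) (by nlinarith [sq_nonneg (x * z)]) ?_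
      have := weight_le hr hy1 hx1 hz1 h1 h2 hM0 (by linarith)
      rwa [show y * x * z = x * y * z by ring] at this
    · refine fin (x ^ 2 * y ^ 2) (by nlinarith [sq_nonneg (x * y)]) ?_
      have := weight_le hr hz1 hx1 hy1 (h1.trans h2) h2 hM0 (by linarith)
      rwa [show z * x * y = x * y * z by ring] at this

/-! ### Weighted spaces and bounded trilinear maps -/

theorem WeightedSeq.add_coe {s : ℕ} (u v : WeightedSeq s) (j : ℕ) : (u + v) j = u j + v j := rfl

theorem WeightedSeq.smul_coe {s : ℕ} (c : ℝ) (u : WeightedSeq s) (j : ℕ) :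
    (c • u) j = c * u j := rfl

theorem WeightedSeq.zero_coe {s : ℕ} (j : ℕ) : (0 : WeightedSeq s) j = 0 := rfl

theorem WeightedSeq.ext {s : ℕ} {u v : WeightedSeq s} (h : ∀ j, u j = v j) : u = v :=
  Subtype.ext (funext h)

theorem mem_weightedSubmodule_iff {s : ℕ} {u : ℕ → ℝ} :
    u ∈ weightedSubmodule s ↔ Summable fun j : ℕ => (((j : ℝ) + 1) ^ s * u j) ^ 2 := by
  change Memℓp (fun j : ℕ => ((j : ℝ) + 1) ^ s * u j) 2 ↔ _
  rw [memℓp_gen_iff (by norm_num)]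
  refine summable_congr fun j => ?_
  have h2 : (2 : ENNReal).toReal = ((2 : ℕ) : ℝ) := by norm_num
  rw [h2, Real.rpow_natCast, Real.norm_eq_abs, sq_abs]

theorem WeightedSeq.norm_sq {s : ℕ} (u : WeightedSeq s) :
    ‖u‖ ^ 2 = ∑' j : ℕ, (((j : ℝ) + 1) ^ s * u j) ^ 2 := by
  have h := lp.norm_rpow_eq_tsum (p := 2) (by norm_num) (toEll2 s u)
  have e : ‖u‖ = ‖toEll2 s u‖ := rfl
  rw [e]
  have h2 : (2 : ENNReal).toReal = ((2 : ℕ) : ℝ) := by norm_num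
  rw [h2, Real.rpow_natCast] at h
  rw [h]
  refine tsum_congr fun j => ?_
  rw [Real.rpow_natCast, Real.norm_eq_abs, sq_abs]
  rfl

theorem WeightedSeq.summable_sq {s : ℕ} (u : WeightedSeq s) :
    Summable fun j : ℕ => (((j : ℝ) + 1) ^ s * u j) ^ 2 :=
  mem_weightedSubmodule_iff.1 u.2

theorem summable_inv_sq_nat_add_one : Summable fun j : ℕ => (1 / ((j : ℝ) + 1)) ^ 2 := by
  have h := (summable_nat_add_iff 1).2 (Real.summable_one_div_nat_pow.2 (one_lt_two))
  refine h.congr fun j => ?_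
  push_cast
  rw [div_pow, one_pow]

/-- The `ℓ²` norm of `(1 / (j + 1))_j`. -/
def ell2Const : ℝ := Real.sqrt (∑' j : ℕ, (1 / ((j : ℝ) + 1)) ^ 2)

theorem ell2Const_nonneg : 0 ≤ ell2Const := Real.sqrt_nonneg _

theorem ell2Const_sq : ell2Const ^ 2 = ∑' j : ℕ, (1 / ((j : ℝ) + 1)) ^ 2 :=
  Real.sq_sqrt (tsum_nonneg fun _ => by positivity)

/-- Cauchy–Schwarz against `1/(i + 1)`: one power of the weight is paid to pass from ℓ² to ℓ¹. -/
theorem WeightedSeq.summable_and_tsum_le {r : ℕ} (u : WeightedSeq (r + 1)) :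
    (Summable fun i : ℕ => ((i : ℝ) + 1) ^ r * |u i|) ∧
      ∑' i : ℕ, ((i : ℝ) + 1) ^ r * |u i| ≤ ell2Const * ‖u‖ := by
  have e : ∀ i : ℕ, ((i : ℝ) + 1) ^ r * |u i| =
      1 / ((i : ℝ) + 1) * (((i : ℝ) + 1) ^ (r + 1) * |u i|) := by
    intro i; field_simp; ring
  have h2 : (2 : ℝ) = ((2 : ℕ) : ℝ) := by norm_num
  have hu : (fun i : ℕ => (((i : ℝ) + 1) ^ (r + 1) * |u i|) ^ (2 : ℝ)) =
      fun i : ℕ => (((i : ℝ) + 1) ^ (r + 1) * u i) ^ 2 := by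
    funext i
    rw [h2, Real.rpow_natCast, mul_pow, sq_abs, mul_pow]
  have hv : (fun i : ℕ => (1 / ((i : ℝ) + 1)) ^ (2 : ℝ)) =
      fun i : ℕ => (1 / ((i : ℝ) + 1)) ^ 2 := by
    funext i
    rw [h2, Real.rpow_natCast]
  have h := Real.summable_and_inner_le_Lp_mul_Lq_tsum_of_nonneg
    (f := fun i : ℕ => 1 / ((i : ℝ) + 1)) (g := fun i : ℕ => ((i : ℝ) + 1) ^ (r + 1) * |u i|)
    Real.HolderConjugate.two_two (fun i => by positivity) (fun i => by positivity)
    (by rw [hv]; exact summable_inv_sq_nat_add_one) (by rw [hu]; exact u.summable_sq)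
  rw [hu, hv, ← u.norm_sq, ← ell2Const_sq, ← Real.sqrt_eq_rpow, ← Real.sqrt_eq_rpow,
    Real.sqrt_sq ell2Const_nonneg, Real.sqrt_sq (norm_nonneg u)] at h
  simp only [e]
  exact h

/-- One further power is paid to pass from the weighted maximum norm back to ℓ². -/
theorem mem_weightedSubmodule_of_le {t : ℕ} {f : ℕ → ℝ} {B : ℝ}
    (h : ∀ m : ℕ, |f m| * ((m : ℝ) + 1) ^ (t + 1) ≤ B) : f ∈ weightedSubmodule t := by
  rw [mem_weightedSubmodule_iff]
  refine Summable.of_nonneg_of_le (fun _ => by positivity) (fun m => ?_)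
    (summable_inv_sq_nat_add_one.mul_left (B ^ 2))
  rw [← mul_pow, ← sq_abs]
  refine pow_le_pow_left₀ (abs_nonneg _) ?_ 2
  have hm := h m
  rw [abs_mul, abs_of_nonneg (by positivity), mul_one_div, le_div_iff₀ (by positivity)]
  calc _ = |f m| * ((m : ℝ) + 1) ^ (t + 1) := by ring
    _ ≤ B := hm

theorem WeightedSeq.norm_le_of_le {t : ℕ} {u : WeightedSeq t} {B : ℝ} (hB : 0 ≤ B)
    (h : ∀ m : ℕ, |u m| * ((m : ℝ) + 1) ^ (t + 1) ≤ B) : ‖u‖ ≤ B * ell2Const := by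
  refine (sq_le_sq₀ (norm_nonneg _) (mul_nonneg hB ell2Const_nonneg)).1 ?_
  rw [u.norm_sq, mul_pow, ell2Const_sq, ← tsum_mul_left]
  refine u.summable_sq.tsum_le_tsum (fun m => ?_) (summable_inv_sq_nat_add_one.mul_left (B ^ 2))
  rw [← mul_pow, ← sq_abs]
  refine pow_le_pow_left₀ (abs_nonneg _) ?_ 2
  have hm := h m
  rw [abs_mul, abs_of_nonneg (by positivity), mul_one_div, le_div_iff₀ (by positivity)]
  calc _ = |u m| * ((m : ℝ) + 1) ^ (t + 1) := by ring
    _ ≤ B := hm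

/-- Coefficients of a trilinear map which gains one power in the maximum norm. -/
def TriBound (a : ℕ × ℕ × ℕ → ℕ → ℝ) (C : ℝ) (r : ℕ) : Prop :=
  ∀ (p : ℕ × ℕ × ℕ) (m : ℕ), |a p m| * ((m : ℝ) + 1) ^ r ≤
    C * (((p.1 : ℝ) + 1) * ((p.2.1 : ℝ) + 1) * ((p.2.2 : ℝ) + 1)) ^ r

theorem TriBound.add {a b : ℕ × ℕ × ℕ → ℕ → ℝ} {C D : ℝ} {r : ℕ} (ha : TriBound a C r)
    (hb : TriBound b D r) : TriBound (fun p m => a p m + b p m) (C + D) r := by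
  intro p m
  have h1 := ha p m
  have h2 := hb p m
  calc _ ≤ (|a p m| + |b p m|) * ((m : ℝ) + 1) ^ r := by gcongr; exact abs_add_le _ _
    _ ≤ _ := by linarith

theorem TriBound.nonneg {a : ℕ × ℕ × ℕ → ℕ → ℝ} {C : ℝ} {r : ℕ} (h : TriBound a C r) :
    0 ≤ C := by
  have := h (0, 0, 0) 0
  simp at this
  exact (abs_nonneg _).trans this

/-- The series of absolute values converges, with a weighted bound by the product of the norms. -/
theorem TriBound.summable_and_abs_le {a : ℕ × ℕ × ℕ → ℕ → ℝ} {C : ℝ} {r : ℕ}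
    (h : TriBound a C r) (u v w : WeightedSeq (r + 1)) (m : ℕ) :
    (Summable fun p : ℕ × ℕ × ℕ => |a p m * (u p.1 * v p.2.1 * w p.2.2)|) ∧
      (∑' p : ℕ × ℕ × ℕ, |a p m * (u p.1 * v p.2.1 * w p.2.2)|) * ((m : ℝ) + 1) ^ r ≤
        C * ell2Const ^ 3 * (‖u‖ * ‖v‖ * ‖w‖) := by
  obtain ⟨hu, hu'⟩ := u.summable_and_tsum_le
  obtain ⟨hv, hv'⟩ := v.summable_and_tsum_le
  obtain ⟨hw, hw'⟩ := w.summable_and_tsum_le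
  have hC := h.nonneg
  have hvw := hv.mul_of_nonneg hw (fun i => by positivity) (fun i => by positivity)
  have huvw := hu.mul_of_nonneg hvw (fun i => by positivity) (fun i => by positivity)
  have hM : (1 : ℝ) ≤ ((m : ℝ) + 1) ^ r :=
    one_le_pow₀ (by linarith [(Nat.cast_nonneg m : (0 : ℝ) ≤ m)])
  have key : ∀ p : ℕ × ℕ × ℕ, |a p m * (u p.1 * v p.2.1 * w p.2.2)| * ((m : ℝ) + 1) ^ r ≤
      C * ((((p.1 : ℝ) + 1) ^ r * |u p.1|) * ((((p.2.1 : ℝ) + 1) ^ r * |v p.2.1|) *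
        (((p.2.2 : ℝ) + 1) ^ r * |w p.2.2|))) := by
    intro p
    rw [abs_mul, abs_mul, abs_mul]
    calc _ = (|a p m| * ((m : ℝ) + 1) ^ r) * (|u p.1| * |v p.2.1| * |w p.2.2|) := by ring
      _ ≤ (C * (((p.1 : ℝ) + 1) * ((p.2.1 : ℝ) + 1) * ((p.2.2 : ℝ) + 1)) ^ r) *
          (|u p.1| * |v p.2.1| * |w p.2.2|) :=
          mul_le_mul_of_nonneg_right (h p m) (by positivity)
      _ = _ := by rw [mul_pow, mul_pow]; ring
  have hs : Summable fun p : ℕ × ℕ × ℕ => |a p m * (u p.1 * v p.2.1 * w p.2.2)| := by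
    refine Summable.of_nonneg_of_le (fun _ => abs_nonneg _) (fun p => ?_) (huvw.mul_left C)
    exact (le_mul_of_one_le_right (abs_nonneg _) hM).trans (key p)
  refine ⟨hs, ?_⟩
  rw [← tsum_mul_right]
  have h1 := (hs.mul_right (((m : ℝ) + 1) ^ r)).tsum_le_tsum key (huvw.mul_left C)
  refine h1.trans ?_
  rw [tsum_mul_left, ← hu.tsum_mul_tsum hvw huvw, ← hv.tsum_mul_tsum hw hvw]
  have t1 : 0 ≤ ∑' i : ℕ, ((i : ℝ) + 1) ^ r * |u i| := tsum_nonneg fun i => by positivity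
  have t2 : 0 ≤ ∑' i : ℕ, ((i : ℝ) + 1) ^ r * |v i| := tsum_nonneg fun i => by positivity
  have t3 : 0 ≤ ∑' i : ℕ, ((i : ℝ) + 1) ^ r * |w i| := tsum_nonneg fun i => by positivity
  have e0 := ell2Const_nonneg
  calc _ ≤ C * ((ell2Const * ‖u‖) * ((ell2Const * ‖v‖) * (ell2Const * ‖w‖))) := by gcongr
    _ = _ := by ring

/-- The sequence of values of a trilinear map. -/
def triValue (a : ℕ × ℕ × ℕ → ℕ → ℝ) (u v w : ℕ → ℝ) (m : ℕ) : ℝ :=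
  ∑' p : ℕ × ℕ × ℕ, a p m * (u p.1 * v p.2.1 * w p.2.2)

theorem TriBound.abs_triValue_le {a : ℕ × ℕ × ℕ → ℕ → ℝ} {C : ℝ} {r : ℕ}
    (h : TriBound a C r) (u v w : WeightedSeq (r + 1)) (m : ℕ) :
    |triValue a u v w m| * ((m : ℝ) + 1) ^ r ≤ C * ell2Const ^ 3 * (‖u‖ * ‖v‖ * ‖w‖) := by
  obtain ⟨h1, h2⟩ := h.summable_and_abs_le u v w m
  refine le_trans ?_ h2
  gcongr
  have h1' : Summable fun p : ℕ × ℕ × ℕ => ‖a p m * (u p.1 * v p.2.1 * w p.2.2)‖ := h1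
  exact norm_tsum_le_tsum_norm h1'

theorem TriBound.summable {a : ℕ × ℕ × ℕ → ℕ → ℝ} {C : ℝ} {r : ℕ}
    (h : TriBound a C r) (u v w : WeightedSeq (r + 1)) (m : ℕ) :
    Summable fun p : ℕ × ℕ × ℕ => a p m * (u p.1 * v p.2.1 * w p.2.2) :=
  (h.summable_and_abs_le u v w m).1.of_abs

/-- The bounded trilinear map with given coefficients. -/
def triMap {a : ℕ × ℕ × ℕ → ℕ → ℝ} {C : ℝ} {t : ℕ} (h : TriBound a C (t + 1)) :
    ContinuousMultilinearMap ℝ (fun _ : Fin 3 => WeightedSeq (t + 2)) (WeightedSeq t) :=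
  MultilinearMap.mkContinuous
    { toFun := fun u => ⟨triValue a (u 0) (u 1) (u 2),
        mem_weightedSubmodule_of_le (h.abs_triValue_le (u 0) (u 1) (u 2))⟩
      map_update_add' := by
        intro inst u i x y
        obtain rfl : inst = instDecidableEqFin 3 := Subsingleton.elim _ _
        apply WeightedSeq.ext
        intro m
        have hs := fun u v w => h.summable u v w m
        change triValue _ _ _ _ _ = triValue _ _ _ _ _ + triValue _ _ _ _ _
        unfold triValue
        rw [← (hs _ _ _).tsum_add (hs _ _ _)]
        refine tsum_congr fun p => ?_
        fin_cases i <;> simp [WeightedSeq.add_coe] <;> ring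
      map_update_smul' := by
        intro inst u i c x
        obtain rfl : inst = instDecidableEqFin 3 := Subsingleton.elim _ _
        apply WeightedSeq.ext
        intro m
        change triValue _ _ _ _ _ = c * triValue _ _ _ _ _
        unfold triValue
        rw [← tsum_mul_left]
        refine tsum_congr fun p => ?_
        fin_cases i <;> simp [WeightedSeq.smul_coe] <;> ring }
    (C * ell2Const ^ 3 * ell2Const)
    (by
      intro u
      have hC := h.nonneg
      have he := ell2Const_nonneg
      have := WeightedSeq.norm_le_of_le
        (u := ⟨triValue a (u 0) (u 1) (u 2),
          mem_weightedSubmodule_of_le (h.abs_triValue_le (u 0) (u 1) (u 2))⟩)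
        (by positivity) (h.abs_triValue_le (u 0) (u 1) (u 2))
      refine this.trans (le_of_eq ?_)
      rw [Fin.prod_univ_three]
      ring)

theorem triMap_apply {a : ℕ × ℕ × ℕ → ℕ → ℝ} {C : ℝ} {t : ℕ} (h : TriBound a C (t + 1))
    (u : Fin 3 → WeightedSeq (t + 2)) (m : ℕ) :
    triMap h u m = triValue a (u 0) (u 1) (u 2) m := rfl

/-- Chain rule through the bounded linear diagonal embedding `u ↦ (u, u, u)`. -/
theorem hasFDerivAt_triMap_diag {a : ℕ × ℕ × ℕ → ℕ → ℝ} {C : ℝ} {t : ℕ}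
    (h : TriBound a C (t + 1)) (x : WeightedSeq (t + 2)) :
    HasFDerivAt (fun u : WeightedSeq (t + 2) => triMap h fun _ => u)
      (((triMap h).linearDeriv fun _ => x).comp
        (ContinuousLinearMap.pi fun _ => ContinuousLinearMap.id ℝ _)) x := by
  have h1 := (triMap h).hasFDerivAt (x := fun _ => x)
  have h2 : HasFDerivAt (fun u : WeightedSeq (t + 2) => (fun _ : Fin 3 => u))
      (ContinuousLinearMap.pi fun _ => ContinuousLinearMap.id ℝ _) x :=
    (ContinuousLinearMap.pi fun _ : Fin 3 => ContinuousLinearMap.id ℝ (WeightedSeq (t + 2))).hasFDerivAt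
  exact h1.comp x h2

theorem triMap_linearDeriv_apply {a : ℕ × ℕ × ℕ → ℕ → ℝ} {C : ℝ} {t : ℕ}
    (h : TriBound a C (t + 1)) (x y : WeightedSeq (t + 2)) (m : ℕ) :
    (((triMap h).linearDeriv fun _ => x).comp
        (ContinuousLinearMap.pi fun _ => ContinuousLinearMap.id ℝ _)) y m =
      triValue a y x x m + triValue a x y x m + triValue a x x y m := by
  rw [ContinuousLinearMap.comp_apply, ContinuousMultilinearMap.linearDeriv_apply,
    Fin.sum_univ_three, WeightedSeq.add_coe, WeightedSeq.add_coe, triMap_apply, triMap_apply,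
    triMap_apply]
  simp

theorem freq_sq_mul_le {s : ℕ} (u : WeightedSeq (s + 2)) (j : ℕ) :
    (((j : ℝ) + 1) ^ s * ((freq j : ℝ) ^ 2 * u j)) ^ 2 ≤
      4 ^ 2 * (((j : ℝ) + 1) ^ (s + 2) * u j) ^ 2 := by
  have h0 : (0 : ℝ) ≤ j := Nat.cast_nonneg j
  have h : (freq j : ℝ) ^ 2 ≤ 4 * ((j : ℝ) + 1) ^ 2 := by rw [freq_cast]; nlinarith
  have e1 : (((j : ℝ) + 1) ^ s * ((freq j : ℝ) ^ 2 * u j)) ^ 2 =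
      ((freq j : ℝ) ^ 2) ^ 2 * (((j : ℝ) + 1) ^ s * u j) ^ 2 := by ring
  have e2 : 4 ^ 2 * (((j : ℝ) + 1) ^ (s + 2) * u j) ^ 2 =
      (4 * ((j : ℝ) + 1) ^ 2) ^ 2 * (((j : ℝ) + 1) ^ s * u j) ^ 2 := by ring
  rw [e1, e2]
  gcongr

/-- Multiplication with the squares of the frequencies. -/
def freqSqMap (s : ℕ) : WeightedSeq (s + 2) →L[ℝ] WeightedSeq s :=
  LinearMap.mkContinuous
    { toFun := fun u => ⟨fun j => (freq j : ℝ) ^ 2 * u j, mem_weightedSubmodule_iff.2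
        (Summable.of_nonneg_of_le (fun _ => by positivity) (freq_sq_mul_le u)
          (u.summable_sq.mul_left _))⟩
      map_add' := fun u v => WeightedSeq.ext fun j => mul_add _ _ _
      map_smul' := fun c u => WeightedSeq.ext fun j => mul_left_comm _ _ _ } 4
    (by
      intro u
      refine (sq_le_sq₀ (norm_nonneg _) (by positivity)).1 ?_
      rw [WeightedSeq.norm_sq, mul_pow, WeightedSeq.norm_sq, ← tsum_mul_left]
      exact (WeightedSeq.summable_sq _).tsum_le_tsum (freq_sq_mul_le u)
        (u.summable_sq.mul_left _))

/-! ### The nonlinearity as a trilinear series -/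

/-- The time average of a product of four oscillations. -/
def avgCos (p : ℕ × ℕ × ℕ) (m : ℕ) : ℝ :=
  1 / (2 * Real.pi) * ∫ t in (0 : ℝ)..(2 * Real.pi),
    Real.cos (freq p.1 * t) * Real.cos (freq p.2.1 * t) * Real.cos (freq p.2.2 * t) *
      Real.cos (freq m * t)

theorem abs_mul_cos_le {a b : ℝ} (h : |a| ≤ 1) : |a * Real.cos b| ≤ 1 := by
  rw [abs_mul]
  exact mul_le_one₀ h (abs_nonneg _) (Real.abs_cos_le_one _)

theorem abs_avgCos_le (p : ℕ × ℕ × ℕ) (m : ℕ) : |avgCos p m| ≤ 1 := by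
  have h := intervalIntegral.norm_integral_le_of_norm_le_const (a := 0) (b := 2 * Real.pi)
    (C := 1) (f := fun t : ℝ => Real.cos (freq p.1 * t) * Real.cos (freq p.2.1 * t) *
      Real.cos (freq p.2.2 * t) * Real.cos (freq m * t))
    (fun t _ => abs_mul_cos_le (abs_mul_cos_le (abs_mul_cos_le (Real.abs_cos_le_one _))))
  have hpi := Real.pi_pos
  rw [sub_zero, abs_of_pos (by positivity), one_mul, Real.norm_eq_abs] at h
  rw [avgCos, abs_mul, abs_of_pos (by positivity)]
  calc _ ≤ 1 / (2 * Real.pi) * (2 * Real.pi) := by gcongr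
    _ = 1 := by field_simp

/-- The coefficients of the averaged cubic nonlinearity. -/
def cubicCoeff (p : ℕ × ℕ × ℕ) (m : ℕ) : ℝ := -(ccub p.1 p.2.1 p.2.2 m * avgCos p m)

theorem ccub_triBound {r : ℕ} (hr : 2 ≤ r) :
    TriBound (fun p m => ccub p.1 p.2.1 p.2.2 m) (9216 * 3 ^ r) r :=
  fun p m => abs_ccub_mul_weight_le hr p.1 p.2.1 p.2.2 m

theorem cubicCoeff_triBound {r : ℕ} (hr : 2 ≤ r) : TriBound cubicCoeff (9216 * 3 ^ r) r := by
  intro p m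
  refine le_trans ?_ (ccub_triBound hr p m)
  refine mul_le_mul_of_nonneg_right ?_ (by positivity)
  rw [cubicCoeff, abs_neg, abs_mul]
  exact mul_le_of_le_one_right (abs_nonneg _) (abs_avgCos_le p m)

/-- Dominated convergence interchanges the series and the time average; the majorant is the
absolutely convergent series without the cosines. -/
theorem avgF3_eq {r : ℕ} (hr : 2 ≤ r) (u : WeightedSeq (r + 1)) (m : ℕ) :
    avgF3 u m = triValue cubicCoeff u u u m := by
  obtain ⟨hs, -⟩ := (ccub_triBound hr).summable_and_abs_le u u u m
  set F : ℕ × ℕ × ℕ → ℝ → ℝ := fun p t =>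
    -(ccub p.1 p.2.1 p.2.2 m * (u p.1 * Real.cos (freq p.1 * t)) *
      (u p.2.1 * Real.cos (freq p.2.1 * t)) * (u p.2.2 * Real.cos (freq p.2.2 * t))) *
      Real.cos (freq m * t) with hF
  have hFeq : ∀ p t, F p t = -(ccub p.1 p.2.1 p.2.2 m * (u p.1 * u p.2.1 * u p.2.2)) *
      (Real.cos (freq p.1 * t) * Real.cos (freq p.2.1 * t) * Real.cos (freq p.2.2 * t) *
      Real.cos (freq m * t)) := by
    intro p t; simp only [hF]; ring
  have hFb : ∀ p t, ‖F p t‖ ≤ |ccub p.1 p.2.1 p.2.2 m * (u p.1 * u p.2.1 * u p.2.2)| := by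
    intro p t
    rw [hFeq, Real.norm_eq_abs, abs_mul, abs_neg]
    exact mul_le_of_le_one_right (abs_nonneg _)
      (abs_mul_cos_le (abs_mul_cos_le (abs_mul_cos_le (Real.abs_cos_le_one _))))
  have hlim : ∀ t, HasSum (fun p => F p t) (flow t (f3 (flow t u)) m) := by
    intro t
    have h1 : Summable fun p => F p t := Summable.of_norm_bounded hs (fun p => hFb p t)
    have h2 : flow t (f3 (flow t u)) m = ∑' p, F p t := by
      simp only [flow, f3, hF]
      rw [tsum_mul_right, tsum_neg]
    rw [h2]
    exact h1.hasSum
  have h := intervalIntegral.hasSum_integral_of_dominated_convergence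
    (μ := MeasureTheory.volume) (a := 0) (b := 2 * Real.pi)
    (F := F) (f := fun t => flow t (f3 (flow t u)) m)
    (fun p _ => |ccub p.1 p.2.1 p.2.2 m * (u p.1 * u p.2.1 * u p.2.2)|)
    (fun p => by
      apply Continuous.aestronglyMeasurable
      simp only [hF]
      fun_prop)
    (fun p => Filter.Eventually.of_forall fun t _ => hFb p t)
    (Filter.Eventually.of_forall fun t _ => hs)
    (intervalIntegrable_const)
    (Filter.Eventually.of_forall fun t _ => hlim t)
  rw [avgF3, ← h.tsum_eq, ← tsum_mul_left, triValue]
  refine tsum_congr fun p => ?_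
  simp only [hFeq]
  rw [intervalIntegral.integral_const_mul, cubicCoeff, avgCos]
  ring

/-- The coefficients of the terms of the backreaction. -/
def backTerm (κ ν i j : ℕ) (d : ℤ) (m : ℕ) : ℝ :=
  if d ≠ freq ν ∧ d ≠ -freq ν then
    cbar κ ν m * (cbar i j ν / ((freq ν : ℝ) ^ 2 - (d : ℝ) ^ 2)) * signCount d (freq κ) (freq m)
  else 0

theorem backreactionTerm_eq (ξ : ℕ → ℝ) (m κ ν i j : ℕ) (d : ℤ) :
    backreactionTerm ξ m κ ν i j d = backTerm κ ν i j d m * (ξ κ * ξ i * ξ j) := by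
  unfold backreactionTerm backTerm
  split_ifs <;> ring

theorem abs_signCount_le (a b c : ℤ) : |signCount a b c| ≤ 4 := by
  unfold signCount
  split_ifs <;> norm_num

/-- A denominator that does not vanish is a non-zero integer, hence at least 1 in absolute value:
there are no small divisors. -/
theorem abs_backTerm_le (κ ν i j : ℕ) (d : ℤ) (m : ℕ) :
    |backTerm κ ν i j d m| ≤ 4 * (|cbar κ ν m| * |cbar i j ν|) := by
  unfold backTerm
  split_ifs with h
  · have h1 : (1 : ℝ) ≤ |(freq ν : ℝ) ^ 2 - (d : ℝ) ^ 2| := by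
      have h2 : freq ν ^ 2 - d ^ 2 ≠ 0 := by
        intro h0
        have : (d - freq ν) * (d + freq ν) = 0 := by linarith
        rcases mul_eq_zero.1 this with h3 | h3
        · exact h.1 (by linarith)
        · exact h.2 (by linarith)
      exact_mod_cast Int.one_le_abs h2
    have h3 := abs_signCount_le d (freq κ) (freq m)
    rw [abs_mul, abs_mul, abs_div]
    calc _ ≤ |cbar κ ν m| * |cbar i j ν| * 4 := by
          gcongr
          exact div_le_self (abs_nonneg _) h1
      _ = _ := by ring
  · simp; positivity

theorem backTerm_eq_zero {κ ν i j : ℕ} (h : i + j < ν) (d : ℤ) (m : ℕ) :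
    backTerm κ ν i j d m = 0 := by
  unfold backTerm
  rw [cbar_eq_zero (i := i) (j := j) (m := ν) (by omega)]
  simp

/-- The coefficients of one half of the backreaction, summed over the intermediate mode. -/
def backSum (D : ℕ → ℕ → ℤ) (p : ℕ × ℕ × ℕ) (m : ℕ) : ℝ :=
  ∑ ν ∈ range (p.2.1 + p.2.2 + 1), backTerm p.1 ν p.2.1 p.2.2 (D p.2.1 p.2.2) m

theorem sum_abs_backTerm_triBound {r : ℕ} (hr : 2 ≤ r) (D : ℕ → ℕ → ℤ) :
    TriBound (fun p m => ∑ ν ∈ range (p.2.1 + p.2.2 + 1),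
      |backTerm p.1 ν p.2.1 p.2.2 (D p.2.1 p.2.2) m|) (4096 * 3 ^ r) r := by
  intro p m
  have h := sum_abs_cbar_mul_weight_le hr p.1 p.2.1 p.2.2 m
  rw [abs_of_nonneg (Finset.sum_nonneg fun _ _ => abs_nonneg _)]
  calc _ ≤ (∑ ν ∈ range (p.2.1 + p.2.2 + 1), 4 * (|cbar p.1 ν m| * |cbar p.2.1 p.2.2 ν|)) *
        ((m : ℝ) + 1) ^ r := by
        refine mul_le_mul_of_nonneg_right ?_ (by positivity)
        exact Finset.sum_le_sum fun _ _ => abs_backTerm_le _ _ _ _ _ _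
    _ = 4 * ((∑ ν ∈ range (p.2.1 + p.2.2 + 1), (|cbar p.1 ν m| * |cbar p.2.1 p.2.2 ν|)) *
        ((m : ℝ) + 1) ^ r) := by rw [← Finset.mul_sum]; ring
    _ ≤ 4 * (1024 * 3 ^ r * (((p.1 : ℝ) + 1) * (p.2.1 + 1) * (p.2.2 + 1)) ^ r) := by gcongr
    _ = _ := by ring

theorem backSum_triBound {r : ℕ} (hr : 2 ≤ r) (D : ℕ → ℕ → ℤ) :
    TriBound (backSum D) (4096 * 3 ^ r) r := by
  intro p m
  refine le_trans ?_ (sum_abs_backTerm_triBound hr D p m)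
  refine mul_le_mul_of_nonneg_right ?_ (by positivity)
  exact (Finset.abs_sum_le_sum_abs _ _).trans (le_abs_self _)

/-- Moving the second of four components to the end. -/
def moveSecondEquiv : (ℕ × ℕ × ℕ) × ℕ ≃ ℕ × ℕ × ℕ × ℕ where
  toFun p := (p.1.1, p.2, p.1.2.1, p.1.2.2)
  invFun p := ((p.1, p.2.2.1, p.2.2.2), p.2.1)
  left_inv _ := rfl
  right_inv _ := rfl

theorem tsum_backreactionTerm {r : ℕ} (hr : 2 ≤ r) (D : ℕ → ℕ → ℤ) (u : WeightedSeq (r + 1))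
    (m : ℕ) :
    ∑' p : ℕ × ℕ × ℕ × ℕ, backreactionTerm u m p.1 p.2.1 p.2.2.1 p.2.2.2
      (D p.2.2.1 p.2.2.2) = triValue (backSum D) u u u m := by
  obtain ⟨hs, -⟩ := (sum_abs_backTerm_triBound hr D).summable_and_abs_le u u u m
  set G : (ℕ × ℕ × ℕ) × ℕ → ℝ := fun z =>
    backTerm z.1.1 z.2 z.1.2.1 z.1.2.2 (D z.1.2.1 z.1.2.2) m *
      (u z.1.1 * u z.1.2.1 * u z.1.2.2) with hG
  have hzero : ∀ (p : ℕ × ℕ × ℕ) (ν : ℕ), ν ∉ range (p.2.1 + p.2.2 + 1) → G (p, ν) = 0 := by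
    intro p ν hν
    have : p.2.1 + p.2.2 < ν := by
      have := mt Finset.mem_range.2 hν; omega
    simp only [hG]
    rw [backTerm_eq_zero this, zero_mul]
  -- Absolute summability over all four indices is needed to sum over ν first; for each triple that
  -- inner sum is finite by the triangle rule.
  have hsum : Summable G := by
    refine Summable.of_norm ?_
    refine (summable_prod_of_nonneg fun _ => norm_nonneg _).2 ⟨fun p => ?_, ?_⟩
    · refine summable_of_ne_finset_zero (s := range (p.2.1 + p.2.2 + 1)) fun ν hν => ?_
      rw [hzero p ν hν, norm_zero]
    · refine hs.congr fun p => ?_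
      rw [tsum_eq_sum (s := range (p.2.1 + p.2.2 + 1))
        (fun ν hν => by rw [hzero p ν hν, norm_zero])]
      simp only [hG, Real.norm_eq_abs]
      rw [abs_mul, abs_of_nonneg (Finset.sum_nonneg fun _ _ => abs_nonneg _), Finset.sum_mul]
      simp only [abs_mul]
  rw [← moveSecondEquiv.tsum_eq]
  have e : ∀ z, backreactionTerm u m (moveSecondEquiv z).1 (moveSecondEquiv z).2.1
      (moveSecondEquiv z).2.2.1 (moveSecondEquiv z).2.2.2
      (D (moveSecondEquiv z).2.2.1 (moveSecondEquiv z).2.2.2) = G z := by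
    intro z
    rw [backreactionTerm_eq]
    rfl
  simp only [e]
  rw [hsum.tsum_prod, triValue]
  refine tsum_congr fun p => ?_
  rw [tsum_eq_sum (s := range (p.2.1 + p.2.2 + 1)) (hzero p), backSum, Finset.sum_mul]

/-- The coefficients of the nonlinear part of the modified resonant operator. -/
def resCoeff (p : ℕ × ℕ × ℕ) (m : ℕ) : ℝ :=
  cubicCoeff p m + 9 / 4 * (backSum (fun i j => freq i - freq j) p m +
    backSum (fun i j => freq i + freq j) p m)

theorem TriBound.const_mul {a : ℕ × ℕ × ℕ → ℕ → ℝ} {C : ℝ} {r : ℕ} (h : TriBound a C r)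
    {c : ℝ} (hc : 0 ≤ c) : TriBound (fun p m => c * a p m) (c * C) r := by
  intro p m
  rw [abs_mul, abs_of_nonneg hc, mul_assoc, mul_assoc]
  exact mul_le_mul_of_nonneg_left (h p m) hc

theorem exists_resCoeff_triBound {r : ℕ} (hr : 2 ≤ r) : ∃ C, TriBound resCoeff C r :=
  ⟨_, (cubicCoeff_triBound hr).add
    (((backSum_triBound hr _).add (backSum_triBound hr _)).const_mul (by norm_num))⟩

theorem Mminus_eq {r : ℕ} (hr : 2 ≤ r) (u : WeightedSeq (r + 1)) (m : ℕ) :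
    Mminus u m = -((freq m : ℝ) ^ 2 * u m) + triValue resCoeff u u u m := by
  have s1 := (cubicCoeff_triBound hr).summable u u u m
  have s2 := (backSum_triBound hr (fun i j => freq i - freq j)).summable u u u m
  have s3 := (backSum_triBound hr (fun i j => freq i + freq j)).summable u u u m
  rw [Mminus, avgF3_eq hr, backreaction,
    tsum_backreactionTerm hr (fun i j => freq i - freq j) u m,
    tsum_backreactionTerm hr (fun i j => freq i + freq j) u m, add_assoc]
  congr 1
  simp only [triValue]
  rw [← tsum_mul_left, ← tsum_mul_left, ← (s2.mul_left _).tsum_add (s3.mul_left _),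
    ← s1.tsum_add ((s2.mul_left _).add (s3.mul_left _))]
  refine tsum_congr fun p => ?_
  rw [resCoeff]
  ring

/-! ### Resonances at a one-mode sequence -/

theorem integral_cos_int_mul_two_pi (k : ℤ) :
    ∫ t in (0 : ℝ)..(2 * Real.pi), Real.cos (k * t) = if k = 0 then 2 * Real.pi else 0 := by
  split_ifs with h
  · simp [h]
  · have hk : (k : ℝ) ≠ 0 := by exact_mod_cast h
    rw [intervalIntegral.integral_comp_mul_left (fun x => Real.cos x) hk, integral_cos]
    have : Real.sin ((k : ℝ) * (2 * Real.pi)) = 0 := by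
      have := Real.sin_int_mul_pi (2 * k)
      rw [← this]; congr 1; push_cast; ring
    simp [this]

theorem avgCos_eq (n γ m : ℕ) :
    avgCos (n, γ, γ) m = (if n = m then 1 / 4 else 0) + (if n + m = 2 * γ then 1 / 8 else 0) +
      (if n + 2 * γ + 4 = m then 1 / 8 else 0) + (if m + 2 * γ + 4 = n then 1 / 8 else 0) := by
  have e : ∀ t : ℝ, Real.cos (freq n * t) * Real.cos (freq γ * t) * Real.cos (freq γ * t) *
      Real.cos (freq m * t) =
      1 / 4 * (Real.cos ((freq n - freq m : ℤ) * t) + Real.cos ((freq n + freq m : ℤ) * t)) +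
      1 / 8 * (Real.cos ((freq n - freq m + 2 * freq γ : ℤ) * t)
        + Real.cos ((freq n - freq m - 2 * freq γ : ℤ) * t)
        + Real.cos ((freq n + freq m + 2 * freq γ : ℤ) * t)
        + Real.cos ((freq n + freq m - 2 * freq γ : ℤ) * t)) := by
    intro t
    push_cast
    simp only [add_mul, sub_mul, Real.cos_add, Real.cos_sub, Real.sin_add, Real.sin_sub,
      mul_assoc, Real.cos_two_mul, Real.sin_two_mul]
    ring
  have hi : ∀ (k : ℤ), IntervalIntegrable
      (fun t : ℝ => Real.cos (k * t)) MeasureTheory.volume 0 (2 * Real.pi) :=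
    fun k => Continuous.intervalIntegrable (by fun_prop) _ _
  have hpi := Real.pi_pos
  rw [avgCos]
  simp only [e]
  rw [intervalIntegral.integral_add (((hi _).add (hi _)).const_mul _)
      (((((hi _).add (hi _)).add (hi _)).add (hi _)).const_mul _),
    intervalIntegral.integral_const_mul, intervalIntegral.integral_const_mul,
    intervalIntegral.integral_add (hi _) (hi _),
    intervalIntegral.integral_add (((hi _).add (hi _)).add (hi _)) (hi _),
    intervalIntegral.integral_add ((hi _).add (hi _)) (hi _),
    intervalIntegral.integral_add (hi _) (hi _)]
  simp only [integral_cos_int_mul_two_pi]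
  have c1 : (freq n - freq m = 0) ↔ n = m := by unfold freq; omega
  have c2 : ¬ (freq n + freq m = 0) := by unfold freq; omega
  have c3 : (freq n - freq m + 2 * freq γ = 0) ↔ n + 2 * γ + 4 = m := by unfold freq; omega
  have c4 : (freq n - freq m - 2 * freq γ = 0) ↔ m + 2 * γ + 4 = n := by unfold freq; omega
  have c5 : ¬ (freq n + freq m + 2 * freq γ = 0) := by unfold freq; omega
  have c6 : (freq n + freq m - 2 * freq γ = 0) ↔ n + m = 2 * γ := by unfold freq; omega
  simp only [c1, c2, c3, c4, c5, c6, if_false]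
  have f : ∀ (P : Prop) [Decidable P], (if P then 2 * Real.pi else 0) =
      2 * Real.pi * (if P then 1 else 0) := by
    intro P _; split_ifs <;> simp
  have g : ∀ (P : Prop) [Decidable P] (c : ℝ), (if P then c else 0) =
      c * (if P then 1 else 0) := by
    intro P _ c; split_ifs <;> simp
  simp only [f]
  simp only [g _ (1 / 4), g _ (1 / 8)]
  field_simp
  ring

/-- The resonances in which one outer frequency equals the other plus `2 ω_γ` are removed by
`ccub_eq_zero`: they ask for a gap of `2γ + 4`, beyond the allowed `2γ + 2`. -/
theorem cubicCoeff_eq (n γ m : ℕ) :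
    cubicCoeff (n, γ, γ) m = (if n = m then -(1 / 4 * ccub γ γ m m) else 0) +
      (if n + m = 2 * γ then -(1 / 8 * ccub γ (2 * γ - m) γ m) else 0) := by
  rw [cubicCoeff, avgCos_eq]
  simp only
  by_cases h1 : n + 2 * γ + 4 = m
  · rw [ccub_eq_zero (i := n) (by omega)]
    have h3 : ¬ n = m := by omega
    have h4 : ¬ n + m = 2 * γ := by omega
    simp [h3, h4]
  by_cases h2 : m + 2 * γ + 4 = n
  · have : ccub n γ γ m = ccub m γ γ n := by unfold ccub; congr 1; funext x; ring
    rw [this, ccub_eq_zero (i := m) (by omega)]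
    have h3 : ¬ n = m := by omega
    have h4 : ¬ n + m = 2 * γ := by omega
    simp [h3, h4]
  rw [if_neg h1, if_neg h2]
  have e1 : ∀ k, ccub k γ γ m = ccub γ γ k m := by
    intro k; unfold ccub; congr 1; funext x; ring
  have e2 : ∀ k, ccub k γ γ m = ccub γ k γ m := by
    intro k; unfold ccub; congr 1; funext x; ring
  by_cases h3 : n = m
  · subst h3
    by_cases h4 : n + n = 2 * γ
    · have hn : 2 * γ - n = n := by omega
      rw [if_pos rfl, if_pos rfl, if_pos h4, if_pos h4, hn, ← e1, ← e2]
      ring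
    · rw [if_pos rfl, if_pos rfl, if_neg h4, if_neg h4, ← e1]
      ring
  · by_cases h4 : n + m = 2 * γ
    · have hn : 2 * γ - m = n := by omega
      rw [if_neg h3, if_neg h3, if_pos h4, if_pos h4, hn, ← e2]
      ring
    · rw [if_neg h3, if_neg h3, if_neg h4, if_neg h4]
      ring

theorem cubicCoeff_swap_left (i j k m : ℕ) : cubicCoeff (i, j, k) m = cubicCoeff (j, i, k) m := by
  have h : avgCos (i, j, k) m = avgCos (j, i, k) m := by
    unfold avgCos; congr 2; funext t; ring
  simp only [cubicCoeff, h]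
  rw [ccub_swap₁₂]

theorem cubicCoeff_swap_right (i j k m : ℕ) :
    cubicCoeff (i, j, k) m = cubicCoeff (i, k, j) m := by
  have h : avgCos (i, j, k) m = avgCos (i, k, j) m := by
    unfold avgCos; congr 2; funext t; ring
  simp only [cubicCoeff, h]
  rw [ccub_swap₂₃]

theorem signCount_neg (a b c : ℤ) : signCount (-a) b c = signCount a b c := by
  have c1 : (-a + b + c = 0) ↔ (a - b - c = 0) := by omega
  have c2 : (-a + b - c = 0) ↔ (a - b + c = 0) := by omega
  have c3 : (-a - b + c = 0) ↔ (a + b - c = 0) := by omega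
  have c4 : (-a - b - c = 0) ↔ (a + b + c = 0) := by omega
  unfold signCount
  simp only [c1, c2, c3, c4]
  ring

theorem backTerm_neg (κ ν i j : ℕ) (d : ℤ) (m : ℕ) :
    backTerm κ ν i j (-d) m = backTerm κ ν i j d m := by
  unfold backTerm
  have c : (-d ≠ freq ν ∧ -d ≠ -freq ν) ↔ (d ≠ freq ν ∧ d ≠ -freq ν) := by omega
  simp only [c, signCount_neg]
  push_cast
  rw [neg_sq]

theorem backTerm_swap (κ ν i j : ℕ) (d : ℤ) (m : ℕ) :
    backTerm κ ν i j d m = backTerm κ ν j i d m := by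
  unfold backTerm
  rw [cbar_swap_left i j]

theorem backSum_swap_sub (κ i j m : ℕ) :
    backSum (fun i j => freq i - freq j) (κ, i, j) m =
      backSum (fun i j => freq i - freq j) (κ, j, i) m := by
  unfold backSum
  simp only
  rw [add_comm i j]
  refine Finset.sum_congr rfl fun ν _ => ?_
  rw [backTerm_swap, ← backTerm_neg, neg_sub]

theorem backSum_swap_add (κ i j m : ℕ) :
    backSum (fun i j => freq i + freq j) (κ, i, j) m =
      backSum (fun i j => freq i + freq j) (κ, j, i) m := by
  unfold backSum
  simp only
  rw [add_comm i j]
  refine Finset.sum_congr rfl fun ν _ => ?_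
  rw [backTerm_swap, add_comm (freq i)]

theorem resCoeff_swap_right (κ i j m : ℕ) :
    resCoeff (κ, i, j) m = resCoeff (κ, j, i) m := by
  rw [resCoeff, resCoeff, cubicCoeff_swap_right, backSum_swap_sub, backSum_swap_add]

/-- For `d = 0` the condition `ω_n = ω_m` is met by two sign choices. This factor 2 turns 9/4 into
the constant 9/2 of the linearization. -/
theorem backTerm_zero_eq (n ν γ m : ℕ) :
    backTerm n ν γ γ (freq γ - freq γ) m =
      if n = m then 2 * (cbar m ν m * cbar γ γ ν / (freq ν : ℝ) ^ 2) else 0 := by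
  unfold backTerm signCount
  rw [sub_self, if_pos (by unfold freq; omega), if_neg (by unfold freq; omega),
    if_neg (by unfold freq; omega : ¬ (0 - freq n - freq m = 0))]
  by_cases h : n = m
  · subst h
    rw [if_pos (by omega), if_pos (by omega), if_pos rfl]
    push_cast
    ring
  · rw [if_neg (by unfold freq; omega), if_neg (by unfold freq; omega), if_neg h]
    ring

/-- For `ν ≤ 2γ` the frequency stays below `2 ω_γ`, so nothing is excluded; the other two resonances
contradict the triangle rule. -/
theorem backTerm_double_eq {n ν γ m : ℕ} (hν : ν ≤ 2 * γ) :
    backTerm n ν γ γ (freq γ + freq γ) m =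
      if n + m = 2 * γ then cbar (2 * γ - m) ν m * cbar γ γ ν /
        ((freq ν : ℝ) ^ 2 - (2 * (freq γ : ℝ)) ^ 2) else 0 := by
  unfold backTerm signCount
  rw [if_pos (by unfold freq; omega), if_neg (by unfold freq; omega)]
  have c4 : (freq γ + freq γ - freq n - freq m = 0) ↔ n + m = 2 * γ := by unfold freq; omega
  simp only [c4]
  by_cases h : n + m = 2 * γ
  · have hn : 2 * γ - m = n := by omega
    rw [if_neg (by unfold freq; omega), if_neg (by unfold freq; omega), if_pos h, if_pos h, hn]
    push_cast
    ring
  · rw [if_neg h, if_neg h]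
    by_cases h2 : n + 2 * γ + 4 = m ∨ m + 2 * γ + 4 = n
    · rw [cbar_eq_zero (i := n) (j := ν) (m := m) (by omega)]
      ring
    · rw [if_neg (by unfold freq; omega), if_neg (by unfold freq; omega)]
      ring

theorem backTerm_add_eq {n ν γ m : ℕ} (hν : ν ≤ n + γ) :
    backTerm γ ν n γ (freq n + freq γ) m =
      if n = m then cbar γ ν m ^ 2 / ((freq ν : ℝ) ^ 2 - ((freq m : ℝ) + freq γ) ^ 2)
      else 0 := by
  unfold backTerm signCount
  rw [if_pos (by unfold freq; omega), if_neg (by unfold freq; omega),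
    if_neg (by unfold freq; omega : ¬ (freq n + freq γ - freq γ + freq m = 0))]
  by_cases h2 : n + 2 * γ + 4 = m
  · rw [cbar_eq_zero (i := γ) (j := ν) (m := m) (by omega), if_neg (by omega : ¬ n = m)]
    ring
  rw [if_neg (by unfold freq; omega)]
  by_cases h : n = m
  · subst h
    have : cbar n γ ν = cbar γ ν n := by
      unfold cbar; congr 1; funext x; ring
    rw [if_pos (by ring), if_pos rfl, this]
    push_cast
    ring
  · rw [if_neg (by unfold freq; omega), if_neg h]
    ring

theorem backTerm_sub_eq (n ν γ m : ℕ) :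
    backTerm γ ν n γ (freq n - freq γ) m =
      (if n = m then cbar m γ ν ^ 2 / ((freq ν : ℝ) ^ 2 - ((freq m : ℝ) - freq γ) ^ 2) else 0) +
      (if n + m = 2 * γ then cbar γ ν m * cbar (2 * γ - m) γ ν /
        ((freq ν : ℝ) ^ 2 - ((freq (2 * γ - m) : ℝ) - freq γ) ^ 2) else 0) := by
  -- Excluded terms have zero denominator, hence value zero anyway, and the case distinction
  -- disappears.
  have hX : backTerm γ ν n γ (freq n - freq γ) m =
      cbar γ ν m * (cbar n γ ν / ((freq ν : ℝ) ^ 2 - ((freq n : ℝ) - freq γ) ^ 2)) *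
        signCount (freq n - freq γ) (freq γ) (freq m) := by
    unfold backTerm
    split_ifs with h
    · push_cast; rfl
    · have h0 : (freq ν : ℝ) ^ 2 - ((freq n : ℝ) - freq γ) ^ 2 = 0 := by
        have h1 : freq n - freq γ = freq ν ∨ freq n - freq γ = -freq ν := by omega
        have h2 : (freq n : ℝ) - freq γ = freq ν ∨ (freq n : ℝ) - freq γ = -freq ν := by
          rcases h1 with h1 | h1
          · left; exact_mod_cast h1
          · right; exact_mod_cast h1
        rcases h2 with h2 | h2 <;> rw [h2] <;> ring
      rw [h0]; simp
  rw [hX]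
  by_cases h3 : m + 2 * γ + 4 = n
  · rw [if_neg (by omega : ¬ n = m), if_neg (by omega : ¬ n + m = 2 * γ)]
    -- In this resonance no ν satisfies both triangle conditions, so one of the two coefficients
    -- vanishes.
    by_cases hν : ν ≤ m + γ
    · rw [cbar_eq_zero (i := n) (j := γ) (m := ν) (by omega)]; ring
    · rw [cbar_eq_zero (i := γ) (j := ν) (m := m) (by omega)]; ring
  have hs : signCount (freq n - freq γ) (freq γ) (freq m) =
      (if n = m then 1 else 0) + (if n + m = 2 * γ then 1 else 0) := by
    have c1 : (freq n - freq γ + freq γ - freq m = 0) ↔ n = m := by unfold freq; omega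
    have c2 : (freq n - freq γ - freq γ + freq m = 0) ↔ n + m = 2 * γ := by unfold freq; omega
    unfold signCount
    rw [if_neg (by unfold freq; omega),
      if_neg (by unfold freq; omega : ¬ (freq n - freq γ - freq γ - freq m = 0))]
    simp only [c1, c2]
    ring
  rw [hs, mul_add]
  congr 1
  · by_cases h : n = m
    · subst h
      have : cbar γ ν n = cbar n γ ν := by
        unfold cbar; congr 1; funext x; ring
      rw [if_pos rfl, if_pos rfl, this]
      ring
    · rw [if_neg h, if_neg h, mul_zero]
  · by_cases h : n + m = 2 * γ
    · have hn : 2 * γ - m = n := by omega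
      rw [if_pos h, if_pos h, hn]
      ring
    · rw [if_neg h, if_neg h, mul_zero]

theorem sum_range_eq_of_zero {M : Type*} [AddCommMonoid M] {f : ℕ → M} {a b : ℕ}
    (h : ∀ ν, a ≤ ν ∨ b ≤ ν → f ν = 0) : ∑ ν ∈ range a, f ν = ∑ ν ∈ range b, f ν := by
  have key : ∀ c d : ℕ, (∀ ν, c ≤ ν → f ν = 0) → c ≤ d →
      ∑ ν ∈ range c, f ν = ∑ ν ∈ range d, f ν := fun c d hc hcd =>
    Finset.sum_subset (Finset.range_subset_range.2 hcd) fun ν _ hν =>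
      hc ν (by simpa using hν)
  rcases le_total a b with hab | hab
  · exact key a b (fun ν hν => h ν (Or.inl hν)) hab
  · exact (key b a (fun ν hν => h ν (Or.inr hν)) hab).symm

theorem sum_ite_const {f : ℕ → ℝ} (P : Prop) [Decidable P] (s : Finset ℕ) :
    ∑ ν ∈ s, (if P then f ν else 0) = if P then ∑ ν ∈ s, f ν else 0 := by
  split_ifs <;> simp

/-- The diagonal part of the coefficients for a perturbation of the first factor. -/
def diagFirst (γ m : ℕ) : ℝ :=
  -(1 / 4 * ccub γ γ m m) +
    9 / 2 * ∑ ν ∈ range (2 * γ + 1), cbar m ν m * cbar γ γ ν / (freq ν : ℝ) ^ 2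

/-- The off-diagonal part of the coefficients for a perturbation of the first factor. -/
def offFirst (γ m : ℕ) : ℝ :=
  -(1 / 8 * ccub γ (2 * γ - m) γ m) +
    9 / 4 * ∑ ν ∈ range (2 * γ + 1), cbar (2 * γ - m) ν m * cbar γ γ ν /
        ((freq ν : ℝ) ^ 2 - (2 * (freq γ : ℝ)) ^ 2)

/-- The diagonal part of the coefficients for a perturbation of another factor. -/
def diagSecond (γ m : ℕ) : ℝ :=
  -(1 / 4 * ccub γ γ m m) +
    9 / 4 * (∑ ν ∈ range (m + γ + 1),
        cbar γ ν m ^ 2 / ((freq ν : ℝ) ^ 2 - ((freq m : ℝ) + freq γ) ^ 2) +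
      ∑ ν ∈ range (m + γ + 1),
        cbar m γ ν ^ 2 / ((freq ν : ℝ) ^ 2 - ((freq m : ℝ) - freq γ) ^ 2))

/-- The off-diagonal part of the coefficients for a perturbation of another factor. -/
def offSecond (γ m : ℕ) : ℝ :=
  -(1 / 8 * ccub γ (2 * γ - m) γ m) +
    9 / 4 * ∑ ν ∈ range (m + γ + 1), cbar γ ν m * cbar (2 * γ - m) γ ν /
        ((freq ν : ℝ) ^ 2 - ((freq (2 * γ - m) : ℝ) - freq γ) ^ 2)

theorem resCoeff_first (γ m n : ℕ) :
    resCoeff (n, γ, γ) m = (if n = m then diagFirst γ m else 0) +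
      (if n + m = 2 * γ then offFirst γ m else 0) := by
  have h1 : backSum (fun i j => freq i - freq j) (n, γ, γ) m = if n = m then
      2 * ∑ ν ∈ range (2 * γ + 1), cbar m ν m * cbar γ γ ν / (freq ν : ℝ) ^ 2 else 0 := by
    unfold backSum
    simp only [backTerm_zero_eq]
    rw [sum_ite_const, ← Finset.mul_sum, two_mul γ]
  have h2 : backSum (fun i j => freq i + freq j) (n, γ, γ) m = if n + m = 2 * γ then
      ∑ ν ∈ range (2 * γ + 1), cbar (2 * γ - m) ν m * cbar γ γ ν /
        ((freq ν : ℝ) ^ 2 - (2 * (freq γ : ℝ)) ^ 2) else 0 := by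
    unfold backSum
    simp only
    rw [← sum_ite_const, ← two_mul γ]
    refine Finset.sum_congr rfl fun ν hν => ?_
    have := Finset.mem_range.1 hν
    exact backTerm_double_eq (by omega)
  rw [resCoeff, cubicCoeff_eq, h1, h2, diagFirst, offFirst]
  split_ifs <;> ring

theorem resCoeff_second (γ m n : ℕ) :
    resCoeff (γ, n, γ) m = (if n = m then diagSecond γ m else 0) +
      (if n + m = 2 * γ then offSecond γ m else 0) := by
  have h1 : backSum (fun i j => freq i + freq j) (γ, n, γ) m = if n = m then
      ∑ ν ∈ range (m + γ + 1),
        cbar γ ν m ^ 2 / ((freq ν : ℝ) ^ 2 - ((freq m : ℝ) + freq γ) ^ 2) else 0 := by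
    have h : backSum (fun i j => freq i + freq j) (γ, n, γ) m = ∑ ν ∈ range (n + γ + 1),
        if n = m then
        cbar γ ν m ^ 2 / ((freq ν : ℝ) ^ 2 - ((freq m : ℝ) + freq γ) ^ 2) else 0 := by
      unfold backSum
      refine Finset.sum_congr rfl fun ν hν => ?_
      have : ν < n + γ + 1 := Finset.mem_range.1 hν
      exact backTerm_add_eq (show ν ≤ n + γ by omega)
    rw [h, sum_ite_const]
    split_ifs with hn
    · rw [hn]
    · rfl
  have h2 : backSum (fun i j => freq i - freq j) (γ, n, γ) m = (if n = m then
      ∑ ν ∈ range (m + γ + 1),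
        cbar m γ ν ^ 2 / ((freq ν : ℝ) ^ 2 - ((freq m : ℝ) - freq γ) ^ 2) else 0) +
      (if n + m = 2 * γ then ∑ ν ∈ range (m + γ + 1), cbar γ ν m * cbar (2 * γ - m) γ ν /
        ((freq ν : ℝ) ^ 2 - ((freq (2 * γ - m) : ℝ) - freq γ) ^ 2) else 0) := by
    unfold backSum
    simp only [backTerm_sub_eq]
    rw [Finset.sum_add_distrib, sum_ite_const, sum_ite_const]
    congr 1
    · split_ifs with hn
      · rw [hn]
      · rfl
    · split_ifs with hn
      · apply sum_range_eq_of_zero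
        intro ν hν
        rcases hν with hν | hν
        · rw [cbar_eq_zero (i := 2 * γ - m) (j := γ) (m := ν) (by omega)]; simp
        · rw [cbar_eq_zero (i := γ) (j := ν) (m := m) (by omega)]; simp
      · rfl
  rw [resCoeff, cubicCoeff_swap_left, cubicCoeff_eq, h1, h2, diagSecond, offSecond]
  split_ifs <;> ring

/-! ### Linearization and its kernel -/

theorem diag_sum_eq {γ m : ℕ} {K : ℝ} (hK : K ^ 2 = amplitude γ ^ 2) (hK0 : K ^ 2 ≠ 0) :
    -(freq m : ℝ) ^ 2 + K ^ 2 * (diagFirst γ m + diagSecond γ m + diagSecond γ m) =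
      -K ^ 2 * coeffU (9 / 2) γ m := by
  have e : K ^ 2 * ((freq m : ℝ) / amplitude γ) ^ 2 = (freq m : ℝ) ^ 2 := by
    have hK1 : K ≠ 0 := by rintro rfl; simp at hK0
    rw [div_pow, ← hK]; field_simp
  rw [coeffU, sum_nonresonantRange, diagFirst, diagSecond]
  linear_combination e

theorem off_sum_eq {γ m : ℕ} (hm : m ≤ 2 * γ) :
    offFirst γ m + offSecond γ m + offSecond γ m = -coeffV γ m := by
  have e : ((freq (2 * γ - m) : ℝ) - freq γ) ^ 2 = ((freq m : ℝ) - freq γ) ^ 2 := by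
    simp only [freq_cast, Nat.cast_sub hm]; push_cast; ring
  have h := sum_nonresonantRange (fun ν => cbar γ ν m * cbar (2 * γ - m) γ ν) γ m
  rw [← e] at h
  rw [coeffV, h, offFirst, offSecond]
  ring

/-- This is the cubic self-interaction of the mode γ, up to a factor 8; balancing it with `ω_γ²`
gives the amplitude. -/
theorem first_sum_eq (γ : ℕ) :
    8 * (diagFirst γ γ + offFirst γ γ) = 8 * q γ - 3 * ccub γ γ γ γ := by
  have e : q γ = 9 / 2 * ∑ ν ∈ range (2 * γ + 1), cbar γ ν γ * cbar γ γ ν / (freq ν : ℝ) ^ 2 +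
      9 / 4 * ∑ ν ∈ range (2 * γ + 1), cbar γ ν γ * cbar γ γ ν /
        ((freq ν : ℝ) ^ 2 - (2 * (freq γ : ℝ)) ^ 2) := by
    rw [q, Finset.mul_sum, Finset.mul_sum, Finset.mul_sum, ← Finset.sum_add_distrib]
    refine Finset.sum_congr rfl fun ν _ => ?_
    rw [cbar_swap_right γ ν γ]
    ring
  rw [diagFirst, offFirst, show 2 * γ - γ = γ by omega, e]
  ring

/-- The value of a sum over triples in which two indices are frozen. -/
theorem tsum_slot {F : ℕ × ℕ × ℕ → ℝ} {g : ℕ → ℕ × ℕ × ℕ} (hg : Function.Injective g)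
    (hsupp : Function.support F ⊆ Set.range g) {h : ℕ → ℝ} {γ m : ℕ} {A B c : ℝ}
    (hF : ∀ n, F (g n) = ((if n = m then A else 0) + (if n + m = 2 * γ then B else 0)) *
      (c * h n)) :
    ∑' p, F p = c * (A * h m + if m ≤ 2 * γ then B * h (2 * γ - m) else 0) := by
  rw [← hg.tsum_eq hsupp]
  have h1 : HasSum (fun n => (if n = m then A else 0) * (c * h n)) (A * (c * h m)) := by
    have := hasSum_single (f := fun n => (if n = m then A else 0) * (c * h n)) m
      (fun n hn => by simp [hn])
    simpa using this
  have h2 : HasSum (fun n => (if n + m = 2 * γ then B else 0) * (c * h n))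
      (if m ≤ 2 * γ then B * (c * h (2 * γ - m)) else 0) := by
    have := hasSum_single (f := fun n => (if n + m = 2 * γ then B else 0) * (c * h n))
      (2 * γ - m) (fun n hn => by rw [if_neg (by omega), zero_mul])
    convert this using 1
    by_cases hm : m ≤ 2 * γ
    · rw [if_pos hm, if_pos (by omega)]
    · rw [if_neg hm, if_neg (by omega), zero_mul]
  have h3 : ∑' n, F (g n) = A * (c * h m) + if m ≤ 2 * γ then B * (c * h (2 * γ - m)) else 0 := by
    rw [← (h1.add h2).tsum_eq]
    refine tsum_congr fun n => ?_
    rw [hF, add_mul]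
  rw [h3]
  split_ifs <;> ring

theorem mode_coe (s γ : ℕ) (K : ℝ) (j : ℕ) : mode s γ K j = if j = γ then K else 0 := rfl

theorem triValue_first (h : ℕ → ℝ) (s γ m : ℕ) (K : ℝ) :
    triValue resCoeff h (mode s γ K) (mode s γ K) m =
      K ^ 2 * (diagFirst γ m * h m +
        if m ≤ 2 * γ then offFirst γ m * h (2 * γ - m) else 0) := by
  refine tsum_slot (g := fun n => (n, γ, γ)) (fun a b hab => (Prod.mk.inj hab).1) ?_ fun n => ?_
  · rintro ⟨n, i, j⟩ hp
    simp only [Function.mem_support, mode_coe] at hp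
    have hi : i = γ := by by_contra hi; simp [hi] at hp
    have hj : j = γ := by by_contra hj; simp [hj] at hp
    exact ⟨n, by rw [hi, hj]⟩
  · rw [resCoeff_first]
    simp only [mode_coe, if_true]
    ring

theorem triValue_second (h : ℕ → ℝ) (s γ m : ℕ) (K : ℝ) :
    triValue resCoeff (mode s γ K) h (mode s γ K) m =
      K ^ 2 * (diagSecond γ m * h m +
        if m ≤ 2 * γ then offSecond γ m * h (2 * γ - m) else 0) := by
  refine tsum_slot (g := fun n => (γ, n, γ))
    (fun a b hab => (Prod.mk.inj (Prod.mk.inj hab).2).1) ?_ fun n => ?_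
  · rintro ⟨i, n, j⟩ hp
    simp only [Function.mem_support, mode_coe] at hp
    have hi : i = γ := by by_contra hi; simp [hi] at hp
    have hj : j = γ := by by_contra hj; simp [hj] at hp
    exact ⟨n, by rw [hi, hj]⟩
  · rw [resCoeff_second]
    simp only [mode_coe, if_true]
    ring

theorem triValue_third (h : ℕ → ℝ) (s γ m : ℕ) (K : ℝ) :
    triValue resCoeff (mode s γ K) (mode s γ K) h m =
      K ^ 2 * (diagSecond γ m * h m +
        if m ≤ 2 * γ then offSecond γ m * h (2 * γ - m) else 0) := by
  refine tsum_slot (g := fun n => (γ, γ, n))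
    (fun a b hab => (Prod.mk.inj (Prod.mk.inj hab).2).2) ?_ fun n => ?_
  · rintro ⟨i, j, n⟩ hp
    simp only [Function.mem_support, mode_coe] at hp
    have hi : i = γ := by by_contra hi; simp [hi] at hp
    have hj : j = γ := by by_contra hj; simp [hj] at hp
    exact ⟨n, by rw [hi, hj]⟩
  · rw [resCoeff_swap_right, resCoeff_second]
    simp only [mode_coe, if_true]
    ring

theorem sq_mul_eq_of_amplitude {γ : ℕ} (hγ : γ ≤ 5) {K : ℝ}
    (hK : K = amplitude γ ∨ K = -amplitude γ) :
    K ^ 2 = amplitude γ ^ 2 ∧ K ^ 2 * (8 * q γ - 3 * ccub γ γ γ γ) = 8 * (freq γ : ℝ) ^ 2 := by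
  have h := ccub_lt_q hγ
  have h' : 0 < 8 * q γ - 3 * ccub γ γ γ γ := by linarith
  have e : K ^ 2 = amplitude γ ^ 2 := by
    rcases hK with rfl | rfl
    · rfl
    · ring
  refine ⟨e, ?_⟩
  rw [e, amplitude, mul_pow, Real.sq_sqrt (by positivity)]
  field_simp
  ring

theorem pair_eq_zero {a b c d x y : ℝ} (hdet : a * d - b * c ≠ 0) (h1 : a * x + b * y = 0)
    (h2 : d * y + c * x = 0) : x = 0 ∧ y = 0 := by
  constructor
  · have : (a * d - b * c) * x = 0 := by linear_combination d * h1 - b * h2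
    exact (mul_eq_zero.1 this).resolve_left hdet
  · have : (a * d - b * c) * y = 0 := by linear_combination a * h2 - c * h1
    exact (mul_eq_zero.1 this).resolve_left hdet

/-- The system decouples: pairs `{n, 2γ - n}` with determinant `D_{γn}`, the fixed point γ with `u +
v`, and scalar equations above `2γ`. -/
theorem eq_zero_of_nondegenerate {c : ℝ} {γ : ℕ} (hN : NondegeneracyInequalities c γ)
    {h : ℕ → ℝ} (hh : ∀ m, coeffU c γ m * h m +
      (if m ≤ 2 * γ then coeffV γ m * h (2 * γ - m) else 0) = 0) (m : ℕ) : h m = 0 := by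
  obtain ⟨h1, h2, h3⟩ := hN
  have pair : ∀ n < γ, h n = 0 ∧ h (2 * γ - n) = 0 := by
    intro n hn
    have e1 := hh n
    have e2 := hh (2 * γ - n)
    rw [if_pos (by omega)] at e1 e2
    rw [show 2 * γ - (2 * γ - n) = n by omega] at e2
    exact pair_eq_zero (h3 n hn) e1 e2
  rcases lt_trichotomy m γ with hm | rfl | hm
  · exact (pair m hm).1
  · have e := hh m
    rw [if_pos (by omega), show 2 * m - m = m by omega, ← add_mul] at e
    exact (mul_eq_zero.1 e).resolve_left h1
  · by_cases hm2 : m ≤ 2 * γ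
    · have := (pair (2 * γ - m) (by omega)).2
      rwa [show 2 * γ - (2 * γ - m) = m by omega] at this
    · have e := hh m
      rw [if_neg hm2, add_zero] at e
      exact (mul_eq_zero.1 e).resolve_left (h2 m (by omega))

/-- The modified resonant operator between weighted sequence spaces: it vanishes at the one-mode
initial data, and its derivative there is given by the coefficients `u` and `v`. -/
theorem exists_resonant_operator {γ : ℕ} (hγ : γ ≤ 5) {t : ℕ} (ht : 1 ≤ t) {K : ℝ}
    (hK : K = amplitude γ ∨ K = -amplitude γ) :
    ∃ M : WeightedSeq (t + 2) → WeightedSeq t,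
      (∀ (u : WeightedSeq (t + 2)) (m : ℕ), M u m = Mminus u m) ∧
      M (mode (t + 2) γ K) = 0 ∧
      DifferentiableAt ℝ M (mode (t + 2) γ K) ∧
      LinearMap.ker (fderiv ℝ M (mode (t + 2) γ K) :
        WeightedSeq (t + 2) →ₗ[ℝ] WeightedSeq t) = ⊥ ∧
      (∀ (h : WeightedSeq (t + 2)) (m : ℕ),
        fderiv ℝ M (mode (t + 2) γ K) h m =
          -K ^ 2 * (coeffU (9 / 2) γ m * h m +
            if m ≤ 2 * γ then coeffV γ m * h (2 * γ - m) else 0)) := by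
  -- The maximum norm carries the weight `t + 1`, one power below the source and one above the
  -- target; `1 ≤ t` makes it at least 2, as the coefficient bounds require.
  obtain ⟨C, hC⟩ := exists_resCoeff_triBound (r := t + 1) (by omega)
  obtain ⟨hK2, hKq⟩ := sq_mul_eq_of_amplitude hγ hK
  have hK0 : K ^ 2 ≠ 0 := by
    intro h0
    rw [h0, zero_mul, freq_cast] at hKq
    have : (0 : ℝ) < 8 * ((γ : ℝ) + 2) ^ 2 := by positivity
    linarith
  set ξ := mode (t + 2) γ K with hξ
  have hD : HasFDerivAt (fun u : WeightedSeq (t + 2) => -(freqSqMap t u) + triMap hC fun _ => u)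
      (-(freqSqMap t) + ((triMap hC).linearDeriv fun _ => ξ).comp
        (ContinuousLinearMap.pi fun _ => ContinuousLinearMap.id ℝ _)) ξ :=
    (freqSqMap t).hasFDerivAt.neg.add (hasFDerivAt_triMap_diag hC ξ)
  have hf := hD.fderiv
  have hval : ∀ (u : WeightedSeq (t + 2)) (m : ℕ),
      (-(freqSqMap t u) + triMap hC fun _ => u) m = Mminus u m := by
    intro u m
    rw [Mminus_eq (r := t + 1) (by omega)]
    rfl
  have hderiv : ∀ (h : WeightedSeq (t + 2)) (m : ℕ),
      (-(freqSqMap t) + ((triMap hC).linearDeriv fun _ => ξ).comp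
        (ContinuousLinearMap.pi fun _ => ContinuousLinearMap.id ℝ _)) h m =
          -K ^ 2 * (coeffU (9 / 2) γ m * h m +
            if m ≤ 2 * γ then coeffV γ m * h (2 * γ - m) else 0) := by
    intro h m
    have e1 : (-(freqSqMap t) + ((triMap hC).linearDeriv fun _ => ξ).comp
        (ContinuousLinearMap.pi fun _ => ContinuousLinearMap.id ℝ _)) h m =
        -((freq m : ℝ) ^ 2 * h m) + (((triMap hC).linearDeriv fun _ => ξ).comp
        (ContinuousLinearMap.pi fun _ => ContinuousLinearMap.id ℝ _)) h m := rfl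
    rw [e1, triMap_linearDeriv_apply, hξ, triValue_first, triValue_second, triValue_third]
    have hd := diag_sum_eq (m := m) hK2 hK0
    by_cases hm : m ≤ 2 * γ
    · have ho := off_sum_eq hm
      simp only [if_pos hm]
      linear_combination h m * hd + K ^ 2 * h (2 * γ - m) * ho
    · simp only [if_neg hm]
      linear_combination h m * hd
  refine ⟨fun u => -(freqSqMap t u) + triMap hC fun _ => u, hval, ?_, hD.differentiableAt, ?_, ?_⟩
  · apply WeightedSeq.ext
    intro m
    have e1 : (-(freqSqMap t ξ) + triMap hC fun _ => ξ) m =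
        -((freq m : ℝ) ^ 2 * ξ m) + triValue resCoeff ξ ξ ξ m := rfl
    -- The mode itself is inserted as the free argument, so only the components `m = γ` and `2γ - m
    -- = γ` can contribute, and these coincide.
    rw [e1, hξ, triValue_first]
    simp only [mode_coe, WeightedSeq.zero_coe]
    by_cases hm : m = γ
    · subst hm
      have hf := first_sum_eq m
      rw [← hf] at hKq
      rw [if_pos rfl, if_pos (by omega), if_pos (by omega)]
      linear_combination (K / 8) * hKq
    · rw [if_neg hm]
      by_cases hm2 : m ≤ 2 * γ
      · rw [if_pos hm2, if_neg (by omega)]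
        ring
      · rw [if_neg hm2]
        ring
  · rw [hf, LinearMap.ker_eq_bot']
    intro h hh
    apply WeightedSeq.ext
    intro m
    refine eq_zero_of_nondegenerate (nondegeneracyInequalities hγ (9 / 2) (Or.inl rfl))
      (h := h.1) (fun k => ?_) m
    have e := hderiv h k
    have e0 : (-(freqSqMap t) + ((triMap hC).linearDeriv fun _ => ξ).comp
        (ContinuousLinearMap.pi fun _ => ContinuousLinearMap.id ℝ _)) h = 0 := hh
    rw [e0, WeightedSeq.zero_coe] at e
    exact (mul_eq_zero.1 e.symm).resolve_left (neg_ne_zero.2 hK0)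
  · rw [hf]
    exact hderiv

end YM

end

theorem mainTheorem3 (γ : ℕ) (hγ : γ ≤ 5) (s : ℕ) (hs : 3 ≤ s)
    (K : ℝ) (hK : K = YM.amplitude γ ∨ K = -YM.amplitude γ) :
    3 * YM.ccub γ γ γ γ < 8 * YM.q γ ∧
    (∃ M : YM.WeightedSeq (s + 3) → YM.WeightedSeq (s + 1),
      (∀ (u : YM.WeightedSeq (s + 3)) (m : ℕ), M u m = YM.Mminus u m) ∧
      M (YM.mode (s + 3) γ K) = 0 ∧
      DifferentiableAt ℝ M (YM.mode (s + 3) γ K) ∧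
      LinearMap.ker (fderiv ℝ M (YM.mode (s + 3) γ K) :
        YM.WeightedSeq (s + 3) →ₗ[ℝ] YM.WeightedSeq (s + 1)) = ⊥ ∧
      (∀ (h : YM.WeightedSeq (s + 3)) (m : ℕ),
        fderiv ℝ M (YM.mode (s + 3) γ K) h m =
          -K ^ 2 * (YM.coeffU (9 / 2) γ m * h m +
            if m ≤ 2 * γ then YM.coeffV γ m * h (2 * γ - m) else 0))) ∧
    YM.NondegeneracyInequalities (9 / 2) γ ∧
    YM.NondegeneracyInequalities (9 / 4) γ :=
  ⟨YM.ccub_lt_q hγ, YM.exists_resonant_operator hγ (t := s + 1) (by omega) hK,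
    YM.nondegeneracyInequalities hγ _ (Or.inl rfl),
    YM.nondegeneracyInequalities hγ _ (Or.inr rfl)⟩
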